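/- **Setting.** Let $m,\mu,c>0$, $\varepsilon\in\mathbb R$, $a(r)=1-2\mu/r$. Consider the Schwarzschild metric $-a\,dt^2+dr^2/a+r^2(d\theta^2+\sin^2\theta\,d\varphi^2)$, $r>2\mu$, $0<\theta<\pi$, with the orthonormal tetrad $e_A$ obtained by normalizing the coordinate basis $y=(t,r,\theta,\varphi)$. The phase variables are $\vec L,\vec M\in\mathbb R^3$, $P=(P_t,P_r,P_\theta,P_\varphi)$ and $y$, with brackets $\{L_i,L_j\}=\epsilon_{ijk}L_k$, $\{L_i,M_j\}=\epsilon_{ijk}M_k$, $\{M_i,M_j\}=-\epsilon_{ijk}L_k$, $\{y^\alpha,P_\beta\}=\delta^\alpha_\beta$. Put $S^{0i}=M_i$, $S^{12}=L_3$, $S^{31}=L_2$, $S^{23}=L_1$ (skew-symmetric, in the tetrad), $S^{\alpha\beta}=S^{AB}e_A^\alpha e_B^\beta$, $p_\alpha=P_\alpha+\tfrac12\omega_{\alpha AB}S^{AB}$ with $\omega_{\alpha AB}=g(e_A,\nabla_\alpha e_B)$, $\mathcal D^\alpha{}_\beta=S^{\alpha\gamma}R_{\gamma\beta\kappa\lambda}S^{\kappa\lambda}$,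 $d=\tfrac12\mathrm{tr}\,\mathcal D$ and $$H=\frac{p^\alpha p_\alpha}{2m}-\frac{\mathcal D^{\alpha\beta}p_\alpha p_\beta}{m(d+2p_\alpha p^\alpha)}$$ on the domain $d+2p_\alpha p^\alpha\neq0$. The full system is $\dot x=\{x,H\}$ (derivative in $\tau$). Its Casimir functions are $C_\star=(\vec L,\vec M)$ and $C_\circ=(\vec L,\vec L)-(\vec M,\vec M)$. Let $\vec Q=(Q_1,Q_2,P_\varphi)$ with $$Q_1=\tfrac{\cos\varphi}{\sin\theta}(L_1-P_\varphi\cos\theta)-P_\theta\sin\varphi,\qquad Q_2=\tfrac{\sin\varphi}{\sin\theta}(L_1-P_\varphi\cos\theta)+P_\theta\cos\varphi.$$ With $\rho=\sqrt{L_2^2+L_3^2}$ and $X=(L_1\cos\theta-P_\varphi)/\sin\theta$ put $$\vec E=\Big(L_1,\tfrac{L_3P_\theta+L_2X}{\rho},\tfrac{-L_2P_\theta+L_3X}{\rho}\Big),\qquad \vec Z=\Big(-\tfrac{M_1|\vec L|}{\rho},|\vec L|,\tfrac{M_2L_3-M_3L_2}{\rho}\Big).$$ All solutions are considered on open intervals.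 **(1) Invariant manifold.** $\vec Q=0$ if and only if $P_\theta=L_1=P_\varphi=0$, and this manifold is invariant. So is its part $\mathcal N$ given by $C_\star=0$, $C_\circ=c^2$, $-P_t=\varepsilon$. **(2) Reduction.** On $C_\star=0$, $\rho\ne0$, the Hamiltonian is a function $H(\vec E,\vec Z,r,P_r)$ depending on the energy $-P_t=\varepsilon$ as a parameter, and $\vec E=0$ if $\vec Q=0$. For $Z_2>0$, $r>2\mu$, $V_0\neq 0$ its restriction $H_0=H|_{\vec E=0}$ equals $$\begin{aligned}H_0=\frac1m\Big\{&a\Big[\tfrac12+\tfrac{2Z_1^2+Z_2^2}{V_0}\Big]P_r^2+\tfrac{Z_2Z_3(Z_1-2r\varepsilon)}{rV_0}P_r+\tfrac{Z_2^2}{r^3V_0}\big[raZ_2^2+\mu Z_1^2\big]\\&-\tfrac{(\mu Z_1-r^2\varepsilon)^2}{r^3(r-2\mu)}\Big[\tfrac12+\tfrac{2Z_1^2-Z_3^2}{V_0}\Big]+\tfrac{Z_2^2}{r}\Big[-\tfrac{\varepsilon Z_1}{V_0}+\tfrac{a}{2r}-\tfrac{aZ_3^2}{rV_0}\Big]\Big\},\end{aligned}$$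 $$V_0=\tfrac{r^3}{\mu}N-2Z_1^2-Z_2^2+Z_3^2,\qquad N=-aP_r^2+\tfrac{(\mu Z_1-\varepsilon r^2)^2}{r^3(r-2\mu)}-\tfrac{aZ_2^2}{r^2}.$$ For every solution of the full system in $\mathcal N$, the variables $(\vec Z,r,P_r)$ satisfy the Hamiltonian system with Hamiltonian $H_0$ and brackets $\{Z_1,Z_2\}=Z_3$, $\{Z_1,Z_3\}=Z_2$, $\{Z_2,Z_3\}=Z_1$, $\{r,P_r\}=1$, and $-Z_1^2+Z_2^2-Z_3^2=c^2$. These brackets define a Poisson structure with Casimir function $C_\circ=-Z_1^2+Z_2^2-Z_3^2$ and have rank $4$ on the leaves $C_\circ=c^2$: two degrees of freedom. **(3) Tulczyjew manifold.** On $\mathcal N$ the Tulczyjew condition $S^{\alpha\beta}p_\beta=0$ is equivalent to $$Z_1P_r+\frac{Z_2Z_3}{r}=0,\qquad \varepsilon Z_1-\frac{\mu Z_1^2}{r^2}+\frac{a(r)}{r}Z_2^2=0 .$$ These relations define an invariant manifold of the reduced system, of which $C_\circ$ and $H_0$ are integrals. Let $\mathcal T$ be its intersection with the leaf $C_\circ=c^2$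 (with $Z_2>0$, $r>2\mu$, $V_0\neq0$). The differentials of $C_\circ$ and of the two left-hand sides are linearly independent on $\mathcal T$, so that the flow on $\mathcal T$ is two-dimensional, except possibly at points where $Z_3=0$ and $2r^2-15\mu r+24\mu^2=0$. On $\mathcal T$ one has $N>0$ and $H_0=p^\alpha p_\alpha/(2m)=-N/(2m)$. **(4) Quadratures on $\mathcal T$.** Consider solutions in $\mathcal T$ on a level $H_0=-\nu^2/(2m)$, $\nu>0$ (physically $\nu=m$). Put $\Delta=\nu^2r^3-\mu c^2$, $R=\varepsilon^2\nu^2r^6-a\varepsilon^2c^2r^4-a\Delta^2$ and $\chi=\Delta-3\mu Z_1^2$. *Case $\varepsilon\ne0$.* Along every solution $\Delta\neq0$, $\chi\ne0$, $R\geq0$, $$Z_1=-\frac{\varepsilon c^2r^2}{\Delta},\quad Z_2=\frac{|\varepsilon|c\nu r^3}{\sqrt a\,|\Delta|},\quad P_r=\frac{s\nu\sqrt R}{a\Delta},\quad Z_3=-\frac{rZ_1P_r}{Z_2},\quad \frac{dr}{d\tau}=s\,\frac{\nu}{m}\,\frac{\sqrt R}{\chi}$$ with a sign $s=\pm1$.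 On every interval $[\tau_1,\tau_2]$ on which $R>0$, the sign in the formulas for $P_r$ and $Z_3$ is constant and $$\tau_2-\tau_1=\int_{r(\tau_1)}^{r(\tau_2)}s\,\frac m\nu\,\frac{\chi(\rho)}{\sqrt{R(\rho)}}\,d\rho .$$ Conversely, every $r(\tau)>2\mu$ with $\Delta\ne0$, $\chi\neq0$, $R>0$ that satisfies this equation for $dr/d\tau$ with a fixed $s$ gives, by these formulas, a solution in $\mathcal T$ on this level. *Case $\varepsilon=0$.* Along every solution $r$ is constant, $\nu^2r^3=\mu c^2$, $2\mu<r<3\mu$, and for some $s=\pm1$ and every $\tau_0$ in the interval $$Z_3(\tau)=Z_3(\tau_0)-s\,\frac{c^2\sqrt\mu\,(3\mu-r)}{mr^3\sqrt{r-2\mu}}(\tau-\tau_0),\quad Z_2=\sqrt{\tfrac{\mu(Z_3^2+c^2)}{3\mu-r}},\quad Z_1=s\sqrt{\tfrac{r-2\mu}{\mu}}\,Z_2,\quad P_r=-\frac{Z_2Z_3}{rZ_1}.$$ **(5) Recovery of $\theta,\varphi,t$.** For every $(\vec Z,r,P_r)$ with $r>2\mu$, $Z_2>0$, $V_0\neq0$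 one has $\partial H/\partial E_3|_{\vec E=0}=0$. Along every solution in $\mathcal N$ the function $K=L_2\sin\theta/\sqrt{L_2^2+L_3^2}$ is a constant $\kappa$, $|\kappa|\le1$, $$L_2=\frac{\kappa Z_2}{\sin\theta},\quad L_3=\pm Z_2\sqrt{1-\frac{\kappa^2}{\sin^2\theta}},\quad M_1=-Z_1,\quad M_2=\frac{Z_3L_3}{Z_2},\quad M_3=-\frac{Z_3L_2}{Z_2},$$ $$\dot\theta=\pm\sqrt{1-\tfrac{\kappa^2}{\sin^2\theta}}\,\tfrac{\partial H}{\partial E_2}\Big|_{\vec E=0}-\tfrac{\kappa}{\sin\theta}\tfrac{\partial H}{\partial E_3}\Big|_{\vec E=0},\quad \dot\varphi=-\tfrac{\kappa}{\sin^2\theta}\tfrac{\partial H}{\partial E_2}\Big|_{\vec E=0}\mp\tfrac1{\sin\theta}\sqrt{1-\tfrac{\kappa^2}{\sin^2\theta}}\,\tfrac{\partial H}{\partial E_3}\Big|_{\vec E=0},\quad \dot t=-\tfrac{\partial H_0}{\partial\varepsilon},$$ with the upper sign if $L_3\geq0$ and the lower one if $L_3\leq0$. With $h(\tau)=\partial H/\partial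 E_2|_{\vec E=0}$ along the reduced solution, $\Phi(\tau)=\int_{\tau_0}^\tau h$ and $w=L_3\sin\theta/Z_2$, $$\cos\theta(\tau)=\cos\theta(\tau_0)\cos\Phi-w(\tau_0)\sin\Phi,\qquad w(\tau)=w(\tau_0)\cos\Phi+\cos\theta(\tau_0)\sin\Phi,$$ $$\varphi(\tau)=\varphi(\tau_0)-\int_{\tau_0}^\tau\frac{\kappa\,h}{\sin^2\theta}\,d\tau',\qquad t(\tau)=t(\tau_0)-\int_{\tau_0}^\tau\frac{\partial H_0}{\partial\varepsilon}\,d\tau' .$$ Conversely, a curve in $\mathcal N$ (inside the domain of the full system) with $L_3\ne0$ of constant sign and $K=\kappa$ constant, whose $(\vec Z,r,P_r)$ solves the reduced system and whose $\theta,\varphi,t$ satisfy these differential equations, is a solution of the full system. -/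

import Mathlib

open scoped Matrix

noncomputable section

namespace SpinningBody

/-- `i`-th partial derivative of a function of finitely many real variables. -/
def partialD {n : ℕ} (F : (Fin n → ℝ) → ℝ) (x : Fin n → ℝ) (i : Fin n) : ℝ :=
  deriv (fun s => F (Function.update x i s)) (x i)

/-- The gradient, as the vector of partial derivatives. -/
def grad {n : ℕ} (F : (Fin n → ℝ) → ℝ) (x : Fin n → ℝ) : Fin n → ℝ :=
  fun i => partialD F x i

/-- A point of the 14-dimensional phase space: the spin vectors `L`, `M`, the momenta
`P = (P_t, P_r, P_θ, P_φ)` and the coordinates `y = (t, r, θ, φ)`. -/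
structure State where
  L : Fin 3 → ℝ
  M : Fin 3 → ℝ
  P : Fin 4 → ℝ
  y : Fin 4 → ℝ

/-! ### The Schwarzschild space-time -/

/-- The function `a(r) = 1 - 2μ/r`. -/
def lapse (μ r : ℝ) : ℝ := 1 - 2 * μ / r

/-- The Schwarzschild metric `g_{αβ}` in the coordinates `(t, r, θ, φ)`. -/
def metric (μ : ℝ) (y : Fin 4 → ℝ) : Matrix (Fin 4) (Fin 4) ℝ :=
  Matrix.diagonal ![-lapse μ (y 1), 1 / lapse μ (y 1), y 1 ^ 2, y 1 ^ 2 * Real.sin (y 2) ^ 2]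

/-- The inverse metric `g^{αβ}`. -/
def metricInv (μ : ℝ) (y : Fin 4 → ℝ) : Matrix (Fin 4) (Fin 4) ℝ :=
  Matrix.diagonal
    ![-1 / lapse μ (y 1), lapse μ (y 1), 1 / y 1 ^ 2, 1 / (y 1 ^ 2 * Real.sin (y 2) ^ 2)]

/-- The orthonormal tetrad: row `A` holds the components `e_A^α`. -/
def tetrad (μ : ℝ) (y : Fin 4 → ℝ) : Matrix (Fin 4) (Fin 4) ℝ :=
  Matrix.diagonal
    ![1 / √(lapse μ (y 1)), √(lapse μ (y 1)), 1 / y 1, 1 / (y 1 * Real.sin (y 2))]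

/-- On the domain used below, `metricInv` is the inverse of `metric`. -/
theorem metric_mul_metricInv (μ : ℝ) (y : Fin 4 → ℝ) (ha : lapse μ (y 1) ≠ 0)
    (hr : y 1 ≠ 0) (hs : Real.sin (y 2) ≠ 0) : metric μ y * metricInv μ y = 1 := by
  rw [metric, metricInv, Matrix.diagonal_mul_diagonal, ← Matrix.diagonal_one]
  congr 1
  funext i
  fin_cases i <;> simp <;> field_simp

/-- The Ricci rotation coefficients `ω_{αAB} = g(e_A, ∇_α e_B)` of the tetrad; the first index
selects the matrix. The nonzero ones are `ω_{t01}`, `ω_{θ12}`, `ω_{φ13}`, `ω_{φ23}` and those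
that follow by antisymmetry in `A`, `B`. -/
def rotationCoeff (μ : ℝ) (y : Fin 4 → ℝ) : Fin 4 → Matrix (Fin 4) (Fin 4) ℝ :=
  ![!![0, -μ / y 1 ^ 2, 0, 0;
       μ / y 1 ^ 2, 0, 0, 0;
       0, 0, 0, 0;
       0, 0, 0, 0],
    0,
    !![0, 0, 0, 0;
       0, 0, -√(lapse μ (y 1)), 0;
       0, √(lapse μ (y 1)), 0, 0;
       0, 0, 0, 0],
    !![0, 0, 0, 0;
       0, 0, 0, -√(lapse μ (y 1)) * Real.sin (y 2);
       0, 0, 0, -Real.cos (y 2);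
       0, √(lapse μ (y 1)) * Real.sin (y 2), Real.cos (y 2), 0]]

/-- The curvature components `R_{αβαβ}` (no summation) of the Schwarzschild metric. -/
def sectional (μ : ℝ) (y : Fin 4 → ℝ) : Matrix (Fin 4) (Fin 4) ℝ :=
  let r := y 1
  let a := lapse μ (y 1)
  let s2 := Real.sin (y 2) ^ 2
  !![0, -2 * μ / r ^ 3, a * μ / r, a * μ / r * s2;
     -2 * μ / r ^ 3, 0, -μ / (r * a), -μ / (r * a) * s2;
     a * μ / r, -μ / (r * a), 0, 2 * μ * r * s2;
     a * μ / r * s2, -μ / (r * a) * s2, 2 * μ * r * s2, 0]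

/-- The curvature tensor `R_{αβγδ}`: for the Schwarzschild metric only `R_{αβαβ}` and the
components obtained from it by antisymmetry in each pair of indices are nonzero. -/
def riemann (μ : ℝ) (y : Fin 4 → ℝ) (α β γ δ : Fin 4) : ℝ :=
  sectional μ y α β *
    ((if α = γ ∧ β = δ then 1 else 0) - (if α = δ ∧ β = γ then 1 else 0))

/-! ### The Hamiltonian system of the spinning body -/

/-- The spin tensor `S^{AB}` in the orthonormal frame. -/
def spinFrame (s : State) : Matrix (Fin 4) (Fin 4) ℝ :=
  !![0, s.M 0, s.M 1, s.M 2;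
     -s.M 0, 0, s.L 2, -s.L 1;
     -s.M 1, -s.L 2, 0, s.L 0;
     -s.M 2, s.L 1, -s.L 0, 0]

/-- The spin tensor `S^{αβ} = S^{AB} e_A^α e_B^β` in the coordinate basis. -/
def spin (μ : ℝ) (s : State) (α β : Fin 4) : ℝ :=
  ∑ A, ∑ B, spinFrame s A B * tetrad μ s.y A α * tetrad μ s.y B β

/-- The linear momentum `p_α = P_α + (1/2) ω_{αAB} S^{AB}`. -/
def momentum (μ : ℝ) (s : State) (α : Fin 4) : ℝ :=
  s.P α + 1 / 2 * ∑ A, ∑ B, rotationCoeff μ s.y α A B * spinFrame s A B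

/-- The square `p^α p_α`. -/
def momentumSq (μ : ℝ) (s : State) : ℝ :=
  ∑ α, ∑ β, metricInv μ s.y α β * momentum μ s α * momentum μ s β

/-- The tensor `D^α_β = S^{αγ} R_{γβκλ} S^{κλ}`. -/
def tensorD (μ : ℝ) (s : State) (α β : Fin 4) : ℝ :=
  ∑ γ, spin μ s α γ * ∑ κ, ∑ l, riemann μ s.y γ β κ l * spin μ s κ l

/-- The scalar `d = (1/2) tr D`. -/
def scalarD (μ : ℝ) (s : State) : ℝ := 1 / 2 * ∑ α, tensorD μ s α α

/-- The Hamiltonian `H = p^α p_α / (2m) - D^{αβ} p_α p_β / (m (d + 2 p_α p^α))`. -/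
def hamiltonian (m μ : ℝ) (s : State) : ℝ :=
  momentumSq μ s / (2 * m) -
    (∑ α, ∑ β, (∑ δ, tensorD μ s α δ * metricInv μ s.y δ β) *
        momentum μ s α * momentum μ s β) /
      (m * (scalarD μ s + 2 * momentumSq μ s))

/-- The vector `f^α = S^{αβ} p_β`, which vanishes under the Tulczyjew condition. -/
def tulczyjew (μ : ℝ) (s : State) (α : Fin 4) : ℝ := ∑ β, spin μ s α β * momentum μ s β

/-- The domain of the system: outside the horizon, away from the axis of the spherical
coordinates, and away from the singularity of the Hamiltonian. -/
def Regular (μ : ℝ) (s : State) : Prop :=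
  2 * μ < s.y 1 ∧ 0 < s.y 2 ∧ s.y 2 < Real.pi ∧ scalarD μ s + 2 * momentumSq μ s ≠ 0

/-- The derivative of the Hamiltonian with respect to `L`. -/
def gradL (m μ : ℝ) (s : State) : Fin 3 → ℝ :=
  grad (fun v => hamiltonian m μ { s with L := v }) s.L

/-- The derivative of the Hamiltonian with respect to `M`. -/
def gradM (m μ : ℝ) (s : State) : Fin 3 → ℝ :=
  grad (fun v => hamiltonian m μ { s with M := v }) s.M

/-- The derivative of the Hamiltonian with respect to `P`. -/
def gradP (m μ : ℝ) (s : State) : Fin 4 → ℝ :=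
  grad (fun v => hamiltonian m μ { s with P := v }) s.P

/-- The derivative of the Hamiltonian with respect to `y`. -/
def gradY (m μ : ℝ) (s : State) : Fin 4 → ℝ :=
  grad (fun v => hamiltonian m μ { s with y := v }) s.y

/-- `x` is a solution on `I` of the equations `ẋ = {x, H}` for the brackets
`{L_i, L_j} = ε_{ijk} L_k`, `{L_i, M_j} = ε_{ijk} M_k`, `{M_i, M_j} = -ε_{ijk} L_k`,
`{y^α, P_β} = δ^α_β`. -/
structure IsMotion (m μ : ℝ) (I : Set ℝ) (x : ℝ → State) : Prop where
  regular : ∀ τ ∈ I, Regular μ (x τ)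
  derivL : ∀ τ ∈ I, HasDerivAt (fun t => (x t).L)
    (gradL m μ (x τ) ⨯₃ (x τ).L + gradM m μ (x τ) ⨯₃ (x τ).M) τ
  derivM : ∀ τ ∈ I, HasDerivAt (fun t => (x t).M)
    (gradL m μ (x τ) ⨯₃ (x τ).M - gradM m μ (x τ) ⨯₃ (x τ).L) τ
  derivP : ∀ τ ∈ I, HasDerivAt (fun t => (x t).P) (-gradY m μ (x τ)) τ
  derivY : ∀ τ ∈ I, HasDerivAt (fun t => (x t).y) (gradP m μ (x τ)) τ

/-- The Casimir function `C_⋆ = (L, M)`. -/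
def casimirStar (s : State) : ℝ := s.L ⬝ᵥ s.M

/-- The Casimir function `C_∘ = (L, L) - (M, M)`. -/
def casimirCirc (s : State) : ℝ := s.L ⬝ᵥ s.L - s.M ⬝ᵥ s.M

/-- The vector integral `Q = (Q₁, Q₂, P_φ)`. -/
def vecQ (s : State) : Fin 3 → ℝ :=
  let θ := s.y 2
  let φ := s.y 3
  ![Real.cos φ / Real.sin θ * (s.L 0 - s.P 3 * Real.cos θ) - s.P 2 * Real.sin φ,
    Real.sin φ / Real.sin θ * (s.L 0 - s.P 3 * Real.cos θ) + s.P 2 * Real.cos φ,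
    s.P 3]

/-- The manifold `P_θ = 0`, `L₁ = 0`, `P_φ = 0`. -/
def OnZeroQ (s : State) : Prop := s.P 2 = 0 ∧ s.L 0 = 0 ∧ s.P 3 = 0

/-- The part of the manifold `P_θ = L₁ = P_φ = 0` that lies on the symplectic leaf
`C_⋆ = 0`, `C_∘ = c²` and on the level `ε` of the energy `-P_t`. -/
def OnZeroQLeaf (c ε : ℝ) (s : State) : Prop :=
  OnZeroQ s ∧ casimirStar s = 0 ∧ casimirCirc s = c ^ 2 ∧ s.P 0 = -ε

/-! ### Reduced variables -/

/-- The reduced vector `E`. -/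
def vecE (s : State) : Fin 3 → ℝ :=
  let ρ := √(s.L 1 ^ 2 + s.L 2 ^ 2)
  let X := (s.L 0 * Real.cos (s.y 2) - s.P 3) / Real.sin (s.y 2)
  ![s.L 0, (s.L 2 * s.P 2 + s.L 1 * X) / ρ, (-s.L 1 * s.P 2 + s.L 2 * X) / ρ]

/-- The reduced vector `Z`. -/
def vecZ (s : State) : Fin 3 → ℝ :=
  let ρ := √(s.L 1 ^ 2 + s.L 2 ^ 2)
  let l := √(s.L ⬝ᵥ s.L)
  ![-(s.M 0 * l) / ρ, l, (s.M 1 * s.L 2 - s.M 2 * s.L 1) / ρ]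

/-- The reduced variables `(Z₁, Z₂, Z₃, r, P_r)` of a state. -/
def redState (s : State) : Fin 5 → ℝ :=
  ![vecZ s 0, vecZ s 1, vecZ s 2, s.y 1, s.P 1]

/-- A state with `C_⋆ = 0`, energy `-P_t = ε` and prescribed reduced variables `E` and
`x = (Z, r, P_r)`. -/
def section3 (ε : ℝ) (E : Fin 3 → ℝ) (x : Fin 5 → ℝ) : State where
  L := ![E 0, √(x 1 ^ 2 - E 0 ^ 2), 0]
  M := ![-(x 0 * √(x 1 ^ 2 - E 0 ^ 2)) / x 1, E 0 * x 0 / x 1, -x 2]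
  P := ![-ε, x 4, -E 2, -E 1]
  y := ![0, x 3, Real.pi / 2, 0]

/-- The Hamiltonian expressed through `E` and `x = (Z, r, P_r)`. -/
def hamiltonianRed (m μ ε : ℝ) (E : Fin 3 → ℝ) (x : Fin 5 → ℝ) : ℝ :=
  hamiltonian m μ (section3 ε E x)

/-- The Hamiltonian `H₀ = H|_{E = 0}` of the reduced system. -/
def hamiltonianZero (m μ ε : ℝ) (x : Fin 5 → ℝ) : ℝ := hamiltonianRed m μ ε 0 x

/-- The derivative `∂H/∂E_i` at `E = 0`. -/
def derivE (m μ ε : ℝ) (i : Fin 3) (x : Fin 5 → ℝ) : ℝ :=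
  partialD (fun E => hamiltonianRed m μ ε E x) 0 i

/-- The derivative `∂H₀/∂ε` with respect to the energy. -/
def derivEnergy (m μ ε : ℝ) (x : Fin 5 → ℝ) : ℝ :=
  deriv (fun e => hamiltonianZero m μ e x) ε

/-- The value `-p^α p_α` in the reduced variables with `E = 0`. -/
def massSq (μ ε : ℝ) (x : Fin 5 → ℝ) : ℝ :=
  -lapse μ (x 3) * x 4 ^ 2 + (μ * x 0 - ε * x 3 ^ 2) ^ 2 / (x 3 ^ 3 * (x 3 - 2 * μ)) -
    lapse μ (x 3) * x 1 ^ 2 / x 3 ^ 2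

/-- The function `V₀`. -/
def funV (μ ε : ℝ) (x : Fin 5 → ℝ) : ℝ :=
  massSq μ ε x * x 3 ^ 3 / μ - 2 * x 0 ^ 2 - x 1 ^ 2 + x 2 ^ 2

/-- The explicit form of the Hamiltonian `H₀`. -/
def hamiltonianZeroExplicit (m μ ε : ℝ) (x : Fin 5 → ℝ) : ℝ :=
  let Z₁ := x 0
  let Z₂ := x 1
  let Z₃ := x 2
  let r := x 3
  let p := x 4
  let a := lapse μ r
  let V := funV μ ε x
  1 / m *
    (a * (1 / 2 + (2 * Z₁ ^ 2 + Z₂ ^ 2) / V) * p ^ 2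
      + Z₂ * Z₃ * (Z₁ - 2 * r * ε) / (r * V) * p
      + Z₂ ^ 2 / (r ^ 3 * V) * (r * a * Z₂ ^ 2 + μ * Z₁ ^ 2)
      - (μ * Z₁ - r ^ 2 * ε) ^ 2 / (r ^ 3 * (r - 2 * μ)) *
          (1 / 2 + (2 * Z₁ ^ 2 - Z₃ ^ 2) / V)
      + Z₂ ^ 2 / r * (-(ε * Z₁) / V + a / (2 * r) - a * Z₃ ^ 2 / (r * V)))

/-- The domain of the reduced system. -/
def RedRegular (μ ε : ℝ) (x : Fin 5 → ℝ) : Prop :=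
  2 * μ < x 3 ∧ 0 < x 1 ∧ funV μ ε x ≠ 0

/-- The matrix of the brackets `{Z₁, Z₂} = Z₃`, `{Z₁, Z₃} = Z₂`, `{Z₂, Z₃} = Z₁`,
`{r, P_r} = 1` of the variables `(Z₁, Z₂, Z₃, r, P_r)`. -/
def poissonMatrix (x : Fin 5 → ℝ) : Matrix (Fin 5) (Fin 5) ℝ :=
  !![0, x 2, x 1, 0, 0;
     -x 2, 0, x 0, 0, 0;
     -x 1, -x 0, 0, 0, 0;
     0, 0, 0, 0, 1;
     0, 0, 0, -1, 0]

/-- `J` is a Poisson structure: it is skew-symmetric and satisfies the Jacobi identity. -/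
def IsPoisson {n : ℕ} (J : (Fin n → ℝ) → Matrix (Fin n) (Fin n) ℝ) : Prop :=
  (∀ x i j, J x j i = -J x i j) ∧
  ∀ x i j k, ∑ l, (J x i l * partialD (fun z => J z j k) x l
    + J x j l * partialD (fun z => J z k i) x l
    + J x k l * partialD (fun z => J z i j) x l) = 0

/-- `γ` is a solution on `I` of the reduced Hamiltonian system, `γ̇ = J(γ) ∇H₀(γ)`. -/
def IsRedMotion (m μ ε : ℝ) (I : Set ℝ) (γ : ℝ → Fin 5 → ℝ) : Prop :=
  ∀ τ ∈ I, RedRegular μ ε (γ τ) ∧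
    HasDerivAt γ (poissonMatrix (γ τ) *ᵥ grad (hamiltonianZero m μ ε) (γ τ)) τ

/-- The Casimir function `C_∘` in the reduced variables. -/
def redCasimir (x : Fin 5 → ℝ) : ℝ := -x 0 ^ 2 + x 1 ^ 2 - x 2 ^ 2

/-- The left-hand side of the first reduced Tulczyjew relation. -/
def tulOne (x : Fin 5 → ℝ) : ℝ := x 0 * x 4 + x 1 * x 2 / x 3

/-- The left-hand side of the second reduced Tulczyjew relation. -/
def tulTwo (μ ε : ℝ) (x : Fin 5 → ℝ) : ℝ :=
  ε * x 0 - μ * x 0 ^ 2 / x 3 ^ 2 + lapse μ (x 3) / x 3 * x 1 ^ 2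

/-- The intersection of the leaf `C_∘ = c²` with the Tulczyjew manifold. -/
def OnTul (μ c ε : ℝ) (x : Fin 5 → ℝ) : Prop :=
  RedRegular μ ε x ∧ redCasimir x = c ^ 2 ∧ tulOne x = 0 ∧ tulTwo μ ε x = 0

/-- The function `K = L₂ sin θ / √(L₂² + L₃²)`. -/
def integralK (s : State) : ℝ := s.L 1 * Real.sin (s.y 2) / √(s.L 1 ^ 2 + s.L 2 ^ 2)

/-! ### Functions of the radius that occur in the quadratures
Here `ν` labels the level `H₀ = -ν² / (2m)`; the physical level is `ν = m`. -/

/-- `Δ(r) = ν² r³ - μ c²`. -/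
def radDelta (μ c ν r : ℝ) : ℝ := ν ^ 2 * r ^ 3 - μ * c ^ 2

/-- `Z₁` as a function of the radius. -/
def radZOne (μ c ε ν r : ℝ) : ℝ := -(ε * c ^ 2 * r ^ 2) / radDelta μ c ν r

/-- `Z₂` as a function of the radius. -/
def radZTwo (μ c ε ν r : ℝ) : ℝ :=
  |ε| * c * ν * r ^ 3 / (√(lapse μ r) * |radDelta μ c ν r|)

/-- `R(r) = ε² ν² r⁶ - a(r) ε² c² r⁴ - a(r) Δ(r)²`. -/
def radR (μ c ε ν r : ℝ) : ℝ :=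
  ε ^ 2 * ν ^ 2 * r ^ 6 - lapse μ r * ε ^ 2 * c ^ 2 * r ^ 4
    - lapse μ r * radDelta μ c ν r ^ 2

/-- `χ(r) = Δ(r) - 3 μ Z₁(r)²`. -/
def radChi (μ c ε ν r : ℝ) : ℝ := radDelta μ c ν r - 3 * μ * radZOne μ c ε ν r ^ 2

/-- `P_r` as a function of the radius and of a sign `s`. -/
def radP (μ c ε ν s r : ℝ) : ℝ :=
  s * ν * √(radR μ c ε ν r) / (lapse μ r * radDelta μ c ν r)

/-- The point `(Z, r, P_r)` determined by the radius and a sign `s`. -/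
def radPoint (μ c ε ν s r : ℝ) : Fin 5 → ℝ :=
  ![radZOne μ c ε ν r, radZTwo μ c ε ν r,
    -(r * radZOne μ c ε ν r * radP μ c ε ν s r) / radZTwo μ c ε ν r,
    r, radP μ c ε ν s r]

end SpinningBody

end

noncomputable section

namespace SpinningBody

/-! ### Calculus of functions of finitely many variables -/

/-! Everything rests on the symmetry of the Hamiltonian in the orthonormal tetrad. There
`hamiltonian` becomes `frameHam`, a function of eleven variables into which θ and P_φ enter only
through X. `frameHam` is invariant under a simultaneous rotation of (L₂,L₃), (M₂,M₃), (X,P_θ), and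
under the reversal of e_θ. The rotation does three things. Its infinitesimal form turns the equation
for L₁ into one in P_θ and X, which makes Q an integral. Turning (L₂,L₃) into (ρ,0) exhibits H on
C_⋆ = 0 as a function of E, Z, r, P_r (`enc_eq_rot`). It also carries the gradient at any point of 𝒩
to the gradient at the section point `secFrame`. The reflection fixes the section points, so the
derivatives in L₁, L₃, M₂, P_θ vanish there; in particular ∂H/∂E₃ = 0.

The field on 𝒩 thus involves only ∇H₀, h = ∂H/∂E₂ and ∂H₀/∂ε (`OnZeroQLeaf.gradients`). The terms
with h turn (L₂,L₃) and (M₂,M₃) rigidly and drop out of Z, which leaves the Poisson system of H₀.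
What h does to the angles is elementary: with (C,S) = (L₂,L₃)/Z₂ one has Ċ = -h cot θ CS, Ṡ = h cot
θ C², θ̇ = hS. Hence C sin θ is constant, and (cos θ, S sin θ) rotates with angular velocity h.

For the Tulczyjew manifold, write T₁, T₂ for the two left-hand sides. The quadratic form
D^{αβ}p_αp_β is a contraction with the vector S^{αβ}p_β, so H₀ = -N/(2m) + U/(mV₀) with U = T₁k₁ +
T₂k₂ + T₃²/a, and T₃ is itself a combination of T₁ and T₂. Explicit cofactors show that {T₁,H₀} and
{T₂,H₀} are combinations of T₁ and T₂. Along a motion (T₁,T₂) therefore solves a homogeneous linear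
system with continuous coefficients, and zero data stay zero. On the manifold itself H₀ = -N/(2m).

On 𝒯 the relations yield Z₁²r²N = aZ₂²c². With N = ν² this and T₂ = 0 give the equation Z₁Δ =
-εc²r², linear in Z₁. If ε ≠ 0, all variables become functions of r up to the sign of P_r, and the
equation for r separates because μV₀ = χ. For the converse, both the velocity of the curve and the
Hamiltonian field are annihilated by dC_∘, dT₁, dT₂, dN and have the same radial component;
`OnTul.tangent_eq_zero` forces them to agree. If ε = 0, then Z₁ ≠ 0 gives Δ = 0, so r is frozen and
Z₃ moves at constant speed. -/

theorem HasFDerivAt.partialD_eq {n : ℕ} {F : (Fin n → ℝ) → ℝ} {F' : (Fin n → ℝ) →L[ℝ] ℝ}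
    {x : Fin n → ℝ} (h : HasFDerivAt F F' x) (i : Fin n) :
    partialD F x i = F' (Pi.single i 1) := by
  have h' : HasFDerivAt F F' (Function.update x i (x i)) := by simpa using h
  exact (h'.comp_hasDerivAt (x i) (hasDerivAt_update x i (x i))).deriv

theorem clm_apply_eq_sum {n : ℕ} (F : (Fin n → ℝ) →L[ℝ] ℝ) (v : Fin n → ℝ) :
    F v = ∑ i, v i * F (Pi.single i 1) := by
  conv_lhs => rw [← Finset.univ_sum_single v]
  rw [map_sum]
  refine Finset.sum_congr rfl fun i _ => ?_
  have : (Pi.single i (v i) : Fin n → ℝ) = v i • Pi.single i 1 := by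
    rw [← Pi.single_smul]; simp
  rw [this, map_smul, smul_eq_mul]

/-- `F` is differentiable at `x` with the vector of partial derivatives `g`. -/
def HasGrad {n : ℕ} (F : (Fin n → ℝ) → ℝ) (g : Fin n → ℝ) (x : Fin n → ℝ) : Prop :=
  HasFDerivAt F (∑ i, g i • (ContinuousLinearMap.proj i : (Fin n → ℝ) →L[ℝ] ℝ)) x

namespace HasGrad

variable {n : ℕ} {F G : (Fin n → ℝ) → ℝ} {f g x : Fin n → ℝ}

theorem partialD_eq (h : HasGrad F f x) (i : Fin n) : partialD F x i = f i := by
  rw [HasFDerivAt.partialD_eq h i]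
  simp [Pi.single_apply]

theorem grad_eq (h : HasGrad F f x) : grad F x = f := funext h.partialD_eq

theorem hasDerivAt_comp {γ : ℝ → Fin n → ℝ} {v : Fin n → ℝ} {t : ℝ}
    (h : HasGrad F f (γ t)) (hγ : HasDerivAt γ v t) :
    HasDerivAt (fun τ => F (γ τ)) (f ⬝ᵥ v) t := by
  refine (HasFDerivAt.comp_hasDerivAt t h hγ).congr_deriv ?_
  simp [dotProduct]

theorem of_differentiableAt (h : DifferentiableAt ℝ F x) : HasGrad F (grad F x) x := by
  have h1 := h.hasFDerivAt
  refine h1.congr_fderiv ?_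
  refine ContinuousLinearMap.ext fun v => ?_
  rw [clm_apply_eq_sum]
  simp [grad, HasFDerivAt.partialD_eq h1, mul_comm]

theorem coord (i : Fin n) : HasGrad (fun z => z i) (Pi.single i 1) x := by
  refine (ContinuousLinearMap.proj (R := ℝ) (φ := fun _ : Fin n => ℝ) i).hasFDerivAt.congr_fderiv ?_
  ext v
  simp [Pi.single_apply]

theorem const (c : ℝ) : HasGrad (fun _ => c) (0 : Fin n → ℝ) x := by
  refine (hasFDerivAt_const c x).congr_fderiv ?_
  ext v
  simp

theorem add (hf : HasGrad F f x) (hg : HasGrad G g x) :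
    HasGrad (fun z => F z + G z) (f + g) x := by
  refine (HasFDerivAt.add hf hg).congr_fderiv ?_
  ext v
  simp [add_mul, Finset.sum_add_distrib]

theorem neg (hf : HasGrad F f x) : HasGrad (fun z => -F z) (-f) x := by
  refine (HasFDerivAt.neg hf).congr_fderiv ?_
  ext v
  simp

theorem sub (hf : HasGrad F f x) (hg : HasGrad G g x) :
    HasGrad (fun z => F z - G z) (f - g) x := by
  refine (HasFDerivAt.sub hf hg).congr_fderiv ?_
  ext v
  simp [sub_mul, Finset.sum_sub_distrib]

theorem mul (hf : HasGrad F f x) (hg : HasGrad G g x) :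
    HasGrad (fun z => F z * G z) (F x • g + G x • f) x := by
  refine (HasFDerivAt.mul hf hg).congr_fderiv ?_
  ext v
  simp [add_mul, Finset.sum_add_distrib, Finset.mul_sum, mul_assoc]

theorem comp {φ : ℝ → ℝ} {d : ℝ} (hφ : HasDerivAt φ d (F x)) (hf : HasGrad F f x) :
    HasGrad (fun z => φ (F z)) (d • f) x := by
  refine (hφ.comp_hasFDerivAt x hf).congr_fderiv ?_
  ext v
  simp [Finset.mul_sum, mul_assoc]

theorem pow (hf : HasGrad F f x) (k : ℕ) :
    HasGrad (fun z => F z ^ k) ((k * F x ^ (k - 1)) • f) x := by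
  simpa using comp (hasDerivAt_pow k (F x)) hf

theorem div (hf : HasGrad F f x) (hg : HasGrad G g x) (h0 : G x ≠ 0) :
    HasGrad (fun z => F z / G z) ((1 / G x) • f - (F x / G x ^ 2) • g) x := by
  have h := hf.mul (comp (hasDerivAt_inv h0) hg)
  simp only [← div_eq_mul_inv] at h
  convert h using 1
  ext i
  simp
  field_simp
  ring

theorem congr_grad (hf : HasGrad F f x) (h : f = g) : HasGrad F g x := h ▸ hf

end HasGrad

/-! ### Functions on open intervals -/

theorem eq_of_hasDerivAt_zero {I : Set ℝ} (hI : IsOpen I) (hc : IsPreconnected I) {f : ℝ → ℝ}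
    (h : ∀ τ ∈ I, HasDerivAt f 0 τ) {τ₀ τ : ℝ} (h₀ : τ₀ ∈ I) (hτ : τ ∈ I) : f τ = f τ₀ :=
  hI.is_const_of_deriv_eq_zero hc (fun t ht => (h t ht).differentiableAt.differentiableWithinAt)
    (fun t ht => (h t ht).deriv) hτ h₀

theorem uIcc_subset_of_isPreconnected {I : Set ℝ} (hc : IsPreconnected I) {τ₀ τ : ℝ}
    (h₀ : τ₀ ∈ I) (hτ : τ ∈ I) : Set.uIcc τ₀ τ ⊆ I :=
  (isPreconnected_iff_ordConnected.1 hc).uIcc_subset h₀ hτ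

theorem eq_add_integral {I : Set ℝ} (hc : IsPreconnected I) {f g : ℝ → ℝ}
    (h : ∀ τ ∈ I, HasDerivAt f (g τ) τ) (hg : ContinuousOn g I) {τ₀ τ : ℝ} (h₀ : τ₀ ∈ I)
    (hτ : τ ∈ I) : f τ = f τ₀ + ∫ t in τ₀..τ, g t := by
  have hs := uIcc_subset_of_isPreconnected hc h₀ hτ
  rw [intervalIntegral.integral_eq_sub_of_hasDerivAt (fun t ht => h t (hs ht))
    (hg.mono hs).intervalIntegrable]
  ring

theorem hasDerivAt_integral {I : Set ℝ} (hI : IsOpen I) (hc : IsPreconnected I) {g : ℝ → ℝ}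
    (hg : ContinuousOn g I) {τ₀ τ : ℝ} (h₀ : τ₀ ∈ I) (hτ : τ ∈ I) :
    HasDerivAt (fun t => ∫ t' in τ₀..t, g t') (g τ) τ := by
  have hs := uIcc_subset_of_isPreconnected hc h₀ hτ
  refine intervalIntegral.integral_hasDerivAt_right (hg.mono hs).intervalIntegrable
    (hg.stronglyMeasurableAtFilter hI τ hτ) (hg.continuousAt (hI.mem_nhds hτ))

/-- A continuous function with values `1` and `-1` is constant on an interval. -/
theorem sign_const {I : Set ℝ} (hc : IsPreconnected I) {f : ℝ → ℝ} (hf : ContinuousOn f I)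
    (h : ∀ τ ∈ I, f τ = 1 ∨ f τ = -1) {τ₀ τ : ℝ} (h₀ : τ₀ ∈ I) (hτ : τ ∈ I) : f τ = f τ₀ := by
  have hd : IsDiscrete ({1, -1} : Set ℝ) := (Set.toFinite _).isDiscrete
  exact hc.constant_of_mapsTo hd hf (fun t ht => by simpa using h t ht) hτ h₀

/-- Uniqueness of the zero solution of a homogeneous linear system. -/
theorem linear_system_zero {I : Set ℝ} (hI : IsOpen I) (hc : IsPreconnected I)
    {u v a b c d : ℝ → ℝ} (ha : ContinuousOn a I) (hb : ContinuousOn b I)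
    (hc' : ContinuousOn c I) (hd : ContinuousOn d I)
    (hu : ∀ τ ∈ I, HasDerivAt u (a τ * u τ + b τ * v τ) τ)
    (hv : ∀ τ ∈ I, HasDerivAt v (c τ * u τ + d τ * v τ) τ)
    {τ₀ τ : ℝ} (h₀ : τ₀ ∈ I) (hτ : τ ∈ I) (hu₀ : u τ₀ = 0) (hv₀ : v τ₀ = 0) :
    u τ = 0 ∧ v τ = 0 := by
  -- Openness leaves room on both sides of τ₀ and τ, so both lie inside a compact [l, k] ⊆ I. There
  -- the coefficients are bounded, which gives one Lipschitz constant for uniqueness.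
  have key : ∀ t ∈ I, ∃ l ∈ I, ∃ k ∈ I, l < t ∧ t < k := by
    intro t ht
    obtain ⟨δ, hδ, hs⟩ := Metric.isOpen_iff.1 hI t ht
    refine ⟨t - δ / 2, hs ?_, t + δ / 2, hs ?_, by linarith, by linarith⟩ <;>
      simp [abs_of_pos hδ] <;> linarith
  obtain ⟨l, hl, -, -, hl', -⟩ := key (min τ₀ τ) (by rcases min_choice τ₀ τ with h | h <;> rwa [h])
  obtain ⟨-, -, k, hk, -, hk'⟩ := key (max τ₀ τ) (by rcases max_choice τ₀ τ with h | h <;> rwa [h])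
  have hs : Set.Icc l k ⊆ I := (isPreconnected_iff_ordConnected.1 hc).out hl hk
  have hlk : Set.Ioo l k ⊆ I := Set.Ioo_subset_Icc_self.trans hs
  obtain ⟨A, hA⟩ := isCompact_Icc.exists_bound_of_continuousOn (ha.mono hs)
  obtain ⟨B, hB⟩ := isCompact_Icc.exists_bound_of_continuousOn (hb.mono hs)
  obtain ⟨C, hC⟩ := isCompact_Icc.exists_bound_of_continuousOn (hc'.mono hs)
  obtain ⟨D, hD⟩ := isCompact_Icc.exists_bound_of_continuousOn (hd.mono hs)
  simp only [Real.norm_eq_abs] at hA hB hC hD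
  have h0k : τ₀ ∈ Set.Ioo l k :=
    ⟨hl'.trans_le (min_le_left _ _), (le_max_left _ _).trans_lt hk'⟩
  have hτk : τ ∈ Set.Ioo l k :=
    ⟨hl'.trans_le (min_le_right _ _), (le_max_right _ _).trans_lt hk'⟩
  have hA0 := (abs_nonneg _).trans (hA τ₀ (Set.Ioo_subset_Icc_self h0k))
  have hB0 := (abs_nonneg _).trans (hB τ₀ (Set.Ioo_subset_Icc_self h0k))
  have hC0 := (abs_nonneg _).trans (hC τ₀ (Set.Ioo_subset_Icc_self h0k))
  have hD0 := (abs_nonneg _).trans (hD τ₀ (Set.Ioo_subset_Icc_self h0k))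
  let w : ℝ → ℝ × ℝ → ℝ × ℝ := fun t y => (a t * y.1 + b t * y.2, c t * y.1 + d t * y.2)
  have hK : 0 ≤ A + B + C + D := by positivity
  -- ℝ × ℝ carries the sup norm: the two rows have constants A + B and C + D, and the sum of all
  -- four bounds dominates both.
  have hlip : ∀ t ∈ Set.Ioo l k, LipschitzOnWith ⟨A + B + C + D, hK⟩ (w t) Set.univ := by
    intro t ht
    have ht' := Set.Ioo_subset_Icc_self ht
    refine LipschitzOnWith.of_dist_le_mul fun y _ z _ => ?_
    have h1 : |y.1 - z.1| ≤ dist y z := by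
      rw [← Real.dist_eq]; exact (le_max_left _ _)
    have h2 : |y.2 - z.2| ≤ dist y z := by
      rw [← Real.dist_eq]; exact (le_max_right _ _)
    have h3 := dist_nonneg (x := y) (y := z)
    have est : ∀ p q P Q : ℝ, |p| ≤ P → |q| ≤ Q →
        |p * y.1 + q * y.2 - (p * z.1 + q * z.2)| ≤ (P + Q) * dist y z := by
      intro p q P Q hp hq
      calc |p * y.1 + q * y.2 - (p * z.1 + q * z.2)|
          = |p * (y.1 - z.1) + q * (y.2 - z.2)| := by congr 1; ring
        _ ≤ |p| * |y.1 - z.1| + |q| * |y.2 - z.2| := by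
            rw [← abs_mul, ← abs_mul]; exact abs_add_le _ _
        _ ≤ P * dist y z + Q * dist y z := by
            gcongr
            · exact (abs_nonneg p).trans hp
            · exact (abs_nonneg q).trans hq
        _ = (P + Q) * dist y z := by ring
    have e1 := est (a t) (b t) A B (hA t ht') (hB t ht')
    have e2 := est (c t) (d t) C D (hC t ht') (hD t ht')
    change max _ _ ≤ (A + B + C + D) * dist y z
    rw [Real.dist_eq, Real.dist_eq]
    refine max_le (e1.trans ?_) (e2.trans ?_) <;>
      exact mul_le_mul_of_nonneg_right (by linarith) h3
  have huv : ∀ t ∈ I, HasDerivAt (fun t => (u t, v t)) (w t (u t, v t)) t :=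
    fun t ht => (hu t ht).prodMk (hv t ht)
  have h := ODE_solution_unique_of_mem_Ioo (g := fun _ => ((0 : ℝ), (0 : ℝ))) hlip h0k
    (fun t ht => ⟨huv t (hlk ht), Set.mem_univ _⟩)
    (fun t ht => ⟨(hasDerivAt_const t ((0 : ℝ), (0 : ℝ))).congr_deriv (by simp [w]; rfl), Set.mem_univ _⟩)
    (by simp [hu₀, hv₀]) hτk
  simpa using h

/-! ### The Hamiltonian in frame components
The coordinates of a vector `v : Fin 11 → ℝ` are `L`, `M`, `P_t`, `P_r`, `P_θ`,
`X = (L₁ cos θ - P_φ) / sin θ` and `r`. -/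

/-- The frame components `q_A = e_A^α p_α` of the linear momentum. -/
def frameQ (μ : ℝ) (v : Fin 11 → ℝ) : Fin 4 → ℝ :=
  ![(v 6 - μ * v 3 / v 10 ^ 2) / √(lapse μ (v 10)), √(lapse μ (v 10)) * v 7,
    (v 8 - √(lapse μ (v 10)) * v 2) / v 10, (√(lapse μ (v 10)) * v 1 - v 9) / v 10]

/-- The square of the linear momentum. -/
def frameSq (μ : ℝ) (v : Fin 11 → ℝ) : ℝ :=
  -frameQ μ v 0 ^ 2 + frameQ μ v 1 ^ 2 + frameQ μ v 2 ^ 2 + frameQ μ v 3 ^ 2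

/-- The frame components of the Tulczyjew vector `S^{AB} q_B`. -/
def frameTul (μ : ℝ) (v : Fin 11 → ℝ) : Fin 4 → ℝ :=
  ![v 3 * frameQ μ v 1 + v 4 * frameQ μ v 2 + v 5 * frameQ μ v 3,
    -v 3 * frameQ μ v 0 + v 2 * frameQ μ v 2 - v 1 * frameQ μ v 3,
    -v 4 * frameQ μ v 0 - v 2 * frameQ μ v 1 + v 0 * frameQ μ v 3,
    -v 5 * frameQ μ v 0 + v 1 * frameQ μ v 1 - v 0 * frameQ μ v 2]

/-- The quadratic form `D^{αβ} p_α p_β`. -/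
def frameD (μ : ℝ) (v : Fin 11 → ℝ) : ℝ :=
  -2 * μ / v 10 ^ 3 *
    (frameTul μ v 0 * (-2 * v 3 * frameQ μ v 1 + v 4 * frameQ μ v 2 + v 5 * frameQ μ v 3)
      + frameTul μ v 1 * (-2 * v 3 * frameQ μ v 0 - v 2 * frameQ μ v 2 + v 1 * frameQ μ v 3)
      + frameTul μ v 2 * (v 4 * frameQ μ v 0 + v 2 * frameQ μ v 1 + 2 * v 0 * frameQ μ v 3)
      + frameTul μ v 3 * (v 5 * frameQ μ v 0 - v 1 * frameQ μ v 1 - 2 * v 0 * frameQ μ v 2))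

/-- The denominator `d + 2 p^α p_α`. -/
def frameDen (μ : ℝ) (v : Fin 11 → ℝ) : ℝ :=
  2 * μ / v 10 ^ 3 *
      (2 * v 3 ^ 2 - v 4 ^ 2 - v 5 ^ 2 + v 1 ^ 2 + v 2 ^ 2 - 2 * v 0 ^ 2) + 2 * frameSq μ v

/-- The Hamiltonian as a function of the frame variables. -/
def frameHam (m μ : ℝ) (v : Fin 11 → ℝ) : ℝ :=
  frameSq μ v / (2 * m) - frameD μ v / (m * frameDen μ v)

/-- The frame variables of a state. -/
def enc (s : State) : Fin 11 → ℝ :=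
  ![s.L 0, s.L 1, s.L 2, s.M 0, s.M 1, s.M 2, s.P 0, s.P 1, s.P 2,
    (s.L 0 * Real.cos (s.y 2) - s.P 3) / Real.sin (s.y 2), s.y 1]

theorem lapse_pos {μ r : ℝ} (hμ : 0 < μ) (hr : 2 * μ < r) : 0 < lapse μ r := by
  have : 0 < r := by linarith
  rw [lapse, sub_pos, div_lt_one this]
  exact hr

/-! ### Passage from coordinate components to frame components -/

theorem spin_eq (μ : ℝ) (s : State) (α β : Fin 4) :
    spin μ s α β = spinFrame s α β * tetrad μ s.y α α * tetrad μ s.y β β := by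
  have h : ∀ A B, A ≠ B → tetrad μ s.y A B = 0 := fun A B hAB => Matrix.diagonal_apply_ne _ hAB
  unfold spin
  rw [Finset.sum_eq_single α, Finset.sum_eq_single β]
  · intro B _ hB
    rw [h B β hB, mul_zero]
  · simp
  · intro A _ hA
    simp [h A α hA]
  · simp

theorem spin_antisymm (μ : ℝ) (s : State) (α β : Fin 4) : spin μ s β α = -spin μ s α β := by
  have h : spinFrame s β α = -spinFrame s α β := by
    fin_cases α <;> fin_cases β <;> simp [spinFrame]
  rw [spin_eq, spin_eq, h]
  ring

/-- The antisymmetrized delta in `riemann` meets an antisymmetric tensor, so its two terms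
contribute equally; hence the factor 2. -/
theorem riemann_contract (μ : ℝ) (s : State) (γ β : Fin 4) :
    ∑ κ, ∑ l, riemann μ s.y γ β κ l * spin μ s κ l =
      2 * sectional μ s.y γ β * spin μ s γ β := by
  have h1 : ∀ κ l, riemann μ s.y γ β κ l * spin μ s κ l =
      (if γ = κ then if β = l then sectional μ s.y γ β * spin μ s κ l else 0 else 0) -
      (if β = κ then if γ = l then sectional μ s.y γ β * spin μ s κ l else 0 else 0) := by
    intro κ l
    unfold riemann
    by_cases hγκ : γ = κ <;> by_cases hβl : β = l <;> by_cases hγl : γ = l <;>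
      by_cases hβκ : β = κ <;> simp [hγκ, hβl, hγl, hβκ] <;> simp_all
  simp only [h1, Finset.sum_sub_distrib]
  simp
  rw [spin_antisymm μ s γ β]
  ring

theorem tensorD_eq (μ : ℝ) (s : State) (α β : Fin 4) :
    tensorD μ s α β = ∑ γ, 2 * sectional μ s.y γ β * spin μ s α γ * spin μ s γ β := by
  unfold tensorD
  refine Finset.sum_congr rfl fun γ _ => ?_
  rw [riemann_contract]
  ring

theorem momentum_eq (μ : ℝ) (s : State) :
    momentum μ s = ![s.P 0 - μ * s.M 0 / s.y 1 ^ 2, s.P 1,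
      s.P 2 - √(lapse μ (s.y 1)) * s.L 2,
      s.P 3 + √(lapse μ (s.y 1)) * Real.sin (s.y 2) * s.L 1 - Real.cos (s.y 2) * s.L 0] := by
  funext α
  fin_cases α <;> simp [momentum, rotationCoeff, spinFrame, Fin.sum_univ_four] <;> ring

section

variable {μ : ℝ} {s : State}

/-- X is chosen for this: in the φ component the factor sin θ cancels and what remains is (√a L₂ -
X)/r, free of θ. -/
theorem momentum_eq_frameQ (ha : 0 < lapse μ (s.y 1)) (hr : s.y 1 ≠ 0)
    (hs : Real.sin (s.y 2) ≠ 0) (α : Fin 4) :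
    tetrad μ s.y α α * momentum μ s α = frameQ μ (enc s) α := by
  have hb : √(lapse μ (s.y 1)) ≠ 0 := (Real.sqrt_pos.2 ha).ne'
  rw [momentum_eq]
  fin_cases α <;> simp [tetrad, frameQ, enc] <;> field_simp
  ring

theorem momentumSq_eq (ha : 0 < lapse μ (s.y 1)) (hr : s.y 1 ≠ 0)
    (hs : Real.sin (s.y 2) ≠ 0) : momentumSq μ s = frameSq μ (enc s) := by
  have h := momentum_eq_frameQ ha hr hs
  have hb : √(lapse μ (s.y 1)) ≠ 0 := (Real.sqrt_pos.2 ha).ne'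
  have hb2 : √(lapse μ (s.y 1)) ^ 2 = lapse μ (s.y 1) := Real.sq_sqrt ha.le
  rw [frameSq, ← h, ← h, ← h, ← h]
  simp only [mul_pow]
  simp [momentumSq, metricInv, Matrix.diagonal_apply, Fin.sum_univ_four, tetrad, hb2]
  ring

/-- In the frame the curvature is μ/r³ times a constant matrix, symmetric in the indices 2 and 3.
This isotropy is behind the rotation invariance of H. -/
theorem spin_sectional (ha : 0 < lapse μ (s.y 1)) (hr : s.y 1 ≠ 0)
    (hs : Real.sin (s.y 2) ≠ 0) (γ β : Fin 4) :
    sectional μ s.y γ β * tetrad μ s.y γ γ ^ 2 * tetrad μ s.y β β ^ 2 =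
      μ / s.y 1 ^ 3 * !![0, -2, 1, 1; -2, 0, -1, -1; 1, -1, 0, 2; 1, -1, 2, 0] γ β := by
  have hb2 : √(lapse μ (s.y 1)) ^ 2 = lapse μ (s.y 1) := Real.sq_sqrt ha.le
  fin_cases γ <;> fin_cases β <;> simp [sectional, tetrad, mul_pow, hb2] <;> field_simp

theorem tetrad_ne_zero (ha : 0 < lapse μ (s.y 1)) (hr : s.y 1 ≠ 0)
    (hs : Real.sin (s.y 2) ≠ 0) (α : Fin 4) : tetrad μ s.y α α ≠ 0 := by
  have hb : √(lapse μ (s.y 1)) ≠ 0 := (Real.sqrt_pos.2 ha).ne'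
  fin_cases α <;> simp [tetrad, hb, hr, hs]

theorem scalarD_eq (ha : 0 < lapse μ (s.y 1)) (hr : s.y 1 ≠ 0)
    (hs : Real.sin (s.y 2) ≠ 0) :
    scalarD μ s = 2 * μ / s.y 1 ^ 3 *
      (2 * s.M 0 ^ 2 - s.M 1 ^ 2 - s.M 2 ^ 2 + s.L 1 ^ 2 + s.L 2 ^ 2 - 2 * s.L 0 ^ 2) := by
  have h1 : ∀ α, tensorD μ s α α = ∑ γ, 2 * (μ / s.y 1 ^ 3 *
      !![0, -2, 1, 1; -2, 0, -1, -1; 1, -1, 0, 2; 1, -1, 2, 0] γ α) *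
        (spinFrame s α γ * spinFrame s γ α) := by
    intro α
    rw [tensorD_eq]
    refine Finset.sum_congr rfl fun γ _ => ?_
    rw [← spin_sectional ha hr hs, spin_eq, spin_eq]
    ring
  simp only [scalarD, h1]
  simp [Fin.sum_univ_four, spinFrame]
  ring

theorem quadraticD_eq (ha : 0 < lapse μ (s.y 1)) (hr : s.y 1 ≠ 0)
    (hs : Real.sin (s.y 2) ≠ 0) :
    ∑ α, ∑ β, (∑ δ, tensorD μ s α δ * metricInv μ s.y δ β) *
        momentum μ s α * momentum μ s β = frameD μ (enc s) := by
  have hb2 : √(lapse μ (s.y 1)) ^ 2 = lapse μ (s.y 1) := Real.sq_sqrt ha.le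
  -- The inverse metric is the Minkowski matrix times squared tetrad factors; those factors turn
  -- coordinate components into frame ones.
  have hg : ∀ δ β, metricInv μ s.y δ β =
      if δ = β then ![-1, 1, 1, 1] δ * tetrad μ s.y δ δ ^ 2 else 0 := by
    intro δ β
    rw [metricInv, Matrix.diagonal_apply]
    refine if_congr Iff.rfl ?_ rfl
    fin_cases δ <;> simp [tetrad, mul_pow, hb2]
    field_simp
  have h1 : ∀ α β, (∑ δ, tensorD μ s α δ * metricInv μ s.y δ β) *
        momentum μ s α * momentum μ s β = ∑ γ, 2 * (μ / s.y 1 ^ 3 *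
      !![0, -2, 1, 1; -2, 0, -1, -1; 1, -1, 0, 2; 1, -1, 2, 0] γ β) *
        (spinFrame s α γ * spinFrame s γ β) * (![-1, 1, 1, 1] β : ℝ) *
          frameQ μ (enc s) α * frameQ μ (enc s) β := by
    intro α β
    simp only [hg, mul_ite, mul_zero, Finset.sum_ite_eq', Finset.mem_univ, if_true]
    rw [tensorD_eq, Finset.sum_mul, Finset.sum_mul, Finset.sum_mul]
    refine Finset.sum_congr rfl fun γ _ => ?_
    rw [← spin_sectional ha hr hs, spin_eq, spin_eq, ← momentum_eq_frameQ ha hr hs,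
      ← momentum_eq_frameQ ha hr hs]
    ring
  simp only [h1]
  obtain ⟨e0, e1, e2, e3, e4, e5, e10⟩ : enc s 0 = s.L 0 ∧ enc s 1 = s.L 1 ∧
      enc s 2 = s.L 2 ∧ enc s 3 = s.M 0 ∧ enc s 4 = s.M 1 ∧ enc s 5 = s.M 2 ∧
      enc s 10 = s.y 1 := by
    simp [enc]
  simp only [frameD, frameTul, e0, e1, e2, e3, e4, e5, e10]
  generalize frameQ μ (enc s) = q
  simp [Fin.sum_univ_four, spinFrame]
  ring

theorem hamiltonian_eq (m : ℝ) (ha : 0 < lapse μ (s.y 1)) (hr : s.y 1 ≠ 0)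
    (hs : Real.sin (s.y 2) ≠ 0) : hamiltonian m μ s = frameHam m μ (enc s) := by
  rw [hamiltonian, frameHam, quadraticD_eq ha hr hs, momentumSq_eq ha hr hs,
    scalarD_eq ha hr hs, frameDen]
  simp [enc]

theorem den_eq (ha : 0 < lapse μ (s.y 1)) (hr : s.y 1 ≠ 0)
    (hs : Real.sin (s.y 2) ≠ 0) :
    scalarD μ s + 2 * momentumSq μ s = frameDen μ (enc s) := by
  rw [momentumSq_eq ha hr hs, scalarD_eq ha hr hs, frameDen]
  simp [enc]

theorem tulczyjew_eq (ha : 0 < lapse μ (s.y 1)) (hr : s.y 1 ≠ 0)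
    (hs : Real.sin (s.y 2) ≠ 0) (α : Fin 4) :
    tulczyjew μ s α = tetrad μ s.y α α * frameTul μ (enc s) α := by
  have h1 : tulczyjew μ s α =
      tetrad μ s.y α α * ∑ β, spinFrame s α β * frameQ μ (enc s) β := by
    rw [tulczyjew, Finset.mul_sum]
    refine Finset.sum_congr rfl fun β _ => ?_
    rw [spin_eq, ← momentum_eq_frameQ ha hr hs]
    ring
  rw [h1]
  congr 1
  simp only [frameTul]
  fin_cases α <;> simp [Fin.sum_univ_four, spinFrame, enc] <;> ring

end

/-! ### Smoothness of the frame Hamiltonian -/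

section

variable {m μ : ℝ} {v : Fin 11 → ℝ}

theorem contDiffAt_frameQ (ha : 0 < lapse μ (v 10)) (hr : v 10 ≠ 0) (i : Fin 4) :
    ContDiffAt ℝ 1 (fun w => frameQ μ w i) v := by
  have hb : √(lapse μ (v 10)) ≠ 0 := (Real.sqrt_pos.2 ha).ne'
  have hl : ContDiffAt ℝ 1 (fun w : Fin 11 → ℝ => √(lapse μ (w 10))) v := by
    refine ContDiffAt.sqrt ?_ ha.ne'
    unfold lapse
    fun_prop (disch := assumption)
  have hr2 : v 10 ^ 2 ≠ 0 := pow_ne_zero 2 hr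
  fin_cases i <;> simp [frameQ] <;> fun_prop (disch := assumption)

/-- Class C¹ is kept, beyond differentiability, because h and ∂H₀/∂ε must be continuous along a
motion in order to be integrated. -/
theorem contDiffAt_frameHam (hm : m ≠ 0) (ha : 0 < lapse μ (v 10)) (hr : v 10 ≠ 0)
    (hd : frameDen μ v ≠ 0) : ContDiffAt ℝ 1 (frameHam m μ) v := by
  have h0 := contDiffAt_frameQ ha hr 0
  have h1 := contDiffAt_frameQ ha hr 1
  have h2 := contDiffAt_frameQ ha hr 2
  have h3 := contDiffAt_frameQ ha hr 3
  have hr3 : v 10 ^ 3 ≠ 0 := pow_ne_zero 3 hr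
  have hsq : ContDiffAt ℝ 1 (frameSq μ) v := by
    unfold frameSq
    fun_prop
  have hden : ContDiffAt ℝ 1 (frameDen μ) v := by
    unfold frameDen
    fun_prop (disch := assumption)
  have hD : ContDiffAt ℝ 1 (frameD μ) v := by
    unfold frameD
    simp only [frameTul, Matrix.cons_val]
    fun_prop (disch := assumption)
  have hmd : m * frameDen μ v ≠ 0 := mul_ne_zero hm hd
  have h2m : 2 * m ≠ 0 := mul_ne_zero two_ne_zero hm
  unfold frameHam
  fun_prop (disch := assumption)

end

/-! ### Symmetries -/

/-- The rotation of `(L₂, L₃)`, `(M₂, M₃)` and `(X, P_θ)` by the angle with cosine `c` and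
sine `s`. -/
def frameRot (c s : ℝ) : (Fin 11 → ℝ) →L[ℝ] (Fin 11 → ℝ) :=
  LinearMap.toContinuousLinearMap
    { toFun := fun v => ![v 0, c * v 1 - s * v 2, s * v 1 + c * v 2, v 3, c * v 4 - s * v 5,
        s * v 4 + c * v 5, v 6, v 7, s * v 9 + c * v 8, c * v 9 - s * v 8, v 10]
      map_add' := fun v w => by
        funext i
        fin_cases i <;> simp <;> ring
      map_smul' := fun k v => by
        funext i
        fin_cases i <;> simp <;> ring }

theorem frameRot_apply (c s : ℝ) (v : Fin 11 → ℝ) :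
    frameRot c s v = ![v 0, c * v 1 - s * v 2, s * v 1 + c * v 2, v 3, c * v 4 - s * v 5,
        s * v 4 + c * v 5, v 6, v 7, s * v 9 + c * v 8, c * v 9 - s * v 8, v 10] := rfl

/-- The reflection that fixes the first axis and reverses the third one. -/
def frameRefl : (Fin 11 → ℝ) →L[ℝ] (Fin 11 → ℝ) :=
  LinearMap.toContinuousLinearMap
    { toFun := fun v => ![-v 0, v 1, -v 2, v 3, -v 4, v 5, v 6, v 7, -v 8, v 9, v 10]
      map_add' := fun v w => by
        funext i
        fin_cases i <;> simp <;> ring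
      map_smul' := fun k v => by
        funext i
        fin_cases i <;> simp }

theorem frameRefl_apply (v : Fin 11 → ℝ) :
    frameRefl v = ![-v 0, v 1, -v 2, v 3, -v 4, v 5, v 6, v 7, -v 8, v 9, v 10] := rfl

/-- Since (X, P_θ) turns together with (L₂, L₃), the momentum components (q₂, q₃) turn by the same
angle. -/
theorem frameQ_rot (μ c s : ℝ) (v : Fin 11 → ℝ) :
    frameQ μ (frameRot c s v) = ![frameQ μ v 0, frameQ μ v 1,
      c * frameQ μ v 2 - s * frameQ μ v 3, s * frameQ μ v 2 + c * frameQ μ v 3] := by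
  funext i
  fin_cases i <;> simp [frameQ, frameRot_apply] <;> ring

theorem frameQ_refl (μ : ℝ) (v : Fin 11 → ℝ) :
    frameQ μ (frameRefl v) = ![frameQ μ v 0, frameQ μ v 1, -frameQ μ v 2, frameQ μ v 3] := by
  funext i
  fin_cases i <;> simp [frameQ, frameRefl_apply] <;> ring

theorem frameSq_rot (μ : ℝ) {c s : ℝ} (h : c ^ 2 + s ^ 2 = 1) (v : Fin 11 → ℝ) :
    frameSq μ (frameRot c s v) = frameSq μ v := by
  simp only [frameSq, frameQ_rot, Matrix.cons_val]
  linear_combination (frameQ μ v 2 ^ 2 + frameQ μ v 3 ^ 2) * h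

theorem frameDen_rot (μ : ℝ) {c s : ℝ} (h : c ^ 2 + s ^ 2 = 1) (v : Fin 11 → ℝ) :
    frameDen μ (frameRot c s v) = frameDen μ v := by
  rw [frameDen, frameDen, frameSq_rot μ h]
  simp only [frameRot_apply, Matrix.cons_val]
  linear_combination 2 * μ / v 10 ^ 3 *
    (v 1 ^ 2 + v 2 ^ 2 - v 4 ^ 2 - v 5 ^ 2) * h

theorem frameTul_rot (μ : ℝ) {c s : ℝ} (h : c ^ 2 + s ^ 2 = 1) (v : Fin 11 → ℝ) :
    frameTul μ (frameRot c s v) = ![frameTul μ v 0, frameTul μ v 1,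
      c * frameTul μ v 2 - s * frameTul μ v 3, s * frameTul μ v 2 + c * frameTul μ v 3] := by
  simp only [frameTul, frameQ_rot]
  generalize frameQ μ v = q
  funext i
  fin_cases i <;> simp only [frameRot_apply, Matrix.cons_val, Fin.zero_eta, Fin.mk_one,
    Fin.reduceFinMk]
  · linear_combination (v 4 * q 2 + v 5 * q 3) * h
  · linear_combination (v 2 * q 2 - v 1 * q 3) * h
  · ring
  · ring

theorem frameD_rot (μ : ℝ) {c s : ℝ} (h : c ^ 2 + s ^ 2 = 1) (v : Fin 11 → ℝ) :
    frameD μ (frameRot c s v) = frameD μ v := by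
  simp only [frameD, frameTul_rot μ h, frameQ_rot]
  generalize frameQ μ v = q
  generalize frameTul μ v = f
  simp only [frameRot_apply, Matrix.cons_val]
  linear_combination (-2 * μ / v 10 ^ 3 *
    (f 0 * (v 4 * q 2 + v 5 * q 3) + f 1 * (-v 2 * q 2 + v 1 * q 3)
      + f 2 * (v 4 * q 0 + v 2 * q 1 + 2 * v 0 * q 3)
      + f 3 * (v 5 * q 0 - v 1 * q 1 - 2 * v 0 * q 2))) * h

/-- The momentum and the Tulczyjew vector rotate in the plane of e_θ and e_φ, where metric and
curvature are isotropic; each ingredient of H is a scalar for these rotations. -/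
theorem frameHam_rot (m μ : ℝ) {c s : ℝ} (h : c ^ 2 + s ^ 2 = 1) (v : Fin 11 → ℝ) :
    frameHam m μ (frameRot c s v) = frameHam m μ v := by
  rw [frameHam, frameHam, frameSq_rot μ h, frameD_rot μ h, frameDen_rot μ h]

/-- This is the reversal of e_θ: every frame component with an odd number of indices 2 changes sign,
and such components occur in H only in pairs. -/
theorem frameHam_refl (m μ : ℝ) (v : Fin 11 → ℝ) :
    frameHam m μ (frameRefl v) = frameHam m μ v := by
  simp only [frameHam, frameD, frameDen, frameTul, frameSq, frameQ_refl]
  generalize frameQ μ v = q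
  simp only [frameRefl_apply, Matrix.cons_val, neg_sq]
  congr 2
  ring

theorem frameRot_inv {c s : ℝ} (h : c ^ 2 + s ^ 2 = 1) (v : Fin 11 → ℝ) :
    frameRot c s (frameRot c (-s) v) = v := by
  funext i
  fin_cases i <;> simp [frameRot_apply] <;>
    first
    | linear_combination v 1 * h
    | linear_combination v 2 * h
    | linear_combination v 4 * h
    | linear_combination v 5 * h
    | linear_combination v 8 * h
    | linear_combination v 9 * h

theorem fderiv_frameHam_rot (m μ : ℝ) {c s : ℝ} (h : c ^ 2 + s ^ 2 = 1) {v : Fin 11 → ℝ}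
    (hd : DifferentiableAt ℝ (frameHam m μ) (frameRot c s v)) (w : Fin 11 → ℝ) :
    fderiv ℝ (frameHam m μ) (frameRot c s v) w =
      fderiv ℝ (frameHam m μ) v (frameRot c (-s) w) := by
  have h1 : HasFDerivAt (frameHam m μ)
      ((fderiv ℝ (frameHam m μ) (frameRot c s v)).comp (frameRot c s)) v :=
    (hd.hasFDerivAt.comp v (frameRot c s).hasFDerivAt).congr_of_eventuallyEq
      (Filter.Eventually.of_forall fun z => (frameHam_rot m μ h z).symm)
  rw [h1.fderiv, ContinuousLinearMap.comp_apply, frameRot_inv h]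

theorem fderiv_frameHam_refl (m μ : ℝ) {v : Fin 11 → ℝ} (hv : frameRefl v = v)
    (hd : DifferentiableAt ℝ (frameHam m μ) v) (w : Fin 11 → ℝ) :
    fderiv ℝ (frameHam m μ) v (frameRefl w) = fderiv ℝ (frameHam m μ) v w := by
  have hd' : DifferentiableAt ℝ (frameHam m μ) (frameRefl v) := by rwa [hv]
  have h1 : HasFDerivAt (frameHam m μ)
      ((fderiv ℝ (frameHam m μ) (frameRefl v)).comp frameRefl) v :=
    (hd'.hasFDerivAt.comp v frameRefl.hasFDerivAt).congr_of_eventuallyEq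
      (Filter.Eventually.of_forall fun z => (frameHam_refl m μ z).symm)
  rw [hv] at h1
  conv_rhs => rw [h1.fderiv, ContinuousLinearMap.comp_apply]

/-- The derivative of the Hamiltonian along the infinitesimal rotation vanishes. -/
theorem fderiv_frameHam_generator (m μ : ℝ) {v : Fin 11 → ℝ}
    (hd : DifferentiableAt ℝ (frameHam m μ) v) :
    fderiv ℝ (frameHam m μ) v ![0, -v 2, v 1, 0, -v 5, v 4, 0, 0, v 9, -v 8, 0] = 0 := by
  have h0 : frameRot (Real.cos 0) (Real.sin 0) v = v := by
    funext i
    fin_cases i <;> simp [frameRot_apply]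
  have h1 : HasDerivAt (fun t => frameRot (Real.cos t) (Real.sin t) v)
      ![0, -v 2, v 1, 0, -v 5, v 4, 0, 0, v 9, -v 8, 0] 0 := by
    have hc : HasDerivAt Real.cos 0 0 := by simpa using Real.hasDerivAt_cos 0
    have hs : HasDerivAt Real.sin 1 0 := by simpa using Real.hasDerivAt_sin 0
    have e1 : ∀ p q : ℝ, HasDerivAt (fun t => Real.cos t * p - Real.sin t * q) (-q) 0 :=
      fun p q => ((hc.mul_const p).sub (hs.mul_const q)).congr_deriv (by ring)
    have e2 : ∀ p q : ℝ, HasDerivAt (fun t => Real.sin t * p + Real.cos t * q) p 0 :=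
      fun p q => ((hs.mul_const p).add (hc.mul_const q)).congr_deriv (by ring)
    refine hasDerivAt_pi.2 fun i => ?_
    fin_cases i <;> simp only [frameRot_apply, Matrix.cons_val, Fin.zero_eta, Fin.mk_one,
      Fin.reduceFinMk] <;> first | exact hasDerivAt_const _ _ | exact e1 _ _ | exact e2 _ _
  have hd' : DifferentiableAt ℝ (frameHam m μ) (frameRot (Real.cos 0) (Real.sin 0) v) := by
    rwa [h0]
  have h2 := hd'.hasFDerivAt.comp_hasDerivAt 0 h1
  have h3 : (frameHam m μ) ∘ (fun t => frameRot (Real.cos t) (Real.sin t) v) =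
      fun _ => frameHam m μ v :=
    funext fun t => frameHam_rot m μ (Real.cos_sq_add_sin_sq t) v
  rw [h3] at h2
  have := h2.unique (hasDerivAt_const _ _)
  rwa [h0] at this

/-! ### The gradient of the Hamiltonian -/

theorem HasGrad.hasDerivAt_update {n : ℕ} {F : (Fin n → ℝ) → ℝ} {g v : Fin n → ℝ}
    (h : HasGrad F g v) {φ : ℝ → ℝ} {d t : ℝ} {j : Fin n} (hφ : HasDerivAt φ d t)
    (ht : φ t = v j) : HasDerivAt (fun τ => F (Function.update v j (φ τ))) (g j * d) t := by
  have h1 : HasDerivAt (fun τ => Function.update v j (φ τ)) (d • Pi.single j 1) t :=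
    (_root_.hasDerivAt_update v j (φ t)).scomp t hφ
  have h2 : HasGrad F g (Function.update v j (φ t)) := by rwa [ht, Function.update_eq_self]
  refine (h2.hasDerivAt_comp (γ := fun τ => Function.update v j (φ τ)) h1).congr_deriv ?_
  simp [mul_comm]

/-- Needed for ∂H/∂L₁: L₁ enters the frame variables twice, as itself and through X. -/
theorem HasGrad.hasDerivAt_update_update {n : ℕ} {F : (Fin n → ℝ) → ℝ} {g v : Fin n → ℝ}
    (h : HasGrad F g v) {φ ψ : ℝ → ℝ} {d e t : ℝ} {i j : Fin n} (hij : i ≠ j)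
    (hφ : HasDerivAt φ d t) (hi : φ t = v i) (hψ : HasDerivAt ψ e t) (hj : ψ t = v j) :
    HasDerivAt (fun τ => F (Function.update (Function.update v i (φ τ)) j (ψ τ)))
      (g i * d + g j * e) t := by
  have h1 : HasDerivAt (fun τ => Function.update (Function.update v i (φ τ)) j (ψ τ))
      (d • Pi.single i 1 + e • Pi.single j 1) t := by
    refine hasDerivAt_pi.2 fun k => ?_
    by_cases hkj : k = j
    · subst hkj
      simpa [Pi.single_apply, hij.symm] using hψ
    · by_cases hki : k = i
      · subst hki
        simpa [Pi.single_apply, hij] using hφ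
      · simpa [Pi.single_apply, hkj, hki] using hasDerivAt_const t (v k)
  have h2 : HasGrad F g (Function.update (Function.update v i (φ t)) j (ψ t)) := by
    rwa [hi, hj, Function.update_eq_self, Function.update_eq_self]
  refine (h2.hasDerivAt_comp
    (γ := fun τ => Function.update (Function.update v i (φ τ)) j (ψ τ)) h1).congr_deriv ?_
  simp [mul_comm]

section

variable {m μ : ℝ}

theorem Regular.radius_pos (hμ : 0 < μ) {s : State} (hs : Regular μ s) : 0 < s.y 1 := by
  linarith [hs.1]

theorem Regular.sin_pos {s : State} (hs : Regular μ s) : 0 < Real.sin (s.y 2) :=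
  Real.sin_pos_of_pos_of_lt_pi hs.2.1 hs.2.2.1

theorem Regular.lapse_pos (hμ : 0 < μ) {s : State} (hs : Regular μ s) : 0 < lapse μ (s.y 1) :=
  SpinningBody.lapse_pos hμ hs.1

theorem Regular.frameDen_ne_zero (hμ : 0 < μ) {s : State} (hs : Regular μ s) :
    frameDen μ (enc s) ≠ 0 := by
  rw [← den_eq (hs.lapse_pos hμ) (hs.radius_pos hμ).ne' hs.sin_pos.ne']
  exact hs.2.2.2

theorem Regular.hasGrad (hm : 0 < m) (hμ : 0 < μ) {s : State} (hs : Regular μ s) :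
    HasGrad (frameHam m μ) (grad (frameHam m μ) (enc s)) (enc s) :=
  HasGrad.of_differentiableAt ((contDiffAt_frameHam hm.ne' (hs.lapse_pos hμ)
    (hs.radius_pos hμ).ne' (hs.frameDen_ne_zero hμ)).differentiableAt one_ne_zero)

theorem enc_update_M (s : State) (t : ℝ) :
    enc { s with M := Function.update s.M 0 t } = Function.update (enc s) 3 t ∧
    enc { s with M := Function.update s.M 1 t } = Function.update (enc s) 4 t ∧
    enc { s with M := Function.update s.M 2 t } = Function.update (enc s) 5 t := by
  refine ⟨?_, ?_, ?_⟩ <;> funext i <;> fin_cases i <;> rfl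

theorem enc_update_L (s : State) (t : ℝ) :
    enc { s with L := Function.update s.L 0 t } =
      Function.update (Function.update (enc s) 0 t) 9
        ((t * Real.cos (s.y 2) - s.P 3) / Real.sin (s.y 2)) ∧
    enc { s with L := Function.update s.L 1 t } = Function.update (enc s) 1 t ∧
    enc { s with L := Function.update s.L 2 t } = Function.update (enc s) 2 t := by
  refine ⟨?_, ?_, ?_⟩ <;> funext i <;> fin_cases i <;> rfl

theorem enc_update_P (s : State) (t : ℝ) :
    enc { s with P := Function.update s.P 0 t } = Function.update (enc s) 6 t ∧
    enc { s with P := Function.update s.P 1 t } = Function.update (enc s) 7 t ∧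
    enc { s with P := Function.update s.P 2 t } = Function.update (enc s) 8 t ∧
    enc { s with P := Function.update s.P 3 t } = Function.update (enc s) 9
      ((s.L 0 * Real.cos (s.y 2) - t) / Real.sin (s.y 2)) := by
  refine ⟨?_, ?_, ?_, ?_⟩ <;> funext i <;> fin_cases i <;> rfl

theorem enc_update_y (s : State) (t : ℝ) :
    enc { s with y := Function.update s.y 0 t } = enc s ∧
    enc { s with y := Function.update s.y 1 t } = Function.update (enc s) 10 t ∧
    enc { s with y := Function.update s.y 2 t } = Function.update (enc s) 9
      ((s.L 0 * Real.cos t - s.P 3) / Real.sin t) ∧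
    enc { s with y := Function.update s.y 3 t } = enc s := by
  refine ⟨?_, ?_, ?_, ?_⟩ <;> funext i <;> fin_cases i <;> rfl

theorem gradM_eq (hm : 0 < m) (hμ : 0 < μ) {s : State} (hs : Regular μ s) :
    gradM m μ s = ![grad (frameHam m μ) (enc s) 3, grad (frameHam m μ) (enc s) 4,
      grad (frameHam m μ) (enc s) 5] := by
  have hg := hs.hasGrad hm hμ
  have hH : ∀ v, hamiltonian m μ { s with M := v } = frameHam m μ (enc { s with M := v }) :=
    fun v => hamiltonian_eq (s := { s with M := v }) m (hs.lapse_pos hμ)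
      (hs.radius_pos hμ).ne' hs.sin_pos.ne'
  funext i
  fin_cases i <;> refine HasDerivAt.deriv ?_ <;>
    simp only [hH, enc_update_M, Fin.zero_eta, Fin.mk_one, Fin.reduceFinMk] <;>
    simpa using hg.hasDerivAt_update (hasDerivAt_id _) (by rfl)

theorem gradL_eq (hm : 0 < m) (hμ : 0 < μ) {s : State} (hs : Regular μ s) :
    gradL m μ s = ![grad (frameHam m μ) (enc s) 0 +
      Real.cos (s.y 2) / Real.sin (s.y 2) * grad (frameHam m μ) (enc s) 9,
      grad (frameHam m μ) (enc s) 1, grad (frameHam m μ) (enc s) 2] := by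
  have hg := hs.hasGrad hm hμ
  have hH : ∀ v, hamiltonian m μ { s with L := v } = frameHam m μ (enc { s with L := v }) :=
    fun v => hamiltonian_eq (s := { s with L := v }) m (hs.lapse_pos hμ)
      (hs.radius_pos hμ).ne' hs.sin_pos.ne'
  funext i
  fin_cases i <;> refine HasDerivAt.deriv ?_ <;>
    simp only [hH, enc_update_L, Fin.zero_eta, Fin.mk_one, Fin.reduceFinMk]
  · have h1 : HasDerivAt (fun t => (t * Real.cos (s.y 2) - s.P 3) / Real.sin (s.y 2))
        (Real.cos (s.y 2) / Real.sin (s.y 2)) (s.L 0) := by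
      simpa using (((hasDerivAt_id (s.L 0)).mul_const (Real.cos (s.y 2))).sub_const
        (s.P 3)).div_const (Real.sin (s.y 2))
    refine (hg.hasDerivAt_update_update (by decide) (hasDerivAt_id _) (by rfl) h1
      (by rfl)).congr_deriv ?_
    simp [mul_comm]
  · simpa using hg.hasDerivAt_update (hasDerivAt_id _) (by rfl)
  · simpa using hg.hasDerivAt_update (hasDerivAt_id _) (by rfl)

theorem gradP_eq (hm : 0 < m) (hμ : 0 < μ) {s : State} (hs : Regular μ s) :
    gradP m μ s = ![grad (frameHam m μ) (enc s) 6, grad (frameHam m μ) (enc s) 7,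
      grad (frameHam m μ) (enc s) 8,
      -(grad (frameHam m μ) (enc s) 9 / Real.sin (s.y 2))] := by
  have hg := hs.hasGrad hm hμ
  have hH : ∀ v, hamiltonian m μ { s with P := v } = frameHam m μ (enc { s with P := v }) :=
    fun v => hamiltonian_eq (s := { s with P := v }) m (hs.lapse_pos hμ)
      (hs.radius_pos hμ).ne' hs.sin_pos.ne'
  funext i
  fin_cases i <;> refine HasDerivAt.deriv ?_ <;>
    simp only [hH, enc_update_P, Fin.zero_eta, Fin.mk_one, Fin.reduceFinMk]
  · simpa using hg.hasDerivAt_update (hasDerivAt_id _) (by rfl)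
  · simpa using hg.hasDerivAt_update (hasDerivAt_id _) (by rfl)
  · simpa using hg.hasDerivAt_update (hasDerivAt_id _) (by rfl)
  · have h1 : HasDerivAt (fun t => (s.L 0 * Real.cos (s.y 2) - t) / Real.sin (s.y 2))
        (-1 / Real.sin (s.y 2)) (s.P 3) := by
      simpa using ((hasDerivAt_id (s.P 3)).const_sub (s.L 0 * Real.cos (s.y 2))).div_const
        (Real.sin (s.y 2))
    refine (hg.hasDerivAt_update h1 (by rfl)).congr_deriv ?_
    simp
    ring

theorem gradY_eq (hm : 0 < m) (hμ : 0 < μ) {s : State} (hs : Regular μ s) :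
    gradY m μ s = ![0, grad (frameHam m μ) (enc s) 10,
      (s.P 3 * Real.cos (s.y 2) - s.L 0) / Real.sin (s.y 2) ^ 2 *
        grad (frameHam m μ) (enc s) 9, 0] := by
  have hg := hs.hasGrad hm hμ
  have hH : ∀ v : Fin 4 → ℝ, 0 < lapse μ (v 1) → v 1 ≠ 0 → Real.sin (v 2) ≠ 0 →
      hamiltonian m μ { s with y := v } = frameHam m μ (enc { s with y := v }) :=
    fun v h1 h2 h3 => hamiltonian_eq (s := { s with y := v }) m h1 h2 h3
  have ha := hs.lapse_pos hμ
  have hr := (hs.radius_pos hμ).ne'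
  have hsin := hs.sin_pos.ne'
  funext i
  fin_cases i <;> refine HasDerivAt.deriv ?_ <;>
    simp only [Fin.zero_eta, Fin.mk_one, Fin.reduceFinMk]
  · refine (hasDerivAt_const (s.y 0) (frameHam m μ (enc s))).congr_of_eventuallyEq
      (Filter.Eventually.of_forall fun t => ?_)
    simp only
    rw [hH (Function.update s.y 0 t) (by simpa using ha) (by simpa using hr)
      (by simpa using hsin), (enc_update_y s t).1]
  · have h1 := hg.hasDerivAt_update (j := 10) (hasDerivAt_id (s.y 1)) (by rfl)
    refine (h1.congr_of_eventuallyEq ?_).congr_deriv (by simp)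
    -- The frame form of H holds only outside the horizon, so the two functions of r agree near the
    -- point and not everywhere.
    filter_upwards [lt_mem_nhds hs.1] with t ht
    rw [hH, (enc_update_y s t).2.1]
    · rfl
    · simpa using SpinningBody.lapse_pos hμ ht
    · simp; linarith
    · simpa using hsin
  · have h0 : HasDerivAt (fun t => (s.L 0 * Real.cos t - s.P 3) / Real.sin t)
        ((s.P 3 * Real.cos (s.y 2) - s.L 0) / Real.sin (s.y 2) ^ 2) (s.y 2) := by
      refine ((((Real.hasDerivAt_cos (s.y 2)).const_mul (s.L 0)).sub_const (s.P 3)).div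
        (Real.hasDerivAt_sin (s.y 2)) hsin).congr_deriv ?_
      congr 1
      linear_combination -s.L 0 * Real.sin_sq_add_cos_sq (s.y 2)
    have h1 := hg.hasDerivAt_update (j := 9) h0 (by rfl)
    refine (h1.congr_of_eventuallyEq ?_).congr_deriv (mul_comm _ _)
    filter_upwards [lt_mem_nhds hs.2.1, gt_mem_nhds hs.2.2.1] with t ht ht'
    rw [hH, (enc_update_y s t).2.2.1]
    · simpa using ha
    · simpa using hr
    · simpa using (Real.sin_pos_of_pos_of_lt_pi ht ht').ne'
  · refine (hasDerivAt_const (s.y 3) (frameHam m μ (enc s))).congr_of_eventuallyEq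
      (Filter.Eventually.of_forall fun t => ?_)
    simp only
    rw [hH (Function.update s.y 3 t) (by simpa using ha) (by simpa using hr)
      (by simpa using hsin), (enc_update_y s t).2.2.2]

end

/-! ### Invariance of the manifold `Q = 0` -/

section

variable {m μ : ℝ}

theorem dotProduct_fin_three (v w : Fin 3 → ℝ) :
    v ⬝ᵥ w = v 0 * w 0 + v 1 * w 1 + v 2 * w 2 := by
  rw [dotProduct, Fin.sum_univ_three]

/-- (Q₁, Q₂) is the vector ((L₁ - P_φ cos θ)/sin θ, P_θ) rotated by φ. Undoing the rotation gives
P_θ = 0, and L₁ = 0 once P_φ = 0. -/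
theorem vecQ_eq_zero_iff {s : State} (hs : Regular μ s) : vecQ s = 0 ↔ OnZeroQ s := by
  have hsin := hs.sin_pos.ne'
  have h1 := Real.sin_sq_add_cos_sq (s.y 3)
  constructor
  · intro h
    have e0 := congrFun h 0
    have e1 := congrFun h 1
    have e2 := congrFun h 2
    simp only [vecQ, Matrix.cons_val, Pi.zero_apply] at e0 e1 e2
    rw [e2, zero_mul, sub_zero] at e0 e1
    refine ⟨?_, ?_, e2⟩
    · linear_combination Real.cos (s.y 3) * e1 - Real.sin (s.y 3) * e0 - s.P 2 * h1
    · have : s.L 0 / Real.sin (s.y 2) = 0 := by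
        linear_combination Real.cos (s.y 3) * e0 + Real.sin (s.y 3) * e1 -
          s.L 0 / Real.sin (s.y 2) * h1
      rwa [div_eq_zero_iff, or_iff_left hsin] at this
  · rintro ⟨h2, h0, h3⟩
    funext i
    fin_cases i <;> simp [vecQ, h0, h2, h3]

/-- The spin part of the rotation generator is -L̇₁. Invariance of H trades it for the part of the
generator that acts on (P_θ, X). -/
theorem IsMotion.hasDerivAt_L0 (hm : 0 < m) (hμ : 0 < μ) {I : Set ℝ} {x : ℝ → State}
    (hx : IsMotion m μ I x) {τ : ℝ} (hτ : τ ∈ I) :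
    HasDerivAt (fun t => (x t).L 0) (enc (x τ) 9 * grad (frameHam m μ) (enc (x τ)) 8 -
      (x τ).P 2 * grad (frameHam m μ) (enc (x τ)) 9) τ := by
  have hs := hx.regular τ hτ
  refine (hasDerivAt_pi.1 (hx.derivL τ hτ) 0).congr_deriv ?_
  have hg := hs.hasGrad hm hμ
  have hd : DifferentiableAt ℝ (frameHam m μ) (enc (x τ)) := HasFDerivAt.differentiableAt hg
  have h := fderiv_frameHam_generator m μ hd
  rw [HasFDerivAt.fderiv hg] at h
  simp only [Fin.sum_univ_succ] at h
  rw [gradL_eq hm hμ hs, gradM_eq hm hμ hs]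
  simp [crossProduct, enc] at h ⊢
  linear_combination -h

theorem hasDerivAt_vecQ (hm : 0 < m) (hμ : 0 < μ) {I : Set ℝ} {x : ℝ → State}
    (hx : IsMotion m μ I x) {τ : ℝ} (hτ : τ ∈ I) (i : Fin 3) :
    HasDerivAt (fun t => vecQ (x t) i) 0 τ := by
  have hs := hx.regular τ hτ
  have hsin := hs.sin_pos.ne'
  have hL := hx.hasDerivAt_L0 hm hμ hτ
  have hθ := hasDerivAt_pi.1 (hx.derivY τ hτ) 2
  have hφ := hasDerivAt_pi.1 (hx.derivY τ hτ) 3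
  have hP := hasDerivAt_pi.1 (hx.derivP τ hτ) 2
  have hP3 := hasDerivAt_pi.1 (hx.derivP τ hτ) 3
  rw [gradP_eq hm hμ hs] at hθ hφ
  simp only [Pi.neg_apply] at hP hP3
  rw [gradY_eq hm hμ hs] at hP hP3
  simp only [Matrix.cons_val, neg_zero] at hθ hφ hP hP3
  have h9 : enc (x τ) 9 = ((x τ).L 0 * Real.cos ((x τ).y 2) - (x τ).P 3) /
    Real.sin ((x τ).y 2) := rfl
  rw [h9] at hL
  -- This is the derivative of L₁ - P_φ cos θ, the factor shared by Q₁ and Q₂.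
  have hA := hL.sub (hP3.mul hθ.cos)
  have h1 := Real.sin_sq_add_cos_sq ((x τ).y 2)
  generalize grad (frameHam m μ) (enc (x τ)) = g at *
  fin_cases i
  · refine (((hφ.cos.div hθ.sin hsin).mul hA).sub (hP.mul hφ.sin)).congr_deriv ?_
    simp
    field_simp
    rw [Real.sin_sq]
    ring
  · refine (((hφ.sin.div hθ.sin hsin).mul hA).add (hP.mul hφ.cos)).congr_deriv ?_
    simp
    field_simp
    rw [Real.sin_sq]
    ring
  · exact hP3

theorem vecQ_const (hm : 0 < m) (hμ : 0 < μ) {I : Set ℝ} (hI : IsOpen I)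
    (hc : IsPreconnected I) {x : ℝ → State} (hx : IsMotion m μ I x) {τ₀ τ : ℝ} (h₀ : τ₀ ∈ I)
    (hτ : τ ∈ I) : vecQ (x τ) = vecQ (x τ₀) :=
  funext fun i =>
    eq_of_hasDerivAt_zero hI hc (fun _ ht => hasDerivAt_vecQ hm hμ hx ht i) h₀ hτ

theorem onZeroQ_invariant (hm : 0 < m) (hμ : 0 < μ) {I : Set ℝ} (hI : IsOpen I)
    (hc : IsPreconnected I) {x : ℝ → State} (hx : IsMotion m μ I x) {τ₀ τ : ℝ} (h₀ : τ₀ ∈ I)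
    (hτ : τ ∈ I) (h : OnZeroQ (x τ₀)) : OnZeroQ (x τ) := by
  rw [← vecQ_eq_zero_iff (hx.regular τ hτ), vecQ_const hm hμ hI hc hx h₀ hτ]
  exact (vecQ_eq_zero_iff (hx.regular τ₀ h₀)).2 h

/-- No property of H is used: by antisymmetry of the triple product the terms cancel for arbitrary
gradients. -/
theorem casimirStar_const {I : Set ℝ} (hI : IsOpen I)
    (hc : IsPreconnected I) {x : ℝ → State} (hx : IsMotion m μ I x) {τ₀ τ : ℝ} (h₀ : τ₀ ∈ I)
    (hτ : τ ∈ I) : casimirStar (x τ) = casimirStar (x τ₀) := by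
  refine eq_of_hasDerivAt_zero hI hc (f := fun t => casimirStar (x t)) (fun t ht => ?_) h₀ hτ
  have hL := hasDerivAt_pi.1 (hx.derivL t ht)
  have hM := hasDerivAt_pi.1 (hx.derivM t ht)
  simp only [casimirStar, dotProduct_fin_three]
  refine ((((hL 0).mul (hM 0)).add ((hL 1).mul (hM 1))).add ((hL 2).mul (hM 2))).congr_deriv ?_
  simp [crossProduct]
  ring

theorem casimirCirc_const {I : Set ℝ} (hI : IsOpen I)
    (hc : IsPreconnected I) {x : ℝ → State} (hx : IsMotion m μ I x) {τ₀ τ : ℝ} (h₀ : τ₀ ∈ I)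
    (hτ : τ ∈ I) : casimirCirc (x τ) = casimirCirc (x τ₀) := by
  refine eq_of_hasDerivAt_zero hI hc (f := fun t => casimirCirc (x t)) (fun t ht => ?_) h₀ hτ
  have hL := hasDerivAt_pi.1 (hx.derivL t ht)
  have hM := hasDerivAt_pi.1 (hx.derivM t ht)
  simp only [casimirCirc, dotProduct_fin_three]
  refine (((((hL 0).mul (hL 0)).add ((hL 1).mul (hL 1))).add ((hL 2).mul (hL 2))).sub
    ((((hM 0).mul (hM 0)).add ((hM 1).mul (hM 1))).add ((hM 2).mul (hM 2)))).congr_deriv ?_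
  simp [crossProduct]
  ring

theorem energy_const (hm : 0 < m) (hμ : 0 < μ) {I : Set ℝ} (hI : IsOpen I)
    (hc : IsPreconnected I) {x : ℝ → State} (hx : IsMotion m μ I x) {τ₀ τ : ℝ} (h₀ : τ₀ ∈ I)
    (hτ : τ ∈ I) : (x τ).P 0 = (x τ₀).P 0 := by
  refine eq_of_hasDerivAt_zero hI hc (f := fun t => (x t).P 0) (fun t ht => ?_) h₀ hτ
  refine (hasDerivAt_pi.1 (hx.derivP t ht) 0).congr_deriv ?_
  simp [gradY_eq hm hμ (hx.regular t ht)]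

theorem onZeroQLeaf_invariant (hm : 0 < m) (hμ : 0 < μ) {c ε : ℝ} {I : Set ℝ} (hI : IsOpen I)
    (hc : IsPreconnected I) {x : ℝ → State} (hx : IsMotion m μ I x) {τ₀ τ : ℝ} (h₀ : τ₀ ∈ I)
    (hτ : τ ∈ I) (h : OnZeroQLeaf c ε (x τ₀)) : OnZeroQLeaf c ε (x τ) :=
  ⟨onZeroQ_invariant hm hμ hI hc hx h₀ hτ h.1,
    (casimirStar_const hI hc hx h₀ hτ).trans h.2.1,
    (casimirCirc_const hI hc hx h₀ hτ).trans h.2.2.1,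
    (energy_const hm hμ hI hc hx h₀ hτ).trans h.2.2.2⟩

end

/-! ### Reduction of the Hamiltonian -/

section

variable {m μ : ℝ}

theorem enc_section3 (ε : ℝ) (E : Fin 3 → ℝ) (x : Fin 5 → ℝ) :
    enc (section3 ε E x) = ![E 0, √(x 1 ^ 2 - E 0 ^ 2), 0,
      -(x 0 * √(x 1 ^ 2 - E 0 ^ 2)) / x 1, E 0 * x 0 / x 1, -x 2, -ε, x 4, -E 2, E 1, x 3] := by
  funext i
  fin_cases i <;> simp [enc, section3]

theorem hamiltonianRed_eq (m : ℝ) (hμ : 0 < μ) (ε : ℝ) (E : Fin 3 → ℝ) {x : Fin 5 → ℝ}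
    (hr : 2 * μ < x 3) :
    hamiltonianRed m μ ε E x = frameHam m μ (enc (section3 ε E x)) := by
  refine hamiltonian_eq m ?_ ?_ ?_
  · simpa [section3] using lapse_pos hμ hr
  · simp [section3]; linarith
  · simp [section3]

/-- Turning (L₂, L₃) into (ρ, 0) leaves variables determined by E, Z, r, P_r. The component of (M₂,
M₃) across (L₂, L₃) is Z₃ up to sign; the component along it follows from L₁ and M₁ by C_⋆ = 0. -/
theorem enc_eq_rot {s : State} (hC : casimirStar s = 0) (hρ : 0 < s.L 1 ^ 2 + s.L 2 ^ 2) :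
    enc s = frameRot (s.L 1 / √(s.L 1 ^ 2 + s.L 2 ^ 2)) (s.L 2 / √(s.L 1 ^ 2 + s.L 2 ^ 2))
      (enc (section3 (-s.P 0) (vecE s) (redState s))) := by
  have hl : 0 < s.L ⬝ᵥ s.L := by
    rw [dotProduct_fin_three]; nlinarith [sq_nonneg (s.L 0)]
  have hρ0 := (Real.sqrt_pos.2 hρ).ne'
  have hρ2 := Real.sq_sqrt hρ.le
  have hl0 := (Real.sqrt_pos.2 hl).ne'
  have hl2 := Real.sq_sqrt hl.le
  have hsq : √(√(s.L ⬝ᵥ s.L) ^ 2 - s.L 0 ^ 2) = √(s.L 1 ^ 2 + s.L 2 ^ 2) := by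
    rw [hl2, dotProduct_fin_three]; congr 1; ring
  rw [casimirStar, dotProduct_fin_three] at hC
  rw [enc_section3, frameRot_apply]
  funext i
  fin_cases i <;> simp [enc, redState, vecE, vecZ, hsq] <;> field_simp <;> try rw [hρ2]
  all_goals try ring1
  · linear_combination s.L 1 * hC
  · linear_combination s.L 2 * hC

theorem rot_sq_add_sq {s : State} (hρ : 0 < s.L 1 ^ 2 + s.L 2 ^ 2) :
    (s.L 1 / √(s.L 1 ^ 2 + s.L 2 ^ 2)) ^ 2 + (s.L 2 / √(s.L 1 ^ 2 + s.L 2 ^ 2)) ^ 2 = 1 := by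
  rw [div_pow, div_pow, Real.sq_sqrt hρ.le]
  field_simp

theorem hamiltonian_eq_hamiltonianRed (hμ : 0 < μ) {s : State} (hs : Regular μ s)
    (hC : casimirStar s = 0) (hρ : 0 < s.L 1 ^ 2 + s.L 2 ^ 2) :
    hamiltonian m μ s = hamiltonianRed m μ (-s.P 0) (vecE s) (redState s) := by
  rw [hamiltonian_eq m (hs.lapse_pos hμ) (hs.radius_pos hμ).ne' hs.sin_pos.ne',
    hamiltonianRed_eq m hμ _ _ (by simpa [redState] using hs.1), enc_eq_rot hC hρ,
    frameHam_rot m μ (rot_sq_add_sq hρ)]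

theorem vecE_eq_zero {s : State} (h : OnZeroQ s) : vecE s = 0 := by
  obtain ⟨h2, h0, h3⟩ := h
  funext i
  fin_cases i <;> simp [vecE, h0, h2, h3]

end

/-! ### The gradient on the manifold `Q = 0` -/

/-- The frame variables on the section `E = 0`. -/
def secFrame (ε : ℝ) (x : Fin 5 → ℝ) : Fin 11 → ℝ :=
  ![0, x 1, 0, -x 0, 0, -x 2, -ε, x 4, 0, 0, x 3]

theorem grad_frameHam_apply {m μ : ℝ} {v : Fin 11 → ℝ}
    (hd : DifferentiableAt ℝ (frameHam m μ) v) (i : Fin 11) :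
    grad (frameHam m μ) v i = fderiv ℝ (frameHam m μ) v (Pi.single i 1) :=
  HasFDerivAt.partialD_eq hd.hasFDerivAt i

/-- A rotation is orthogonal, so the gradient of an invariant function is carried along as a vector.
-/
theorem grad_frameHam_rot {m μ c s : ℝ} (h : c ^ 2 + s ^ 2 = 1) {v : Fin 11 → ℝ}
    (hd : DifferentiableAt ℝ (frameHam m μ) (frameRot c s v))
    (hd' : DifferentiableAt ℝ (frameHam m μ) v) :
    grad (frameHam m μ) (frameRot c s v) = frameRot c s (grad (frameHam m μ) v) := by
  funext i
  rw [grad_frameHam_apply hd, fderiv_frameHam_rot m μ h hd, clm_apply_eq_sum]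
  simp only [← grad_frameHam_apply hd']
  generalize grad (frameHam m μ) v = g
  simp only [Fin.sum_univ_succ, frameRot_apply]
  fin_cases i <;> simp [Fin.succ, Fin.ext_iff] <;> ring

section

variable {m μ ε : ℝ} {x : Fin 5 → ℝ}

theorem RedRegular.radius_pos (hμ : 0 < μ) (hx : RedRegular μ ε x) : 0 < x 3 := by
  linarith [hx.1]

theorem RedRegular.lapse_pos (hμ : 0 < μ) (hx : RedRegular μ ε x) : 0 < lapse μ (x 3) :=
  SpinningBody.lapse_pos hμ hx.1

theorem enc_section3_zero (hx : 0 < x 1) : enc (section3 ε 0 x) = secFrame ε x := by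
  rw [enc_section3, secFrame]
  funext i
  fin_cases i <;> simp [Real.sqrt_sq hx.le]
  field_simp

theorem frameSq_secFrame (hμ : 0 < μ) (hr : 2 * μ < x 3) :
    frameSq μ (secFrame ε x) = -massSq μ ε x := by
  have hr0 : 0 < x 3 := by linarith
  have ha := lapse_pos hμ hr
  have hsq := Real.sq_sqrt ha.le
  have hr2 : x 3 - 2 * μ ≠ 0 := by linarith
  simp [frameSq, frameQ, secFrame, massSq, div_pow, mul_pow, hsq]
  rw [lapse]
  field_simp
  ring

/-- Identifies V₀ ≠ 0 with the regularity condition d + 2p^αp_α ≠ 0 on the section. -/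
theorem frameDen_secFrame (hμ : 0 < μ) (hr : 2 * μ < x 3) :
    frameDen μ (secFrame ε x) = -(2 * μ / x 3 ^ 3) * funV μ ε x := by
  have hr0 : 0 < x 3 := by linarith
  rw [frameDen, frameSq_secFrame hμ hr, funV]
  simp [secFrame]
  field_simp
  ring

theorem RedRegular.contDiffAt (hm : 0 < m) (hμ : 0 < μ) (hx : RedRegular μ ε x) :
    ContDiffAt ℝ 1 (frameHam m μ) (secFrame ε x) := by
  refine contDiffAt_frameHam hm.ne' (hx.lapse_pos hμ) (hx.radius_pos hμ).ne' ?_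
  rw [frameDen_secFrame hμ hx.1]
  have := hx.radius_pos hμ
  exact mul_ne_zero (neg_ne_zero.2 (by positivity)) hx.2.2

theorem RedRegular.hasGrad (hm : 0 < m) (hμ : 0 < μ) (hx : RedRegular μ ε x) :
    HasGrad (frameHam m μ) (grad (frameHam m μ) (secFrame ε x)) (secFrame ε x) :=
  HasGrad.of_differentiableAt ((hx.contDiffAt hm hμ).differentiableAt one_ne_zero)

/-- Section points are fixed by the reflection, which reverses the directions L₁, L₃, M₂, P_θ. A
derivative of H along such a direction equals its own negative. -/
theorem RedRegular.grad_eq_zero (hm : 0 < m) (hμ : 0 < μ) (hx : RedRegular μ ε x) :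
    grad (frameHam m μ) (secFrame ε x) 0 = 0 ∧ grad (frameHam m μ) (secFrame ε x) 2 = 0 ∧
    grad (frameHam m μ) (secFrame ε x) 4 = 0 ∧ grad (frameHam m μ) (secFrame ε x) 8 = 0 := by
  have hd := (hx.contDiffAt hm hμ).differentiableAt one_ne_zero
  have hv : frameRefl (secFrame ε x) = secFrame ε x := by
    funext i
    fin_cases i <;> simp [frameRefl_apply, secFrame]
  have key : ∀ i, frameRefl (Pi.single i 1) = -Pi.single i 1 →
      grad (frameHam m μ) (secFrame ε x) i = 0 := by
    intro i hi
    have h := fderiv_frameHam_refl m μ hv hd (Pi.single i 1)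
    rw [hi, map_neg] at h
    rw [grad_frameHam_apply hd]
    linarith
  refine ⟨key 0 ?_, key 2 ?_, key 4 ?_, key 8 ?_⟩ <;> funext i <;> fin_cases i <;>
    simp [frameRefl_apply]

theorem hamiltonianZero_eq (m : ℝ) (hμ : 0 < μ) (hr : 2 * μ < x 3) (hx : 0 < x 1) :
    hamiltonianZero m μ ε x = frameHam m μ (secFrame ε x) := by
  rw [hamiltonianZero, hamiltonianRed_eq m hμ ε 0 hr, enc_section3_zero hx]

theorem hamiltonianZero_eventuallyEq (m : ℝ) (hμ : 0 < μ) (hr : 2 * μ < x 3) (hx : 0 < x 1) :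
    hamiltonianZero m μ ε =ᶠ[nhds x] fun z => frameHam m μ (secFrame ε z) := by
  filter_upwards [(continuous_apply (3 : Fin 5)).continuousAt.eventually (lt_mem_nhds hr),
    (continuous_apply (1 : Fin 5)).continuousAt.eventually (lt_mem_nhds hx)] with z h3 h1
  exact hamiltonianZero_eq m hμ h3 h1

/-- The section map is affine with Z₁ and Z₃ in the slots of M₁ and M₃ with a minus sign; hence the
two signs in the gradient. -/
theorem RedRegular.hasGrad_hamiltonianZero (hm : 0 < m) (hμ : 0 < μ) (hx : RedRegular μ ε x) :
    HasGrad (hamiltonianZero m μ ε)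
      ![-grad (frameHam m μ) (secFrame ε x) 3, grad (frameHam m μ) (secFrame ε x) 1,
        -grad (frameHam m μ) (secFrame ε x) 5, grad (frameHam m μ) (secFrame ε x) 10,
        grad (frameHam m μ) (secFrame ε x) 7] x := by
  let S : (Fin 5 → ℝ) →L[ℝ] (Fin 11 → ℝ) := LinearMap.toContinuousLinearMap
    { toFun := fun z => ![0, z 1, 0, -z 0, 0, -z 2, 0, z 4, 0, 0, z 3]
      map_add' := fun v w => by
        funext i
        fin_cases i <;> simp <;> ring
      map_smul' := fun k v => by
        funext i
        fin_cases i <;> simp }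
  have hS : ∀ z, secFrame ε z = S z + ![0, 0, 0, 0, 0, 0, -ε, 0, 0, 0, 0] := by
    intro z
    change secFrame ε z = ![0, z 1, 0, -z 0, 0, -z 2, 0, z 4, 0, 0, z 3] + _
    funext i
    fin_cases i <;> simp [secFrame]
  have h1 : HasFDerivAt (secFrame ε) S x :=
    (S.hasFDerivAt.add_const _).congr_of_eventuallyEq (Filter.Eventually.of_forall hS)
  refine ((HasFDerivAt.comp x (hx.hasGrad hm hμ) h1).congr_of_eventuallyEq
    (hamiltonianZero_eventuallyEq m hμ hx.1 hx.2.1)).congr_fderiv ?_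
  refine ContinuousLinearMap.ext fun v => ?_
  have hv : S v = ![0, v 1, 0, -v 0, 0, -v 2, 0, v 4, 0, 0, v 3] := rfl
  rw [ContinuousLinearMap.comp_apply, hv]
  simp only [Fin.sum_univ_succ]
  simp [Fin.succ]
  ring

theorem derivEnergy_eq (hm : 0 < m) (hμ : 0 < μ) (hx : RedRegular μ ε x) :
    derivEnergy m μ ε x = -grad (frameHam m μ) (secFrame ε x) 6 := by
  have hsec : ∀ e, secFrame e x = Function.update (secFrame ε x) 6 (-e) := by
    intro e
    funext i
    fin_cases i <;> rfl
  refine HasDerivAt.deriv ?_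
  simp only [hamiltonianZero_eq m hμ hx.1 hx.2.1]
  refine (((hx.hasGrad hm hμ).hasDerivAt_update (j := 6) (hasDerivAt_neg ε)
    (by rfl)).congr_of_eventuallyEq (Filter.Eventually.of_forall fun e => ?_)).congr_deriv
    (by simp)
  exact congrArg _ (hsec e)

/-- At E = 0 the variable E₂ moves only the slot X of the section point, and with unit speed. -/
theorem derivE_one_eq (hm : 0 < m) (hμ : 0 < μ) (hx : RedRegular μ ε x) :
    derivE m μ ε 1 x = grad (frameHam m μ) (secFrame ε x) 9 := by
  have hsec : ∀ e, enc (section3 ε (Function.update 0 1 e) x) =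
      Function.update (secFrame ε x) 9 e := by
    intro e
    rw [enc_section3]
    funext i
    fin_cases i <;> simp [secFrame, Real.sqrt_sq hx.2.1.le]
    field_simp [hx.2.1.ne']
  refine HasDerivAt.deriv ?_
  simp only [hamiltonianRed_eq m hμ ε _ hx.1, hsec]
  simpa using (hx.hasGrad hm hμ).hasDerivAt_update (j := 9) (hasDerivAt_id (0 : ℝ)) (by rfl)

/-- E₃ moves only the slot P_θ, and the derivative in P_θ vanishes by the reflection. -/
theorem derivE_two_eq (hm : 0 < m) (hμ : 0 < μ) (hx : RedRegular μ ε x) :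
    derivE m μ ε 2 x = 0 := by
  have hsec : ∀ e, enc (section3 ε (Function.update 0 2 e) x) =
      Function.update (secFrame ε x) 8 (-e) := by
    intro e
    rw [enc_section3]
    funext i
    fin_cases i <;> simp [secFrame, Real.sqrt_sq hx.2.1.le]
    field_simp [hx.2.1.ne']
  refine HasDerivAt.deriv ?_
  simp only [hamiltonianRed_eq m hμ ε _ hx.1, hsec]
  simpa [(hx.grad_eq_zero hm hμ).2.2.2] using
    (hx.hasGrad hm hμ).hasDerivAt_update (j := 8) (hasDerivAt_neg (0 : ℝ)) (by simp [secFrame])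

theorem continuousAt_grad_secFrame (hm : 0 < m) (hμ : 0 < μ) (hx : RedRegular μ ε x)
    (i : Fin 11) : ContinuousAt (fun z => grad (frameHam m μ) (secFrame ε z) i) x := by
  have h1 := hx.contDiffAt hm hμ
  have hsec : ContinuousAt (secFrame ε) x := by
    refine continuousAt_pi.2 fun j => ?_
    fin_cases j <;> simp only [secFrame, Matrix.cons_val, Fin.zero_eta, Fin.mk_one,
      Fin.reduceFinMk] <;>
      first
      | exact continuousAt_const
      | exact (continuous_apply _).continuousAt
      | exact (continuous_apply _).neg.continuousAt
  have h2 : ContinuousAt (fun v => fderiv ℝ (frameHam m μ) v (Pi.single i 1)) (secFrame ε x) :=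
    (h1.continuousAt_fderiv one_ne_zero).clm_apply continuousAt_const
  -- `grad` consists of partial derivatives and matches `fderiv` only where the function is
  -- differentiable. The C¹ property supplies this on a neighbourhood.
  have h3 : ∀ᶠ v in nhds (secFrame ε x), fderiv ℝ (frameHam m μ) v (Pi.single i 1) =
      grad (frameHam m μ) v i := by
    filter_upwards [h1.eventually (by simp)] with v hv
    exact (grad_frameHam_apply (hv.differentiableAt one_ne_zero) i).symm
  exact ContinuousAt.comp (g := fun v => grad (frameHam m μ) v i) (h2.congr h3) hsec

end

/-! ### Geometry of the leaf 𝒩 -/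

section

variable {m μ c ε : ℝ} {s : State}

theorem OnZeroQLeaf.rho_eq (h : OnZeroQLeaf c ε s) :
    s.L 1 ^ 2 + s.L 2 ^ 2 = c ^ 2 + s.M ⬝ᵥ s.M := by
  have h1 := h.2.2.1
  rw [casimirCirc, dotProduct_fin_three s.L, h.1.2.1] at h1
  linear_combination h1

/-- With L₁ = 0 the Casimir gives ρ² = c² + |M|², so ρ ≠ 0 is automatic on 𝒩. -/
theorem OnZeroQLeaf.rho_pos (hc : 0 < c) (h : OnZeroQLeaf c ε s) :
    0 < s.L 1 ^ 2 + s.L 2 ^ 2 := by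
  rw [h.rho_eq, dotProduct_fin_three]
  nlinarith [pow_pos hc 2, mul_self_nonneg (s.M 0), mul_self_nonneg (s.M 1),
    mul_self_nonneg (s.M 2)]

theorem OnZeroQLeaf.vecZ_one (h : OnZeroQLeaf c ε s) :
    vecZ s 1 = √(s.L 1 ^ 2 + s.L 2 ^ 2) := by
  simp [vecZ, dotProduct_fin_three, h.1.2.1, pow_two]

theorem OnZeroQLeaf.vecZ_one_pos (hc : 0 < c) (h : OnZeroQLeaf c ε s) : 0 < vecZ s 1 := by
  rw [h.vecZ_one]
  exact Real.sqrt_pos.2 (h.rho_pos hc)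

theorem OnZeroQLeaf.vecZ_one_sq (hc : 0 < c) (h : OnZeroQLeaf c ε s) :
    vecZ s 1 ^ 2 = s.L 1 ^ 2 + s.L 2 ^ 2 := by
  rw [h.vecZ_one, Real.sq_sqrt (h.rho_pos hc).le]

theorem OnZeroQLeaf.M_zero (hc : 0 < c) (h : OnZeroQLeaf c ε s) : s.M 0 = -vecZ s 0 := by
  have h1 := (h.vecZ_one_pos hc).ne'
  have h2 : √(s.L ⬝ᵥ s.L) = vecZ s 1 := rfl
  have h3 : vecZ s 0 = -(s.M 0 * √(s.L ⬝ᵥ s.L)) / √(s.L 1 ^ 2 + s.L 2 ^ 2) := rfl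
  rw [h3, h2, ← h.vecZ_one]
  field_simp

theorem OnZeroQLeaf.vecZ_two (h : OnZeroQLeaf c ε s) :
    vecZ s 2 = (s.M 1 * s.L 2 - s.M 2 * s.L 1) / vecZ s 1 := by
  rw [h.vecZ_one]
  rfl

theorem OnZeroQLeaf.star (h : OnZeroQLeaf c ε s) : s.L 1 * s.M 1 + s.L 2 * s.M 2 = 0 := by
  have := h.2.1
  rw [casimirStar, dotProduct_fin_three, h.1.2.1] at this
  linarith

/-- By C_⋆ = 0 and L₁ = 0, (M₂, M₃) is orthogonal to (L₂, L₃); only its transverse component Z₃ is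
left. -/
theorem OnZeroQLeaf.M_one (hc : 0 < c) (h : OnZeroQLeaf c ε s) :
    s.M 1 = vecZ s 2 * s.L 2 / vecZ s 1 := by
  have h1 := (h.vecZ_one_pos hc).ne'
  rw [h.vecZ_two]
  field_simp
  rw [h.vecZ_one_sq hc]
  linear_combination s.L 1 * h.star

theorem OnZeroQLeaf.M_two (hc : 0 < c) (h : OnZeroQLeaf c ε s) :
    s.M 2 = -(vecZ s 2 * s.L 1) / vecZ s 1 := by
  have h1 := (h.vecZ_one_pos hc).ne'
  rw [h.vecZ_two]
  field_simp
  rw [h.vecZ_one_sq hc]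
  linear_combination s.L 2 * h.star

theorem OnZeroQLeaf.enc_eq (hc : 0 < c) (h : OnZeroQLeaf c ε s) :
    enc s = frameRot (s.L 1 / vecZ s 1) (s.L 2 / vecZ s 1) (secFrame ε (redState s)) := by
  have h1 := enc_eq_rot h.2.1 (h.rho_pos hc)
  rw [vecE_eq_zero h.1, enc_section3_zero (x := redState s) (h.vecZ_one_pos hc),
    h.2.2.2, neg_neg] at h1
  rwa [h.vecZ_one]

theorem OnZeroQLeaf.rot_sq (hc : 0 < c) (h : OnZeroQLeaf c ε s) :
    (s.L 1 / vecZ s 1) ^ 2 + (s.L 2 / vecZ s 1) ^ 2 = 1 := by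
  rw [h.vecZ_one]
  exact rot_sq_add_sq (h.rho_pos hc)

theorem OnZeroQLeaf.redRegular (hμ : 0 < μ) (hc : 0 < c) (h : OnZeroQLeaf c ε s)
    (hs : Regular μ s) : RedRegular μ ε (redState s) := by
  have hr : 2 * μ < redState s 3 := hs.1
  refine ⟨hr, h.vecZ_one_pos hc, fun h0 => hs.frameDen_ne_zero hμ ?_⟩
  rw [h.enc_eq hc, frameDen_rot μ (h.rot_sq hc), frameDen_secFrame hμ hr, h0, mul_zero]

theorem OnZeroQLeaf.redCasimir_eq (hc : 0 < c) (h : OnZeroQLeaf c ε s) :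
    redCasimir (redState s) = c ^ 2 := by
  have h1 := h.vecZ_one_sq hc
  have h2 := h.rho_eq
  have h3 := h.M_zero hc
  have h4 := (h.vecZ_one_pos hc).ne'
  have h5 : s.M 1 ^ 2 + s.M 2 ^ 2 = vecZ s 2 ^ 2 := by
    rw [h.M_one hc, h.M_two hc]
    field_simp
    rw [h1]
    ring
  rw [dotProduct_fin_three, h3] at h2
  change -vecZ s 0 ^ 2 + vecZ s 1 ^ 2 - vecZ s 2 ^ 2 = c ^ 2
  linear_combination h1 + h2 + h5

theorem OnZeroQLeaf.grad_enc (hm : 0 < m) (hμ : 0 < μ) (hc : 0 < c) (h : OnZeroQLeaf c ε s)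
    (hs : Regular μ s) :
    grad (frameHam m μ) (enc s) = frameRot (s.L 1 / vecZ s 1) (s.L 2 / vecZ s 1)
      (grad (frameHam m μ) (secFrame ε (redState s))) := by
  have hd := HasFDerivAt.differentiableAt (hs.hasGrad hm hμ)
  rw [h.enc_eq hc] at hd ⊢
  exact grad_frameHam_rot (h.rot_sq hc) hd
    (((h.redRegular hμ hc hs).contDiffAt hm hμ).differentiableAt one_ne_zero)

/-- The partial derivatives of the Hamiltonian on the manifold `Q = 0`. -/
theorem OnZeroQLeaf.gradients (hm : 0 < m) (hμ : 0 < μ) (hc : 0 < c)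
    (h : OnZeroQLeaf c ε s) (hs : Regular μ s) :
    let g := grad (hamiltonianZero m μ ε) (redState s)
    let k := derivE m μ ε 1 (redState s)
    let C := s.L 1 / vecZ s 1
    let S := s.L 2 / vecZ s 1
    gradL m μ s = ![k * C * (Real.cos (s.y 2) / Real.sin (s.y 2)), C * g 1, S * g 1] ∧
    gradM m μ s = ![-g 0, S * g 2, -(C * g 2)] ∧
    gradP m μ s = ![-derivEnergy m μ ε (redState s), g 4, k * S,
      -(k * C / Real.sin (s.y 2))] ∧
    gradY m μ s = ![0, g 3, 0, 0] := by
  have hx := h.redRegular hμ hc hs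
  obtain ⟨z0, z2, z4, z8⟩ := hx.grad_eq_zero hm hμ
  intro g k C S
  have hg : g = _ := (hx.hasGrad_hamiltonianZero hm hμ).grad_eq
  have hk : k = _ := derivE_one_eq hm hμ hx
  rw [gradL_eq hm hμ hs, gradM_eq hm hμ hs, gradP_eq hm hμ hs, gradY_eq hm hμ hs,
    h.grad_enc hm hμ hc hs, derivEnergy_eq hm hμ hx, hg, hk, frameRot_apply]
  simp only [Matrix.cons_val, z0, z2, z4, z8, h.1.2.1, h.1.2.2]
  change ![_, C * _ - _, S * _ + _] = _ ∧ ![_, C * _ - S * _, S * _ + C * _] = _ ∧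
    ![_, _, S * _ + C * _, -((C * _ - S * _) / _)] = _ ∧ _
  refine ⟨?_, ?_, ?_, ?_⟩ <;> funext i <;> fin_cases i <;> simp <;> ring

end

/-! ### Motions on the manifold `Q = 0` -/

section

variable {m μ c ε : ℝ}

theorem poissonMatrix_mulVec (x g : Fin 5 → ℝ) :
    poissonMatrix x *ᵥ g = ![x 2 * g 1 + x 1 * g 2, -(x 2 * g 0) + x 0 * g 2,
      -(x 1 * g 0) - x 0 * g 1, g 4, -g 3] := by
  funext i
  fin_cases i <;> simp [poissonMatrix, Matrix.mulVec, dotProduct, Fin.sum_univ_succ]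
  ring

theorem OnZeroQLeaf.L_one {s : State} (hc : 0 < c) (h : OnZeroQLeaf c ε s) :
    s.L 1 = vecZ s 1 * (s.L 1 / vecZ s 1) := by
  field_simp [(h.vecZ_one_pos hc).ne']

theorem OnZeroQLeaf.L_two {s : State} (hc : 0 < c) (h : OnZeroQLeaf c ε s) :
    s.L 2 = vecZ s 1 * (s.L 2 / vecZ s 1) := by
  field_simp [(h.vecZ_one_pos hc).ne']

/-- The right-hand sides of the equations for `L` and `M` on the manifold `Q = 0`. -/
theorem OnZeroQLeaf.spin_field {s : State} (hm : 0 < m) (hμ : 0 < μ) (hc : 0 < c)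
    (h : OnZeroQLeaf c ε s) (hs : Regular μ s) :
    let g := grad (hamiltonianZero m μ ε) (redState s)
    let k := derivE m μ ε 1 (redState s) * (Real.cos (s.y 2) / Real.sin (s.y 2))
    let Z := vecZ s
    let C := s.L 1 / Z 1
    let S := s.L 2 / Z 1
    gradL m μ s ⨯₃ s.L + gradM m μ s ⨯₃ s.M =
      ![0, C * (Z 0 * g 2 - Z 2 * g 0) - k * C * S * Z 1,
        S * (Z 0 * g 2 - Z 2 * g 0) + k * C ^ 2 * Z 1] ∧
    gradL m μ s ⨯₃ s.M - gradM m μ s ⨯₃ s.L =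
      ![-(Z 2 * g 1 + Z 1 * g 2), -S * (Z 0 * g 1 + Z 1 * g 0) + k * C ^ 2 * Z 2,
        C * (Z 0 * g 1 + Z 1 * g 0) + k * C * S * Z 2] := by
  intro g k Z C S
  obtain ⟨e1, e2, -, -⟩ := h.gradients hm hμ hc hs
  have hCS : C ^ 2 + S ^ 2 = 1 := h.rot_sq hc
  have hL1 : s.L 1 = Z 1 * C := h.L_one hc
  have hL2 : s.L 2 = Z 1 * S := h.L_two hc
  have hM0 : s.M 0 = -Z 0 := h.M_zero hc
  have hM1 : s.M 1 = Z 2 * S := by rw [h.M_one hc, mul_div_assoc]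
  have hM2 : s.M 2 = -(Z 2 * C) := by rw [h.M_two hc, neg_div, mul_div_assoc]
  have hL0 := h.1.2.1
  change gradL m μ s = ![_ * C * _, C * g 1, S * g 1] at e1
  change gradM m μ s = ![-g 0, S * g 2, -(C * g 2)] at e2
  have hk : derivE m μ ε 1 (redState s) * C * (Real.cos (s.y 2) / Real.sin (s.y 2)) = k * C := by
    ring
  rw [hk] at e1
  rw [e1, e2]
  clear_value g k Z C S
  constructor <;> funext i <;> fin_cases i <;>
    simp [crossProduct, hL0, hL1, hL2, hM0, hM1, hM2]
  · ring
  · ring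
  · ring
  · linear_combination (-(Z 2 * g 1) - Z 1 * g 2) * hCS
  · ring
  · ring

theorem OnZeroQLeaf.redState_eq {s : State} (hc : 0 < c) (h : OnZeroQLeaf c ε s) :
    redState s = ![-s.M 0, √(s.L 1 ^ 2 + s.L 2 ^ 2),
      (s.M 1 * s.L 2 - s.M 2 * s.L 1) / √(s.L 1 ^ 2 + s.L 2 ^ 2), s.y 1, s.P 1] := by
  rw [← h.vecZ_one, ← h.vecZ_two, h.M_zero hc, neg_neg]
  rfl

/-- The terms with h turn (L₂, L₃) and (M₂, M₃) with the common angular velocity h cot θ · L₂/Z₂, so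
they cancel in the rotation invariants Z. The remaining terms are the Poisson field of H₀. -/
theorem isRedMotion_redState (hm : 0 < m) (hμ : 0 < μ) (hc : 0 < c) {I : Set ℝ}
    (hI : IsOpen I) {x : ℝ → State} (hx : IsMotion m μ I x)
    (hN : ∀ τ ∈ I, OnZeroQLeaf c ε (x τ)) :
    IsRedMotion m μ ε I (fun τ => redState (x τ)) := by
  intro τ hτ
  have h := hN τ hτ
  have hs := hx.regular τ hτ
  refine ⟨h.redRegular hμ hc hs, ?_⟩
  have hL := hasDerivAt_pi.1 (hx.derivL τ hτ)
  have hM := hasDerivAt_pi.1 (hx.derivM τ hτ)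
  have hP := hasDerivAt_pi.1 (hx.derivP τ hτ)
  have hy := hasDerivAt_pi.1 (hx.derivY τ hτ)
  obtain ⟨eL, eM⟩ := h.spin_field hm hμ hc hs
  obtain ⟨-, -, eP, eY⟩ := h.gradients hm hμ hc hs
  rw [eL] at hL
  rw [eM] at hM
  rw [eY] at hP
  rw [eP] at hy
  have hρ := (h.rho_pos hc)
  have hZ := (h.vecZ_one_pos hc).ne'
  have hCS := h.rot_sq hc
  have hL1 := h.L_one hc
  have hL2 := h.L_two hc
  have hM1 : (x τ).M 1 = vecZ (x τ) 2 * ((x τ).L 2 / vecZ (x τ) 1) := by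
    rw [← mul_div_assoc]; exact h.M_one hc
  have hM2 : (x τ).M 2 = -(vecZ (x τ) 2 * ((x τ).L 1 / vecZ (x τ) 1)) := by
    rw [← mul_div_assoc, ← neg_div]; exact h.M_two hc
  have r0 : redState (x τ) 0 = vecZ (x τ) 0 := rfl
  have r1 : redState (x τ) 1 = vecZ (x τ) 1 := rfl
  have r2 : redState (x τ) 2 = vecZ (x τ) 2 := rfl
  have hsqrt := (((hL 1).pow 2).add ((hL 2).pow 2)).sqrt hρ.ne'
  have hquot := (((hM 1).mul (hL 2)).sub ((hM 2).mul (hL 1))).div hsqrt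
    (Real.sqrt_pos.2 hρ).ne'
  -- On 𝒩 one has Z₁ = -M₁ and Z₂ = ρ, which gives expressions that can be differentiated directly.
  -- They hold on I only, so near τ.
  have hev : (fun t => redState (x t)) =ᶠ[nhds τ] fun t => ![-(x t).M 0,
      √((x t).L 1 ^ 2 + (x t).L 2 ^ 2),
      ((x t).M 1 * (x t).L 2 - (x t).M 2 * (x t).L 1) / √((x t).L 1 ^ 2 + (x t).L 2 ^ 2),
      (x t).y 1, (x t).P 1] := by
    filter_upwards [hI.mem_nhds hτ] with t ht
    exact (hN t ht).redState_eq hc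
  refine HasDerivAt.congr_of_eventuallyEq ?_ hev
  rw [poissonMatrix_mulVec]
  simp only [r0, r1, r2]
  have hZρ := h.vecZ_one
  simp only [Pi.add_apply, Pi.sub_apply, Pi.mul_apply, Pi.pow_apply, ← hZρ] at hsqrt hquot
  rw [hM1, hM2] at hquot
  generalize grad (hamiltonianZero m μ ε) (redState (x τ)) = g at *
  generalize derivE m μ ε 1 (redState (x τ)) *
    (Real.cos ((x τ).y 2) / Real.sin ((x τ).y 2)) = k at *
  generalize (x τ).L 1 / vecZ (x τ) 1 = C at *
  generalize (x τ).L 2 / vecZ (x τ) 1 = S at *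
  rw [hL1, hL2] at hsqrt hquot
  generalize vecZ (x τ) = Z at *
  refine hasDerivAt_pi.2 fun i => ?_
  fin_cases i
  · refine (hM 0).neg.congr_deriv ?_
    simp
  · refine hsqrt.congr_deriv ?_
    simp
    field_simp
    linear_combination (Z 0 * g 2 - Z 2 * g 0) * hCS
  · refine hquot.congr_deriv ?_
    simp
    field_simp
    have hS : S ^ 2 = 1 - C ^ 2 := by linear_combination hCS
    ring_nf
    simp only [hS, show S ^ 4 = (1 - C ^ 2) ^ 2 by rw [← hS]; ring]
    ring
  · exact hy 1
  · exact hP 1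

/-! ### The integral K and the recovery of θ, φ, t -/

theorem IsRedMotion.continuousOn_derivE (hm : 0 < m) (hμ : 0 < μ) {I : Set ℝ}
    (hI : IsOpen I) {γ : ℝ → Fin 5 → ℝ} (h : IsRedMotion m μ ε I γ) :
    ContinuousOn (fun τ => derivE m μ ε 1 (γ τ)) I := by
  intro τ hτ
  refine ContinuousAt.continuousWithinAt ?_
  refine (ContinuousAt.comp (g := fun z => grad (frameHam m μ) (secFrame ε z) 9)
    (continuousAt_grad_secFrame hm hμ (h τ hτ).1 9) (h τ hτ).2.continuousAt).congr ?_
  filter_upwards [hI.mem_nhds hτ] with t ht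
  exact (derivE_one_eq hm hμ (h t ht).1).symm

theorem IsRedMotion.continuousOn_derivEnergy (hm : 0 < m) (hμ : 0 < μ) {I : Set ℝ}
    (hI : IsOpen I) {γ : ℝ → Fin 5 → ℝ} (h : IsRedMotion m μ ε I γ) :
    ContinuousOn (fun τ => derivEnergy m μ ε (γ τ)) I := by
  intro τ hτ
  refine ContinuousAt.continuousWithinAt ?_
  refine (ContinuousAt.neg (ContinuousAt.comp
    (g := fun z => grad (frameHam m μ) (secFrame ε z) 6)
    (continuousAt_grad_secFrame hm hμ (h τ hτ).1 6) (h τ hτ).2.continuousAt)).congr ?_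
  filter_upwards [hI.mem_nhds hτ] with t ht
  exact (derivEnergy_eq hm hμ (h t ht).1).symm

theorem OnZeroQLeaf.integralK_eq {s : State} (h : OnZeroQLeaf c ε s) :
    integralK s = s.L 1 / vecZ s 1 * Real.sin (s.y 2) := by
  rw [integralK, h.vecZ_one]
  ring

theorem OnZeroQLeaf.cos_eq {s : State} (h : OnZeroQLeaf c ε s) (hs : Regular μ s) :
    integralK s / Real.sin (s.y 2) = s.L 1 / vecZ s 1 := by
  rw [h.integralK_eq]
  field_simp [hs.sin_pos.ne']

/-- The direction (L₂, L₃)/Z₂ has first component κ/sin θ. The root is the modulus of the second one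
and σ its sign; at L₃ = 0 either σ works. -/
theorem OnZeroQLeaf.sin_eq {s : State} (hc : 0 < c) (h : OnZeroQLeaf c ε s)
    (hs : Regular μ s) {σ : ℝ} (hσ : σ = 1 ∨ σ = -1) (hL : 0 ≤ σ * s.L 2) :
    σ * √(1 - integralK s ^ 2 / Real.sin (s.y 2) ^ 2) = s.L 2 / vecZ s 1 := by
  have hZ := h.vecZ_one_pos hc
  have h1 : 1 - integralK s ^ 2 / Real.sin (s.y 2) ^ 2 = (σ * (s.L 2 / vecZ s 1)) ^ 2 := by
    rw [← div_pow, h.cos_eq hs]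
    have := h.rot_sq hc
    rcases hσ with rfl | rfl <;> linear_combination -this
  have h2 : 0 ≤ σ * (s.L 2 / vecZ s 1) := by
    rw [← mul_div_assoc]; exact div_nonneg hL hZ.le
  rw [h1, Real.sqrt_sq h2]
  rcases hσ with rfl | rfl <;> ring

theorem OnZeroQLeaf.abs_integralK_le {s : State} (hc : 0 < c) (h : OnZeroQLeaf c ε s) :
    |integralK s| ≤ 1 := by
  rw [h.integralK_eq, ← sq_le_one_iff_abs_le_one, mul_pow]
  have h1 := h.rot_sq hc
  have h2 := Real.sin_sq_le_one (s.y 2)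
  have h3 : (s.L 1 / vecZ s 1) ^ 2 ≤ 1 := by linarith [sq_nonneg (s.L 2 / vecZ s 1)]
  exact mul_le_one₀ h3 (sq_nonneg _) h2

/-- In the quotient by Z₂ the radial parts of the velocities cancel; only the turning of the
direction (C, S) remains. -/
theorem hasDerivAt_L_div (hm : 0 < m) (hμ : 0 < μ) (hc : 0 < c) {I : Set ℝ}
    (hI : IsOpen I) {x : ℝ → State} (hx : IsMotion m μ I x)
    (hN : ∀ τ ∈ I, OnZeroQLeaf c ε (x τ)) {τ : ℝ} (hτ : τ ∈ I) :
    let k := derivE m μ ε 1 (redState (x τ)) *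
      (Real.cos ((x τ).y 2) / Real.sin ((x τ).y 2))
    let C := (x τ).L 1 / vecZ (x τ) 1
    let S := (x τ).L 2 / vecZ (x τ) 1
    HasDerivAt (fun t => (x t).L 1 / vecZ (x t) 1) (-(k * C * S)) τ ∧
    HasDerivAt (fun t => (x t).L 2 / vecZ (x t) 1) (k * C ^ 2) τ := by
  intro k C S
  have h := hN τ hτ
  have hs := hx.regular τ hτ
  have hL := hasDerivAt_pi.1 (hx.derivL τ hτ)
  obtain ⟨eL, -⟩ := h.spin_field hm hμ hc hs
  rw [eL] at hL
  have hZ := hasDerivAt_pi.1 ((isRedMotion_redState hm hμ hc hI hx hN) τ hτ).2 1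
  rw [poissonMatrix_mulVec] at hZ
  change HasDerivAt (fun t => vecZ (x t) 1) (-(vecZ (x τ) 2 * _) + vecZ (x τ) 0 * _) τ at hZ
  have hZ0 := (h.vecZ_one_pos hc).ne'
  refine ⟨((hL 1).div hZ hZ0).congr_deriv ?_, ((hL 2).div hZ hZ0).congr_deriv ?_⟩ <;>
  · simp [k, C, S]
    field_simp
    ring

theorem hasDerivAt_angles (hm : 0 < m) (hμ : 0 < μ) (hc : 0 < c) {I : Set ℝ}
    {x : ℝ → State} (hx : IsMotion m μ I x)
    (hN : ∀ τ ∈ I, OnZeroQLeaf c ε (x τ)) {τ : ℝ} (hτ : τ ∈ I) :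
    let k := derivE m μ ε 1 (redState (x τ))
    HasDerivAt (fun t => (x t).y 2) (k * ((x τ).L 2 / vecZ (x τ) 1)) τ ∧
    HasDerivAt (fun t => (x t).y 3)
      (-(k * ((x τ).L 1 / vecZ (x τ) 1) / Real.sin ((x τ).y 2))) τ ∧
    HasDerivAt (fun t => (x t).y 0) (-derivEnergy m μ ε (redState (x τ))) τ := by
  intro k
  have hy := hasDerivAt_pi.1 (hx.derivY τ hτ)
  rw [((hN τ hτ).gradients hm hμ hc (hx.regular τ hτ)).2.2.1] at hy
  exact ⟨hy 2, hy 3, hy 0⟩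

/-- K = C sin θ, and Ċ = -h cot θ CS is compensated by θ̇ = hS. -/
theorem integralK_const (hm : 0 < m) (hμ : 0 < μ) (hc : 0 < c) {I : Set ℝ}
    (hI : IsOpen I) (hpc : IsPreconnected I) {x : ℝ → State} (hx : IsMotion m μ I x)
    (hN : ∀ τ ∈ I, OnZeroQLeaf c ε (x τ)) {τ₀ τ : ℝ} (h₀ : τ₀ ∈ I) (hτ : τ ∈ I) :
    integralK (x τ) = integralK (x τ₀) := by
  rw [(hN τ hτ).integralK_eq, (hN τ₀ h₀).integralK_eq]
  refine eq_of_hasDerivAt_zero hI hpc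
    (f := fun t => (x t).L 1 / vecZ (x t) 1 * Real.sin ((x t).y 2)) (fun t ht => ?_) h₀ hτ
  have h1 := (hasDerivAt_L_div hm hμ hc hI hx hN ht).1
  have h2 := (hasDerivAt_angles hm hμ hc hx hN ht).1
  refine (h1.mul h2.sin).congr_deriv ?_
  field_simp [(hx.regular t ht).sin_pos.ne']
  ring

/-- The vector (u, w), turned back by the accumulated angle ∫k, has zero derivative; the formulas
invert this rotation. -/
theorem rotation_formula {I : Set ℝ} (hI : IsOpen I) (hpc : IsPreconnected I)
    {u w k : ℝ → ℝ} (hk : ContinuousOn k I) (hu : ∀ τ ∈ I, HasDerivAt u (-(k τ * w τ)) τ)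
    (hw : ∀ τ ∈ I, HasDerivAt w (k τ * u τ) τ) {τ₀ τ : ℝ} (h₀ : τ₀ ∈ I) (hτ : τ ∈ I) {Φ : ℝ}
    (hΦ : Φ = ∫ t in τ₀..τ, k t) :
    u τ = u τ₀ * Real.cos Φ - w τ₀ * Real.sin Φ ∧
    w τ = w τ₀ * Real.cos Φ + u τ₀ * Real.sin Φ := by
  have hd : ∀ t ∈ I, HasDerivAt (fun t => ∫ t' in τ₀..t, k t') (k t) t :=
    fun t ht => hasDerivAt_integral hI hpc hk h₀ ht
  have hA := eq_of_hasDerivAt_zero hI hpc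
    (f := fun t => u t * Real.cos (∫ t' in τ₀..t, k t') + w t * Real.sin (∫ t' in τ₀..t, k t'))
    (fun t ht => (((hu t ht).mul (hd t ht).cos).add
      ((hw t ht).mul (hd t ht).sin)).congr_deriv (by ring)) h₀ hτ
  have hB := eq_of_hasDerivAt_zero hI hpc
    (f := fun t => w t * Real.cos (∫ t' in τ₀..t, k t') - u t * Real.sin (∫ t' in τ₀..t, k t'))
    (fun t ht => (((hw t ht).mul (hd t ht).cos).sub
      ((hu t ht).mul (hd t ht).sin)).congr_deriv (by ring)) h₀ hτ
  simp only [intervalIntegral.integral_same, Real.cos_zero, Real.sin_zero, ← hΦ] at hA hB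
  have h1 := Real.sin_sq_add_cos_sq Φ
  constructor
  · linear_combination Real.cos Φ * hA - Real.sin Φ * hB - u τ * h1
  · linear_combination Real.sin Φ * hA + Real.cos Φ * hB - w τ * h1

/-- The pair u = cos θ, w = L₃ sin θ/Z₂ satisfies u̇ = -hw and ẇ = hu, the second equation by C² +
S² = 1. The rest is integration. -/
theorem recovery (hm : 0 < m) (hμ : 0 < μ) (hc : 0 < c) {I : Set ℝ}
    (hI : IsOpen I) (hpc : IsPreconnected I) {x : ℝ → State} (hx : IsMotion m μ I x)
    (hN : ∀ τ ∈ I, OnZeroQLeaf c ε (x τ)) {τ₀ τ : ℝ} (h₀ : τ₀ ∈ I) (hτ : τ ∈ I) {Φ : ℝ}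
    (hΦ : Φ = ∫ t in τ₀..τ, derivE m μ ε 1 (redState (x t))) :
    Real.cos ((x τ).y 2) = Real.cos ((x τ₀).y 2) * Real.cos Φ -
        Real.sin ((x τ₀).y 2) * (x τ₀).L 2 / vecZ (x τ₀) 1 * Real.sin Φ ∧
    Real.sin ((x τ).y 2) * (x τ).L 2 / vecZ (x τ) 1 =
        Real.sin ((x τ₀).y 2) * (x τ₀).L 2 / vecZ (x τ₀) 1 * Real.cos Φ +
          Real.cos ((x τ₀).y 2) * Real.sin Φ ∧
    (x τ).y 3 = (x τ₀).y 3 - ∫ t in τ₀..τ, integralK (x τ₀) / Real.sin ((x t).y 2) ^ 2 *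
      derivE m μ ε 1 (redState (x t)) ∧
    (x τ).y 0 = (x τ₀).y 0 - ∫ t in τ₀..τ, derivEnergy m μ ε (redState (x t)) := by
  have hred := isRedMotion_redState hm hμ hc hI hx hN
  have hk := hred.continuousOn_derivE hm hμ hI
  have hθ : ∀ t ∈ I, HasDerivAt (fun t => (x t).y 2) _ t :=
    fun t ht => (hasDerivAt_angles hm hμ hc hx hN ht).1
  have hrot := rotation_formula hI hpc (u := fun t => Real.cos ((x t).y 2))
    (w := fun t => Real.sin ((x t).y 2) * (x t).L 2 / vecZ (x t) 1) hk (fun t ht => ?_)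
    (fun t ht => ?_) h₀ hτ hΦ
  · refine ⟨hrot.1, hrot.2, ?_, ?_⟩
    · have hc2 : ContinuousOn (fun t => Real.sin ((x t).y 2)) I :=
        fun t ht => (hθ t ht).sin.continuousAt.continuousWithinAt
      have hφ : ∀ t ∈ I, HasDerivAt (fun t => (x t).y 3)
          (-(integralK (x τ₀) / Real.sin ((x t).y 2) ^ 2 *
            derivE m μ ε 1 (redState (x t)))) t := by
        intro t ht
        refine (hasDerivAt_angles hm hμ hc hx hN ht).2.1.congr_deriv ?_
        rw [← integralK_const hm hμ hc hI hpc hx hN h₀ ht, ← (hN t ht).cos_eq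
          (hx.regular t ht)]
        field_simp [(hx.regular t ht).sin_pos.ne']
      rw [eq_add_integral hpc hφ ((continuousOn_const.div (hc2.pow 2) fun t ht =>
          pow_ne_zero 2 (hx.regular t ht).sin_pos.ne').mul hk).neg h₀ hτ,
        intervalIntegral.integral_neg, sub_eq_add_neg]
    · rw [eq_add_integral hpc (f := fun t => (x t).y 0)
        (g := fun t => -derivEnergy m μ ε (redState (x t)))
        (fun t ht => (hasDerivAt_angles hm hμ hc hx hN ht).2.2)
        (hred.continuousOn_derivEnergy hm hμ hI).neg h₀ hτ,
        intervalIntegral.integral_neg, sub_eq_add_neg]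
  · refine (hθ t ht).cos.congr_deriv ?_
    ring
  · simp only [mul_div_assoc]
    refine ((hθ t ht).sin.mul (hasDerivAt_L_div hm hμ hc hI hx hN ht).2).congr_deriv ?_
    have h1 := (hN t ht).rot_sq hc
    have h2 := (hx.regular t ht).sin_pos.ne'
    have h3 : Real.sin ((x t).y 2) * (derivE m μ ε 1 (redState (x t)) *
        (Real.cos ((x t).y 2) / Real.sin ((x t).y 2)) * ((x t).L 1 / vecZ (x t) 1) ^ 2) =
        derivE m μ ε 1 (redState (x t)) * Real.cos ((x t).y 2) *
          ((x t).L 1 / vecZ (x t) 1) ^ 2 := by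
      field_simp
    rw [h3]
    linear_combination derivE m μ ε 1 (redState (x t)) * Real.cos ((x t).y 2) * h1

/-- A solution of the reduced system together with the equations for `θ`, `φ`, `t` determines
a motion. -/
theorem isMotion_of_isRedMotion (hm : 0 < m) (hμ : 0 < μ) (hc : 0 < c) {I : Set ℝ}
    (hI : IsOpen I) {x : ℝ → State} {κ σ : ℝ} (hσ : σ = 1 ∨ σ = -1)
    (hx : ∀ τ ∈ I, Regular μ (x τ) ∧ OnZeroQLeaf c ε (x τ) ∧ 0 < σ * (x τ).L 2 ∧
      integralK (x τ) = κ)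
    (hred : IsRedMotion m μ ε I (fun τ => redState (x τ)))
    (hang : ∀ τ ∈ I,
      HasDerivAt (fun t => (x t).y 2) (σ * √(1 - κ ^ 2 / Real.sin ((x τ).y 2) ^ 2) *
          derivE m μ ε 1 (redState (x τ))) τ ∧
      HasDerivAt (fun t => (x t).y 3) (-(κ / Real.sin ((x τ).y 2) ^ 2) *
          derivE m μ ε 1 (redState (x τ))) τ ∧
      HasDerivAt (fun t => (x t).y 0) (-derivEnergy m μ ε (redState (x τ))) τ) :
    IsMotion m μ I x := by
  suffices hall : ∀ τ ∈ I, HasDerivAt (fun t => (x t).L)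
        (gradL m μ (x τ) ⨯₃ (x τ).L + gradM m μ (x τ) ⨯₃ (x τ).M) τ ∧
      HasDerivAt (fun t => (x t).M)
        (gradL m μ (x τ) ⨯₃ (x τ).M - gradM m μ (x τ) ⨯₃ (x τ).L) τ ∧
      HasDerivAt (fun t => (x t).P) (-gradY m μ (x τ)) τ ∧
      HasDerivAt (fun t => (x t).y) (gradP m μ (x τ)) τ from
    ⟨fun τ hτ => (hx τ hτ).1, fun τ hτ => (hall τ hτ).1, fun τ hτ => (hall τ hτ).2.1,
      fun τ hτ => (hall τ hτ).2.2.1, fun τ hτ => (hall τ hτ).2.2.2⟩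
  intro τ hτ
  obtain ⟨hs, h, hL2, hK⟩ := hx τ hτ
  obtain ⟨hθ, hφ, ht⟩ := hang τ hτ
  have hsin := hs.sin_pos.ne'
  have hZ := hasDerivAt_pi.1 (hred τ hτ).2
  rw [poissonMatrix_mulVec] at hZ
  have hZ0 : HasDerivAt (fun t => vecZ (x t) 0) (vecZ (x τ) 2 * _ + vecZ (x τ) 1 * _) τ := hZ 0
  have hZ1 : HasDerivAt (fun t => vecZ (x t) 1) (-(vecZ (x τ) 2 * _) + vecZ (x τ) 0 * _) τ :=
    hZ 1
  have hZ2 : HasDerivAt (fun t => vecZ (x t) 2) (-(vecZ (x τ) 1 * _) - vecZ (x τ) 0 * _) τ :=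
    hZ 2
  have hr : HasDerivAt (fun t => (x t).y 1) _ τ := hZ 3
  have hp : HasDerivAt (fun t => (x t).P 1) _ τ := hZ 4
  obtain ⟨eL, eM⟩ := h.spin_field hm hμ hc hs
  obtain ⟨-, -, eP, eY⟩ := h.gradients hm hμ hc hs
  have hcos := h.cos_eq hs
  have hS := h.sin_eq hc hs hσ hL2.le
  rw [hK] at hcos hS
  have hev := hI.mem_nhds hτ
  have hZpos := h.vecZ_one_pos hc
  have hZne := hZpos.ne'
  have hL2ne : (x τ).L 2 ≠ 0 := fun h0 => by simp [h0] at hL2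
  rw [hS, mul_comm] at hθ
  have hφ' : -(κ / Real.sin ((x τ).y 2) ^ 2) * derivE m μ ε 1 (redState (x τ)) =
      -(derivE m μ ε 1 (redState (x τ)) * ((x τ).L 1 / vecZ (x τ) 1) /
        Real.sin ((x τ).y 2)) := by
    rw [← hcos]
    field_simp
  rw [hφ'] at hφ
  -- Constancy of K means L₂ = κZ₂/sin θ on I, so L̇₂ follows from the equations for Z₂ and θ.
  have dL1 : HasDerivAt (fun t => (x t).L 1)
      ((gradL m μ (x τ) ⨯₃ (x τ).L + gradM m μ (x τ) ⨯₃ (x τ).M) 1) τ := by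
    refine (((hZ1.const_mul κ).div hθ.sin hsin).congr_of_eventuallyEq ?_).congr_deriv ?_
    · filter_upwards [hev] with t ht
      obtain ⟨hs', h', -, hK'⟩ := hx t ht
      have e := h'.cos_eq hs'
      rw [hK'] at e
      have := (h'.vecZ_one_pos hc).ne'
      simp only [Pi.div_apply]
      rw [mul_div_right_comm, e]
      field_simp
    · rw [eL]
      have hκ : κ = (x τ).L 1 / vecZ (x τ) 1 * Real.sin ((x τ).y 2) := by
        rw [← hcos]; field_simp
      rw [hκ]
      simp
      field_simp
      ring
  -- L₃ is recovered as σ√(Z₂² - L₂²). The strict sign of σL₃ keeps the radicand positive, hence the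
  -- root differentiable.
  have dL2 : HasDerivAt (fun t => (x t).L 2)
      ((gradL m μ (x τ) ⨯₃ (x τ).L + gradM m μ (x τ) ⨯₃ (x τ).M) 2) τ := by
    have hpos : ∀ t ∈ I, vecZ (x t) 1 ^ 2 - (x t).L 1 ^ 2 = (x t).L 2 ^ 2 := by
      intro t ht
      rw [(hx t ht).2.1.vecZ_one_sq hc]
      ring
    have hsq : ∀ t ∈ I, √(vecZ (x t) 1 ^ 2 - (x t).L 1 ^ 2) = σ * (x t).L 2 := by
      intro t ht
      have h1 : (x t).L 2 ^ 2 = (σ * (x t).L 2) ^ 2 := by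
        rcases hσ with rfl | rfl <;> ring
      rw [hpos t ht, h1, Real.sqrt_sq (hx t ht).2.2.1.le]
    have hσ2 : σ * σ = 1 := by rcases hσ with rfl | rfl <;> norm_num
    have h1 := (((hZ1.pow 2).sub (dL1.pow 2)).sqrt
      (by simpa [hpos τ hτ] using hL2ne)).const_mul σ
    refine (h1.congr_of_eventuallyEq ?_).congr_deriv ?_
    · filter_upwards [hev] with t ht
      simp only [Pi.sub_apply, Pi.pow_apply, hsq t ht]
      rw [← mul_assoc, hσ2, one_mul]
    · simp only [Pi.sub_apply, Pi.pow_apply, hsq τ hτ]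
      rw [eL]
      have hσ0 : σ ≠ 0 := fun h0 => by simp [h0] at hσ2
      simp
      field_simp
      have hq := h.vecZ_one_sq hc
      linear_combination (vecZ (x τ) 0 *
        grad (hamiltonianZero m μ ε) (redState (x τ)) 2 - vecZ (x τ) 2 *
        grad (hamiltonianZero m μ ε) (redState (x τ)) 0) * Real.sin ((x τ).y 2) * hq
  have dM0 : HasDerivAt (fun t => (x t).M 0)
      ((gradL m μ (x τ) ⨯₃ (x τ).M - gradM m μ (x τ) ⨯₃ (x τ).L) 0) τ := by
    refine (hZ0.neg.congr_of_eventuallyEq ?_).congr_deriv ?_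
    · filter_upwards [hev] with t ht
      exact (hx t ht).2.1.M_zero hc
    · rw [eM]
      rfl
  have dM1 : HasDerivAt (fun t => (x t).M 1)
      ((gradL m μ (x τ) ⨯₃ (x τ).M - gradM m μ (x τ) ⨯₃ (x τ).L) 1) τ := by
    refine (((hZ2.mul dL2).div hZ1 hZne).congr_of_eventuallyEq ?_).congr_deriv ?_
    · filter_upwards [hev] with t ht
      exact (hx t ht).2.1.M_one hc
    · rw [eM, eL]
      simp
      field_simp
      ring
  have dM2 : HasDerivAt (fun t => (x t).M 2)
      ((gradL m μ (x τ) ⨯₃ (x τ).M - gradM m μ (x τ) ⨯₃ (x τ).L) 2) τ := by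
    refine (((hZ2.mul dL1).neg.div hZ1 hZne).congr_of_eventuallyEq ?_).congr_deriv ?_
    · filter_upwards [hev] with t ht
      exact (hx t ht).2.1.M_two hc
    · rw [eM, eL]
      simp
      field_simp
      ring
  refine ⟨hasDerivAt_pi.2 fun i => ?_, hasDerivAt_pi.2 fun i => ?_, hasDerivAt_pi.2 fun i => ?_,
    hasDerivAt_pi.2 fun i => ?_⟩
  · fin_cases i
    · rw [eL]
      refine (hasDerivAt_const τ (0 : ℝ)).congr_of_eventuallyEq ?_
      filter_upwards [hev] with t ht
      exact (hx t ht).2.1.1.2.1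
    · exact dL1
    · exact dL2
  · fin_cases i
    · exact dM0
    · exact dM1
    · exact dM2
  · rw [eY]
    have hP : ∀ (j : Fin 4) (a : ℝ), (∀ t ∈ I, (x t).P j = a) →
        HasDerivAt (fun t => (x t).P j) 0 τ := fun j a hj =>
      (hasDerivAt_const τ a).congr_of_eventuallyEq (by
        filter_upwards [hev] with t ht
        exact hj t ht)
    fin_cases i
    · simpa using hP 0 (-ε) fun t ht => (hx t ht).2.1.2.2.2
    · simpa using hp
    · simpa using hP 2 0 fun t ht => (hx t ht).2.1.1.1
    · simpa using hP 3 0 fun t ht => (hx t ht).2.1.1.2.2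
  · rw [eP]
    fin_cases i
    · exact ht
    · exact hr
    · exact hθ
    · exact hφ

end

/-! ### The reduced Poisson structure -/

/-- The entries are linear in x, so a partial derivative is the value at a basis vector; the matrix
at 0 is subtracted because of the constant entries for (r, P_r). -/
theorem partialD_poissonMatrix (x : Fin 5 → ℝ) (i j l : Fin 5) :
    partialD (fun z => poissonMatrix z i j) x l =
      poissonMatrix (Pi.single l 1) i j - poissonMatrix 0 i j := by
  refine HasGrad.partialD_eq (f := fun l => poissonMatrix (Pi.single l 1) i j -
    poissonMatrix 0 i j) ?_ l
  fin_cases i <;> fin_cases j <;>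
    simp only [poissonMatrix, Matrix.of_apply, Matrix.cons_val, Fin.zero_eta, Fin.mk_one,
      Fin.reduceFinMk, Pi.zero_apply, sub_self, neg_zero, sub_zero] <;>
    first
    | exact HasGrad.const _
    | exact (HasGrad.coord _).congr_grad (by funext k; simp [Pi.single_apply, eq_comm])
    | exact (HasGrad.coord _).neg.congr_grad (by funext k; simp [Pi.single_apply, eq_comm])

-- The bracket is the sum of the Lie–Poisson structure of so(2,1) and a canonical pair; the Jacobi
-- identity is checked on all index triples.
set_option maxHeartbeats 2000000 in
theorem isPoisson_poissonMatrix : IsPoisson poissonMatrix := by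
  constructor
  · intro x i j
    fin_cases i <;> fin_cases j <;> simp [poissonMatrix]
  · intro x i j k
    simp only [partialD_poissonMatrix, Fin.sum_univ_succ]
    fin_cases i <;> fin_cases j <;> fin_cases k <;> simp [poissonMatrix, Fin.succ]

theorem hasGrad_redCasimir (x : Fin 5 → ℝ) :
    HasGrad redCasimir ![-2 * x 0, 2 * x 1, -2 * x 2, 0, 0] x := by
  refine ((((HasGrad.coord 0).pow 2).neg.add ((HasGrad.coord 1).pow 2)).sub
    ((HasGrad.coord 2).pow 2)).congr_grad ?_
  funext i
  fin_cases i <;> simp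

theorem poissonMatrix_mulVec_redCasimir (x : Fin 5 → ℝ) :
    poissonMatrix x *ᵥ grad redCasimir x = 0 := by
  rw [(hasGrad_redCasimir x).grad_eq, poissonMatrix_mulVec]
  funext i
  fin_cases i <;> simp <;> ring

/-- For Z₂ ≠ 0 the kernel is the line of the Casimir differential, and 5 - 1 = 4. -/
theorem rank_poissonMatrix {x : Fin 5 → ℝ} (hx : x 1 ≠ 0) : (poissonMatrix x).rank = 4 := by
  have hker : LinearMap.ker (poissonMatrix x).mulVecLin =
      Submodule.span ℝ {![-x 0, x 1, -x 2, 0, 0]} := by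
    ext v
    rw [LinearMap.mem_ker, Matrix.mulVecLin_apply, poissonMatrix_mulVec,
      Submodule.mem_span_singleton]
    constructor
    · intro h
      have h0 := congrFun h 0
      have h2 := congrFun h 2
      have h3 := congrFun h 3
      have h4 := congrFun h 4
      simp only [Matrix.cons_val, Pi.zero_apply] at h0 h2 h3 h4
      refine ⟨v 1 / x 1, ?_⟩
      funext i
      fin_cases i <;> simp
      · field_simp; linarith
      · field_simp
      · field_simp; linarith
      · linarith
      · linarith
    · rintro ⟨k, rfl⟩
      funext i
      fin_cases i <;> simp <;> ring
  have h0 : (![-x 0, x 1, -x 2, 0, 0] : Fin 5 → ℝ) ≠ 0 := fun h => hx (by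
    simpa using congrFun h 1)
  have h1 := LinearMap.finrank_range_add_finrank_ker (poissonMatrix x).mulVecLin
  rw [hker, finrank_span_singleton h0, Module.finrank_fin_fun] at h1
  rw [Matrix.rank]
  omega

/-! ### The explicit reduced Hamiltonian -/

/-- The function `μ Z₁ / r² - ε`. -/
def redQ (μ ε : ℝ) (x : Fin 5 → ℝ) : ℝ := μ * x 0 / x 3 ^ 2 - ε

/-- A combination of the two Tulczyjew relations. -/
def tulThree (μ ε : ℝ) (x : Fin 5 → ℝ) : ℝ :=
  x 2 * redQ μ ε x + lapse μ (x 3) * x 1 * x 4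

/-- The coefficient of the first Tulczyjew relation in the Hamiltonian. -/
def coefOne (μ : ℝ) (x : Fin 5 → ℝ) : ℝ :=
  lapse μ (x 3) * (2 * x 0 * x 4 - x 1 * x 2 / x 3)

/-- The coefficient of the second Tulczyjew relation in the Hamiltonian. -/
def coefTwo (μ ε : ℝ) (x : Fin 5 → ℝ) : ℝ :=
  2 * x 0 * redQ μ ε x / lapse μ (x 3) + x 1 ^ 2 / x 3

/-- The numerator of the second term of the reduced Hamiltonian. -/
def funU (μ ε : ℝ) (x : Fin 5 → ℝ) : ℝ :=
  tulOne x * coefOne μ x + tulTwo μ ε x * coefTwo μ ε x +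
    tulThree μ ε x ^ 2 / lapse μ (x 3)

section

variable {m μ ε : ℝ} {x : Fin 5 → ℝ}

/-- The quadratic form is linear in the Tulczyjew vector, whose components on the section are the
three relations up to factors; hence a numerator of this shape. -/
theorem frameD_secFrame (hμ : 0 < μ) (hr : 2 * μ < x 3) :
    frameD μ (secFrame ε x) = 2 * μ / x 3 ^ 3 * funU μ ε x := by
  have hr0 : 0 < x 3 := by linarith
  have ha := lapse_pos hμ hr
  have hb := Real.sqrt_pos.2 ha
  have hsq := Real.sq_sqrt ha.le
  -- Writing μ through r and a, and a as b² with b = √a, leaves a rational identity in independent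
  -- variables.
  have hμ' : μ = x 3 * (1 - lapse μ (x 3)) / 2 := by
    rw [lapse]; field_simp; ring
  simp only [frameD, frameTul, frameQ, secFrame, funU, tulOne, tulTwo, tulThree, coefOne,
    coefTwo, redQ, Matrix.cons_val]
  generalize lapse μ (x 3) = a at *
  generalize √a = b at *
  subst hsq
  field_simp
  ring

theorem hamiltonianZero_eq_funU (m : ℝ) (hμ : 0 < μ) (hr : 2 * μ < x 3) (hx : 0 < x 1) :
    hamiltonianZero m μ ε x =
      -massSq μ ε x / (2 * m) + funU μ ε x / (m * funV μ ε x) := by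
  have hr0 : 0 < x 3 := by linarith
  rw [hamiltonianZero_eq m hμ hr hx, frameHam, frameSq_secFrame hμ hr,
    frameDen_secFrame hμ hr, frameD_secFrame hμ hr]
  have h1 : 2 * μ / x 3 ^ 3 ≠ 0 := by positivity
  have h2 : m * (-(2 * μ / x 3 ^ 3) * funV μ ε x) =
      2 * μ / x 3 ^ 3 * -(m * funV μ ε x) := by ring
  rw [h2, mul_div_mul_left _ _ h1, div_neg, sub_neg_eq_add]

theorem hamiltonianZero_eq_explicit (hm : 0 < m) (hμ : 0 < μ) (hx : RedRegular μ ε x) :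
    hamiltonianZero m μ ε x = hamiltonianZeroExplicit m μ ε x := by
  have hr0 := hx.radius_pos hμ
  have hr2 : x 3 - 2 * μ ≠ 0 := by linarith [hx.1]
  have hV := hx.2.2
  have ha := (hx.lapse_pos hμ).ne'
  have hN : -massSq μ ε x / 2 = lapse μ (x 3) / 2 * x 4 ^ 2 -
      (μ * x 0 - x 3 ^ 2 * ε) ^ 2 / (x 3 ^ 3 * (x 3 - 2 * μ)) / 2 +
      x 1 ^ 2 / x 3 * (lapse μ (x 3) / (2 * x 3)) := by
    rw [massSq]
    field_simp
    ring
  have hU : funU μ ε x = lapse μ (x 3) * (2 * x 0 ^ 2 + x 1 ^ 2) * x 4 ^ 2 +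
      x 1 * x 2 * (x 0 - 2 * x 3 * ε) / x 3 * x 4 +
      x 1 ^ 2 / x 3 ^ 3 * (x 3 * lapse μ (x 3) * x 1 ^ 2 + μ * x 0 ^ 2) -
      (μ * x 0 - x 3 ^ 2 * ε) ^ 2 / (x 3 ^ 3 * (x 3 - 2 * μ)) * (2 * x 0 ^ 2 - x 2 ^ 2) +
      x 1 ^ 2 / x 3 * (-(ε * x 0) - lapse μ (x 3) * x 2 ^ 2 / x 3) := by
    have hl : lapse μ (x 3) = (x 3 - 2 * μ) / x 3 := by rw [lapse]; field_simp
    simp only [funU, tulOne, tulTwo, tulThree, coefOne, coefTwo, redQ, hl]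
    field_simp
    ring
  rw [hamiltonianZero_eq_funU m hμ hx.1 hx.2.1]
  have h1 : -massSq μ ε x / (2 * m) + funU μ ε x / (m * funV μ ε x) =
      1 / m * (-massSq μ ε x / 2 + funU μ ε x / funV μ ε x) := by
    field_simp
  rw [h1, hN, hU, hamiltonianZeroExplicit]
  field_simp
  ring

theorem mu_eq_lapse (hr : x 3 ≠ 0) : μ = x 3 * (1 - lapse μ (x 3)) / 2 := by
  rw [lapse]
  field_simp
  ring

theorem tulTwo_eq : tulTwo μ ε x = -(redQ μ ε x * x 0) + lapse μ (x 3) / x 3 * x 1 ^ 2 := by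
  rw [tulTwo, redQ]
  ring

/-- This is the identity S^{AB}q_Aq_B = 0 on the section: the Tulczyjew vector pairs to zero with p,
so its nonzero components are dependent. -/
theorem tulThree_eq (hr : x 3 ≠ 0) (hx : x 1 ≠ 0) :
    tulThree μ ε x = x 3 / x 1 * (redQ μ ε x * tulOne x + x 4 * tulTwo μ ε x) := by
  rw [tulThree, tulTwo_eq, tulOne]
  field_simp
  ring

theorem massSq_eq (hμ : 0 < μ) (hr : 2 * μ < x 3) :
    massSq μ ε x = -(lapse μ (x 3) * x 4 ^ 2) + redQ μ ε x ^ 2 / lapse μ (x 3) -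
      lapse μ (x 3) * x 1 ^ 2 / x 3 ^ 2 := by
  have hr0 : 0 < x 3 := by linarith
  have hr2 : x 3 - 2 * μ ≠ 0 := by linarith
  have hl : lapse μ (x 3) = (x 3 - 2 * μ) / x 3 := by rw [lapse]; field_simp
  rw [massSq, redQ, hl]
  field_simp

end

/-! ### Gradients of the reduced functions -/

/-- The gradient of `lapse`. -/
def dLapse (μ : ℝ) (x : Fin 5 → ℝ) : Fin 5 → ℝ := ![0, 0, 0, 2 * μ / x 3 ^ 2, 0]

/-- The gradient of `redQ`. -/
def dRedQ (μ : ℝ) (x : Fin 5 → ℝ) : Fin 5 → ℝ :=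
  ![μ / x 3 ^ 2, 0, 0, -(2 * μ * x 0 / x 3 ^ 3), 0]

/-- The gradient of `tulOne`. -/
def dOne (x : Fin 5 → ℝ) : Fin 5 → ℝ :=
  ![x 4, x 2 / x 3, x 1 / x 3, -(x 1 * x 2 / x 3 ^ 2), x 0]

/-- The gradient of `tulTwo`. -/
def dTwo (μ ε : ℝ) (x : Fin 5 → ℝ) : Fin 5 → ℝ :=
  ![ε - 2 * μ * x 0 / x 3 ^ 2, 2 * lapse μ (x 3) * x 1 / x 3, 0,
    2 * μ * x 0 ^ 2 / x 3 ^ 3 + x 1 ^ 2 * (4 * μ / x 3 ^ 3 - 1 / x 3 ^ 2), 0]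

/-- The gradient of `tulThree`. -/
def dThree (μ ε : ℝ) (x : Fin 5 → ℝ) : Fin 5 → ℝ :=
  ![x 2 * μ / x 3 ^ 2, lapse μ (x 3) * x 4, redQ μ ε x,
    -(2 * μ * x 0 * x 2 / x 3 ^ 3) + 2 * μ / x 3 ^ 2 * x 1 * x 4, lapse μ (x 3) * x 1]

/-- The gradient of `coefOne`. -/
def dCoefOne (μ : ℝ) (x : Fin 5 → ℝ) : Fin 5 → ℝ :=
  ![2 * lapse μ (x 3) * x 4, -(lapse μ (x 3) * x 2 / x 3), -(lapse μ (x 3) * x 1 / x 3),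
    2 * μ / x 3 ^ 2 * (2 * x 0 * x 4 - x 1 * x 2 / x 3) + lapse μ (x 3) * x 1 * x 2 / x 3 ^ 2,
    2 * lapse μ (x 3) * x 0]

/-- The gradient of `coefTwo`. -/
def dCoefTwo (μ ε : ℝ) (x : Fin 5 → ℝ) : Fin 5 → ℝ :=
  ![2 * redQ μ ε x / lapse μ (x 3) + 2 * x 0 * μ / (x 3 ^ 2 * lapse μ (x 3)), 2 * x 1 / x 3, 0,
    -(4 * μ * x 0 ^ 2 / (x 3 ^ 3 * lapse μ (x 3))) -
      4 * μ * x 0 * redQ μ ε x / (x 3 ^ 2 * lapse μ (x 3) ^ 2) - x 1 ^ 2 / x 3 ^ 2, 0]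

/-- The gradient of `massSq`. -/
def dMass (μ ε : ℝ) (x : Fin 5 → ℝ) : Fin 5 → ℝ :=
  ![2 * redQ μ ε x * μ / (x 3 ^ 2 * lapse μ (x 3)), -(2 * lapse μ (x 3) * x 1 / x 3 ^ 2), 0,
    -(2 * μ / x 3 ^ 2 * x 4 ^ 2) - 4 * μ * redQ μ ε x * x 0 / (x 3 ^ 3 * lapse μ (x 3)) -
      2 * μ * redQ μ ε x ^ 2 / (x 3 ^ 2 * lapse μ (x 3) ^ 2) -
      x 1 ^ 2 * (6 * μ / x 3 ^ 4 - 2 / x 3 ^ 3), -(2 * lapse μ (x 3) * x 4)]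

/-- The gradient of `funV`. -/
def dFunV (μ ε : ℝ) (x : Fin 5 → ℝ) : Fin 5 → ℝ :=
  (x 3 ^ 3 / μ) • dMass μ ε x +
    ![-4 * x 0, -2 * x 1, 2 * x 2, 3 * x 3 ^ 2 * massSq μ ε x / μ, 0]

/-- The gradient of `funU`. -/
def dFunU (μ ε : ℝ) (x : Fin 5 → ℝ) : Fin 5 → ℝ :=
  tulOne x • dCoefOne μ x + coefOne μ x • dOne x + tulTwo μ ε x • dCoefTwo μ ε x +
    coefTwo μ ε x • dTwo μ ε x + (2 * tulThree μ ε x / lapse μ (x 3)) • dThree μ ε x -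
    (tulThree μ ε x ^ 2 / lapse μ (x 3) ^ 2) • dLapse μ x

/-- The gradient of the reduced Hamiltonian. -/
def dHam (m μ ε : ℝ) (x : Fin 5 → ℝ) : Fin 5 → ℝ :=
  (-1 / (2 * m)) • dMass μ ε x + (1 / (m * funV μ ε x)) • dFunU μ ε x -
    (funU μ ε x / (m * funV μ ε x ^ 2)) • dFunV μ ε x

theorem HasGrad.congr_of_eventuallyEq {n : ℕ} {F G : (Fin n → ℝ) → ℝ} {f x : Fin n → ℝ}
    (h : HasGrad F f x) (hG : G =ᶠ[nhds x] F) : HasGrad G f x :=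
  HasFDerivAt.congr_of_eventuallyEq h hG

section

variable {m μ ε : ℝ} {x : Fin 5 → ℝ}

theorem hasGrad_lapse (hr : x 3 ≠ 0) : HasGrad (fun z => lapse μ (z 3)) (dLapse μ x) x := by
  refine ((HasGrad.const 1).sub ((HasGrad.const (2 * μ)).div (HasGrad.coord 3) hr)).congr_grad ?_
  funext i
  simp only [Pi.sub_apply, Pi.smul_apply]
  fin_cases i <;> simp [dLapse]

theorem hasGrad_redQ (hr : x 3 ≠ 0) : HasGrad (redQ μ ε) (dRedQ μ x) x := by
  refine ((((HasGrad.const μ).mul (HasGrad.coord 0)).div ((HasGrad.coord 3).pow 2)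
    (pow_ne_zero 2 hr)).sub (HasGrad.const ε)).congr_grad ?_
  funext i
  simp only [Pi.add_apply, Pi.sub_apply, Pi.smul_apply]
  fin_cases i <;> simp [dRedQ] <;> field_simp

theorem hasGrad_tulOne (hr : x 3 ≠ 0) : HasGrad tulOne (dOne x) x := by
  refine (((HasGrad.coord 0).mul (HasGrad.coord 4)).add (((HasGrad.coord 1).mul
    (HasGrad.coord 2)).div (HasGrad.coord 3) hr)).congr_grad ?_
  funext i
  simp only [Pi.add_apply, Pi.sub_apply, Pi.smul_apply]
  fin_cases i <;> simp [dOne] <;> field_simp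

theorem hasGrad_tulTwo (hr : x 3 ≠ 0) : HasGrad (tulTwo μ ε) (dTwo μ ε x) x := by
  refine ((((HasGrad.const ε).mul (HasGrad.coord 0)).sub (((HasGrad.const μ).mul
    ((HasGrad.coord 0).pow 2)).div ((HasGrad.coord 3).pow 2) (pow_ne_zero 2 hr))).add
    (((hasGrad_lapse hr).div (HasGrad.coord 3) hr).mul
      ((HasGrad.coord 1).pow 2))).congr_grad ?_
  funext i
  simp only [Pi.add_apply, Pi.sub_apply, Pi.smul_apply]
  fin_cases i <;> simp [dTwo, dLapse] <;> (try simp only [lapse]) <;> field_simp <;> ring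

theorem hasGrad_tulThree (hr : x 3 ≠ 0) : HasGrad (tulThree μ ε) (dThree μ ε x) x := by
  refine (((HasGrad.coord 2).mul (hasGrad_redQ hr)).add (((hasGrad_lapse hr).mul
    (HasGrad.coord 1)).mul (HasGrad.coord 4))).congr_grad ?_
  funext i
  simp only [Pi.add_apply, Pi.smul_apply]
  fin_cases i <;> simp [dThree, dLapse, dRedQ] <;> field_simp

theorem hasGrad_coefOne (hr : x 3 ≠ 0) : HasGrad (coefOne μ) (dCoefOne μ x) x := by
  refine ((hasGrad_lapse hr).mul ((((HasGrad.const 2).mul (HasGrad.coord 0)).mul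
    (HasGrad.coord 4)).sub (((HasGrad.coord 1).mul (HasGrad.coord 2)).div
    (HasGrad.coord 3) hr))).congr_grad ?_
  funext i
  simp only [Pi.add_apply, Pi.sub_apply, Pi.smul_apply]
  fin_cases i <;> simp [dCoefOne, dLapse] <;> field_simp
  ring

theorem hasGrad_coefTwo (hr : x 3 ≠ 0) (ha : lapse μ (x 3) ≠ 0) :
    HasGrad (coefTwo μ ε) (dCoefTwo μ ε x) x := by
  refine (((((HasGrad.const 2).mul (HasGrad.coord 0)).mul (hasGrad_redQ hr)).div
    (hasGrad_lapse hr) ha).add (((HasGrad.coord 1).pow 2).div (HasGrad.coord 3)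
      hr)).congr_grad ?_
  funext i
  simp only [Pi.add_apply, Pi.sub_apply, Pi.smul_apply]
  fin_cases i <;> simp [dCoefTwo, dLapse, dRedQ] <;> field_simp <;> ring

theorem hasGrad_funU (hr : x 3 ≠ 0) (ha : lapse μ (x 3) ≠ 0) :
    HasGrad (funU μ ε) (dFunU μ ε x) x := by
  refine ((((hasGrad_tulOne hr).mul (hasGrad_coefOne hr)).add ((hasGrad_tulTwo hr).mul
    (hasGrad_coefTwo hr ha))).add (((hasGrad_tulThree hr).pow 2).div
    (hasGrad_lapse hr) ha)).congr_grad ?_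
  funext i
  simp only [dFunU, Pi.add_apply, Pi.sub_apply, Pi.smul_apply, smul_eq_mul]
  field_simp
  ring

theorem hasGrad_massSq (hμ : 0 < μ) (hr : 2 * μ < x 3) :
    HasGrad (massSq μ ε) (dMass μ ε x) x := by
  have ha := (lapse_pos hμ hr).ne'
  have hr0 : x 3 ≠ 0 := by linarith
  have hl : lapse μ (x 3) * x 3 = x 3 - 2 * μ := by rw [lapse]; field_simp
  have h : HasGrad (fun z => -(lapse μ (z 3) * z 4 ^ 2) + redQ μ ε z ^ 2 / lapse μ (z 3) -
      lapse μ (z 3) * z 1 ^ 2 / z 3 ^ 2) (dMass μ ε x) x := by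
    refine ((((hasGrad_lapse hr0).mul ((HasGrad.coord 4).pow 2)).neg.add
      (((hasGrad_redQ hr0).pow 2).div (hasGrad_lapse hr0) ha)).sub
      (((hasGrad_lapse hr0).mul ((HasGrad.coord 1).pow 2)).div ((HasGrad.coord 3).pow 2)
        (pow_ne_zero 2 hr0))).congr_grad ?_
    funext i
    simp only [Pi.add_apply, Pi.sub_apply, Pi.neg_apply, Pi.smul_apply]
    fin_cases i <;> simp [dMass, dLapse, dRedQ] <;> field_simp
    linear_combination 2 * lapse μ (x 3) ^ 2 * x 1 ^ 2 * hl
  -- The form of N through `redQ` and `lapse` is available for r > 2μ, an open condition; nearby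
  -- equality is enough.
  refine h.congr_of_eventuallyEq ?_
  filter_upwards [(continuous_apply (3 : Fin 5)).continuousAt.eventually (lt_mem_nhds hr)]
    with z hz
  exact massSq_eq hμ hz

theorem hasGrad_funV (hμ : 0 < μ) (hr : 2 * μ < x 3) :
    HasGrad (funV μ ε) (dFunV μ ε x) x := by
  refine ((((((hasGrad_massSq hμ hr).mul ((HasGrad.coord 3).pow 3)).div
    (HasGrad.const μ) hμ.ne').sub ((HasGrad.const 2).mul ((HasGrad.coord 0).pow 2))).sub
    ((HasGrad.coord 1).pow 2)).add ((HasGrad.coord 2).pow 2)).congr_grad ?_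
  funext i
  simp only [Pi.add_apply, Pi.sub_apply, Pi.smul_apply]
  fin_cases i <;> simp [dFunV] <;> field_simp <;> ring

theorem RedRegular.hasGrad_dHam (hm : 0 < m) (hμ : 0 < μ) (hx : RedRegular μ ε x) :
    HasGrad (hamiltonianZero m μ ε) (dHam m μ ε x) x := by
  have hr := (hx.radius_pos hμ).ne'
  have ha := (hx.lapse_pos hμ).ne'
  have h : HasGrad (fun z => -massSq μ ε z / (2 * m) + funU μ ε z / (m * funV μ ε z))
      (dHam m μ ε x) x := by
    refine (((hasGrad_massSq hμ hx.1).neg.div (HasGrad.const (2 * m)) (by positivity)).add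
      ((hasGrad_funU hr ha).div ((HasGrad.const m).mul (hasGrad_funV hμ hx.1))
        (mul_ne_zero hm.ne' hx.2.2))).congr_grad ?_
    have hV := hx.2.2
    funext i
    simp [dHam]
    field_simp
    ring
  refine h.congr_of_eventuallyEq ?_
  filter_upwards [(continuous_apply (3 : Fin 5)).continuousAt.eventually (lt_mem_nhds hx.1),
    (continuous_apply (1 : Fin 5)).continuousAt.eventually (lt_mem_nhds hx.2.1)] with z h3 h1
  exact hamiltonianZero_eq_funU m hμ h3 h1

end

/-! ### Invariance of the Tulczyjew manifold -/

/-- The Poisson bracket of two functions with gradients `f` and `g`. -/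
def bracket (x f g : Fin 5 → ℝ) : ℝ := f ⬝ᵥ (poissonMatrix x *ᵥ g)

theorem bracket_eq (x f g : Fin 5 → ℝ) :
    bracket x f g = f 0 * (x 2 * g 1 + x 1 * g 2) + f 1 * (-(x 2 * g 0) + x 0 * g 2) +
      f 2 * (-(x 1 * g 0) - x 0 * g 1) + f 3 * g 4 - f 4 * g 3 := by
  rw [bracket, poissonMatrix_mulVec]
  simp [dotProduct, Fin.sum_univ_succ]
  ring

theorem bracket_self (x f : Fin 5 → ℝ) : bracket x f f = 0 := by
  rw [bracket_eq]
  ring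

/-- The first cofactor in the evolution of `tulOne`. -/
def cofactorOneOne (μ ε : ℝ) (x : Fin 5 → ℝ) : ℝ :=
  let Z₁ := x 0
  let Z₂ := x 1
  let Z₃ := x 2
  let r := x 3
  let p := x 4
  let a := lapse μ (x 3)
  let q := redQ μ ε x
  Z₁ ^ 2 * p * a ^ 2 / 2 - Z₁ ^ 2 * p * a + Z₁ ^ 2 * p / 2 - Z₁ * Z₂ * Z₃ * a ^ 2 / (2 * r)
    + Z₁ * Z₂ * Z₃ * a / r - Z₁ * Z₂ * Z₃ / (2 * r) - Z₁ * p * q * r * a + Z₁ * p * q * r -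
    3 * Z₂ ^ 2 * p * a ^ 2 / 4 + Z₂ ^ 2 * p * a / 2 + Z₂ ^ 2 * p / 4 - Z₂ * Z₃ * q * a + Z₂
    * Z₃ * q - Z₃ ^ 2 * p * a ^ 2 / 4 + Z₃ ^ 2 * p * a / 2 - Z₃ ^ 2 * p / 4 - p ^ 3 * r ^ 2
    * a ^ 2 / 2 + p ^ 3 * r ^ 2 * a / 2

/-- The second cofactor in the evolution of `tulOne`. -/
def cofactorOneTwo (μ ε : ℝ) (x : Fin 5 → ℝ) : ℝ :=
  let Z₁ := x 0
  let Z₂ := x 1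
  let Z₃ := x 2
  let r := x 3
  let a := lapse μ (x 3)
  let q := redQ μ ε x
  Z₁ ^ 2 * q / a - Z₁ ^ 2 * q / 2 - Z₁ ^ 2 * q / (2 * a ^ 2) + Z₁ * Z₃ ^ 2 * a / (2 * r) -
    Z₁ * Z₃ ^ 2 / r + Z₁ * Z₃ ^ 2 / (2 * r * a) - Z₁ * q ^ 2 * r / a + Z₁ * q ^ 2 * r / a ^
    2 - Z₂ ^ 2 * q / 4 + Z₂ ^ 2 * q / (2 * a) - Z₂ ^ 2 * q / (4 * a ^ 2) + 5 * Z₃ ^ 2 * q /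
    4 - 3 * Z₃ ^ 2 * q / (2 * a) + Z₃ ^ 2 * q / (4 * a ^ 2) - q ^ 3 * r ^ 2 / (2 * a ^ 2) +
    q ^ 3 * r ^ 2 / (2 * a ^ 3)

/-- The third cofactor in the evolution of `tulOne`. -/
def cofactorOneThree (μ ε : ℝ) (x : Fin 5 → ℝ) : ℝ :=
  let Z₂ := x 1
  let Z₃ := x 2
  let r := x 3
  let p := x 4
  let a := lapse μ (x 3)
  let q := redQ μ ε x
  Z₂ ^ 2 * Z₃ / (2 * r) - Z₂ ^ 2 * Z₃ * a / (4 * r) - Z₂ ^ 2 * Z₃ / (4 * r * a) + Z₂ * p * q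
    * r / 2 - Z₂ * p * q * r / (2 * a) + Z₃ ^ 3 * a / (4 * r) - Z₃ ^ 3 / (2 * r) + Z₃ ^ 3 /
    (4 * r * a) + Z₃ * p ^ 2 * r * a / 2 - Z₃ * p ^ 2 * r / 2 - Z₃ * q ^ 2 * r / (2 * a) +
    Z₃ * q ^ 2 * r / (2 * a ^ 2)

/-- The first cofactor in the evolution of `tulTwo`. -/
def cofactorTwoOne (μ ε : ℝ) (x : Fin 5 → ℝ) : ℝ :=
  let Z₁ := x 0
  let Z₂ := x 1
  let Z₃ := x 2
  let r := x 3
  let p := x 4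
  let a := lapse μ (x 3)
  let q := redQ μ ε x
  3 * Z₁ * Z₂ ^ 2 * a ^ 2 / r - 2 * Z₁ * Z₂ ^ 2 * a ^ 3 / r - Z₁ * Z₂ ^ 2 * a / r + Z₁ * p ^
    2 * r * a ^ 3 - Z₁ * p ^ 2 * r * a ^ 2 - Z₁ * q ^ 2 * r * a + Z₁ * q ^ 2 * r + Z₂ ^ 2 *
    q * a ^ 2 - Z₂ ^ 2 * q * a + Z₂ * Z₃ * p * a ^ 3 / 2 - Z₂ * Z₃ * p * a ^ 2 / 2 + Z₃ ^ 2
    * q * a ^ 2 - Z₃ ^ 2 * q * a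

/-- The second cofactor in the evolution of `tulTwo`. -/
def cofactorTwoTwo (μ ε : ℝ) (x : Fin 5 → ℝ) : ℝ :=
  let Z₁ := x 0
  let Z₂ := x 1
  let Z₃ := x 2
  let r := x 3
  let a := lapse μ (x 3)
  let q := redQ μ ε x
  2 * Z₁ * Z₂ * Z₃ * a ^ 2 / r - 3 * Z₁ * Z₂ * Z₃ * a / r + Z₁ * Z₂ * Z₃ / r - 3 * Z₂ * Z₃ *
    q * a / 2 + 3 * Z₂ * Z₃ * q / 2

/-- The third cofactor in the evolution of `tulTwo`. -/
def cofactorTwoThree (μ ε : ℝ) (x : Fin 5 → ℝ) : ℝ :=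
  let Z₂ := x 1
  let Z₃ := x 2
  let r := x 3
  let p := x 4
  let a := lapse μ (x 3)
  let q := redQ μ ε x
  Z₂ ^ 3 * a ^ 2 / r + Z₂ ^ 3 * a / (2 * r) - Z₂ ^ 3 / (2 * r) - Z₂ * Z₃ ^ 2 * a ^ 2 / (2 *
    r) + Z₂ * Z₃ ^ 2 / (2 * r) + 2 * Z₂ * p ^ 2 * r * a ^ 2 - Z₂ * p ^ 2 * r * a - 2 * Z₂ *
    q ^ 2 * r + Z₂ * q ^ 2 * r / a

section

variable {m μ ε : ℝ} {x : Fin 5 → ℝ}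

theorem mul_funV (hμ : 0 < μ) :
    μ * funV μ ε x = x 3 ^ 3 * massSq μ ε x - μ * (2 * x 0 ^ 2 + x 1 ^ 2 - x 2 ^ 2) := by
  rw [funV]
  field_simp
  ring

theorem dTwo_zero : dTwo μ ε x 0 = -redQ μ ε x - μ * x 0 / x 3 ^ 2 := by
  simp [dTwo, redQ]
  ring

/-- The left side collects the terms of mμV₀{T₁, H₀} in which no factor T₁, T₂, T₃ survives
undifferentiated. They still lie in the ideal of the relations, and the cofactors are the
certificate. -/
theorem cofactorOne_identity (hμ : 0 < μ) (hr : 2 * μ < x 3) :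
    -(μ * funV μ ε x * bracket x (dOne x) (dMass μ ε x)) / 2 +
      μ * coefTwo μ ε x * bracket x (dOne x) (dTwo μ ε x) =
    cofactorOneOne μ ε x * tulOne x + cofactorOneTwo μ ε x * tulTwo μ ε x +
      cofactorOneThree μ ε x * tulThree μ ε x := by
  have hr0 : x 3 ≠ 0 := by linarith
  have ha := (lapse_pos hμ hr).ne'
  have hμ' : μ = x 3 * (1 - lapse μ (x 3)) / 2 := mu_eq_lapse hr0
  rw [mul_funV hμ, massSq_eq hμ hr, bracket_eq, bracket_eq, dTwo_zero, tulTwo_eq]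
  simp only [dOne, dMass, dTwo, coefTwo, tulOne, tulThree, cofactorOneOne, cofactorOneTwo,
    cofactorOneThree, Matrix.cons_val]
  -- With q and a in place of ε and μ the statement is a rational identity in independent variables.
  generalize redQ μ ε x = q
  generalize lapse μ (x 3) = a at *
  clear hμ hr
  subst hμ'
  field_simp
  ring

theorem cofactorTwo_identity (hμ : 0 < μ) (hr : 2 * μ < x 3) :
    -(μ * funV μ ε x * bracket x (dTwo μ ε x) (dMass μ ε x)) / 2 +
      μ * coefOne μ x * bracket x (dTwo μ ε x) (dOne x) =
    cofactorTwoOne μ ε x * tulOne x + cofactorTwoTwo μ ε x * tulTwo μ ε x +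
      cofactorTwoThree μ ε x * tulThree μ ε x := by
  have hr0 : x 3 ≠ 0 := by linarith
  have ha := (lapse_pos hμ hr).ne'
  have hμ' : μ = x 3 * (1 - lapse μ (x 3)) / 2 := mu_eq_lapse hr0
  rw [mul_funV hμ, massSq_eq hμ hr, bracket_eq, bracket_eq, dTwo_zero, tulTwo_eq]
  simp only [dOne, dMass, dTwo, coefOne, tulOne, tulThree, cofactorTwoOne, cofactorTwoTwo,
    cofactorTwoThree, Matrix.cons_val]
  generalize redQ μ ε x = q
  generalize lapse μ (x 3) = a at *
  clear hμ hr
  subst hμ'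
  field_simp
  ring

/-- The coefficient of `tulOne` in the bracket with the Hamiltonian. -/
def evolutionOne (m μ ε : ℝ) (f : (Fin 5 → ℝ) → Fin 5 → ℝ) (k₁ : (Fin 5 → ℝ) → ℝ)
    (x : Fin 5 → ℝ) : ℝ :=
  (k₁ x / μ + bracket x (f x) (dCoefOne μ x)) / (m * funV μ ε x) -
    coefOne μ x * bracket x (f x) (dFunV μ ε x) / (m * funV μ ε x ^ 2)

/-- The coefficient of `tulTwo` in the bracket with the Hamiltonian. -/
def evolutionTwo (m μ ε : ℝ) (f : (Fin 5 → ℝ) → Fin 5 → ℝ) (k₂ : (Fin 5 → ℝ) → ℝ)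
    (x : Fin 5 → ℝ) : ℝ :=
  (k₂ x / μ + bracket x (f x) (dCoefTwo μ ε x)) / (m * funV μ ε x) -
    coefTwo μ ε x * bracket x (f x) (dFunV μ ε x) / (m * funV μ ε x ^ 2)

/-- The coefficient of `tulThree` in the bracket with the Hamiltonian. -/
def evolutionThree (m μ ε : ℝ) (f : (Fin 5 → ℝ) → Fin 5 → ℝ) (k₃ : (Fin 5 → ℝ) → ℝ)
    (x : Fin 5 → ℝ) : ℝ :=
  (k₃ x / μ + 2 * bracket x (f x) (dThree μ ε x) / lapse μ (x 3) -
      tulThree μ ε x * bracket x (f x) (dLapse μ x) / lapse μ (x 3) ^ 2) / (m * funV μ ε x) -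
    tulThree μ ε x / lapse μ (x 3) * bracket x (f x) (dFunV μ ε x) / (m * funV μ ε x ^ 2)

/-- By the Leibniz rule, terms of {f, H₀} with an undifferentiated T_i lie in the ideal already, and
`h` treats the others. The part with T₃ is then distributed over T₁ and T₂ by `tulThree_eq`. -/
theorem RedRegular.bracket_dHam (hm : 0 < m) (hμ : 0 < μ) (hx : RedRegular μ ε x)
    {f : (Fin 5 → ℝ) → Fin 5 → ℝ} {k₁ k₂ k₃ : (Fin 5 → ℝ) → ℝ}
    (h : -(μ * funV μ ε x * bracket x (f x) (dMass μ ε x)) / 2 +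
      μ * coefOne μ x * bracket x (f x) (dOne x) +
      μ * coefTwo μ ε x * bracket x (f x) (dTwo μ ε x) =
      k₁ x * tulOne x + k₂ x * tulTwo μ ε x + k₃ x * tulThree μ ε x) :
    bracket x (f x) (dHam m μ ε x) =
      (evolutionOne m μ ε f k₁ x +
        evolutionThree m μ ε f k₃ x * (x 3 / x 1 * redQ μ ε x)) * tulOne x +
      (evolutionTwo m μ ε f k₂ x +
        evolutionThree m μ ε f k₃ x * (x 3 / x 1 * x 4)) * tulTwo μ ε x := by
  have hV := hx.2.2
  have ha := (hx.lapse_pos hμ).ne'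
  have h3 := tulThree_eq (μ := μ) (ε := ε) (hx.radius_pos hμ).ne' hx.2.1.ne'
  have hlin : bracket x (f x) (dHam m μ ε x) =
      (-(μ * funV μ ε x * bracket x (f x) (dMass μ ε x)) / 2 +
      μ * coefOne μ x * bracket x (f x) (dOne x) +
      μ * coefTwo μ ε x * bracket x (f x) (dTwo μ ε x)) / (μ * (m * funV μ ε x)) +
      (tulOne x * bracket x (f x) (dCoefOne μ x) +
        tulTwo μ ε x * bracket x (f x) (dCoefTwo μ ε x) +
        2 * tulThree μ ε x / lapse μ (x 3) * bracket x (f x) (dThree μ ε x) -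
        tulThree μ ε x ^ 2 / lapse μ (x 3) ^ 2 * bracket x (f x) (dLapse μ x)) /
          (m * funV μ ε x) -
      funU μ ε x / (m * funV μ ε x ^ 2) * bracket x (f x) (dFunV μ ε x) := by
    simp only [bracket_eq, dHam, dFunU, Pi.add_apply, Pi.sub_apply, Pi.smul_apply, smul_eq_mul]
    field_simp
    ring
  rw [hlin, h, funU]
  have h4 : (evolutionOne m μ ε f k₁ x +
        evolutionThree m μ ε f k₃ x * (x 3 / x 1 * redQ μ ε x)) * tulOne x +
      (evolutionTwo m μ ε f k₂ x +
        evolutionThree m μ ε f k₃ x * (x 3 / x 1 * x 4)) * tulTwo μ ε x =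
      evolutionOne m μ ε f k₁ x * tulOne x + evolutionTwo m μ ε f k₂ x * tulTwo μ ε x +
        evolutionThree m μ ε f k₃ x * tulThree μ ε x := by
    rw [h3]
    ring
  rw [h4, evolutionOne, evolutionTwo, evolutionThree]
  field_simp
  ring

@[fun_prop]
theorem continuousAt_coord (i : Fin 5) (x : Fin 5 → ℝ) :
    ContinuousAt (fun z : Fin 5 → ℝ => z i) x :=
  (continuous_apply i).continuousAt

theorem continuousAt_bracket {f g : (Fin 5 → ℝ) → Fin 5 → ℝ}
    (hf : ∀ i, ContinuousAt (fun z => f z i) x) (hg : ∀ i, ContinuousAt (fun z => g z i) x) :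
    ContinuousAt (fun z => bracket z (f z) (g z)) x := by
  have := hf 0; have := hf 1; have := hf 2; have := hf 3; have := hf 4
  have := hg 0; have := hg 1; have := hg 2; have := hg 3; have := hg 4
  simp only [bracket_eq]
  fun_prop

/-- Continuity is all that the uniqueness theorem for the linear system of (T₁, T₂) asks of its
coefficients. -/
theorem RedRegular.continuousAt_evolution (hm : 0 < m) (hμ : 0 < μ) (hx : RedRegular μ ε x)
    {f : (Fin 5 → ℝ) → Fin 5 → ℝ} {k₁ k₂ k₃ : (Fin 5 → ℝ) → ℝ}
    (hf : ∀ i, ContinuousAt (fun z => f z i) x) (hk₁ : ContinuousAt k₁ x)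
    (hk₂ : ContinuousAt k₂ x) (hk₃ : ContinuousAt k₃ x) :
    ContinuousAt (fun x => evolutionOne m μ ε f k₁ x +
      evolutionThree m μ ε f k₃ x * (x 3 / x 1 * redQ μ ε x)) x ∧
    ContinuousAt (fun x => evolutionTwo m μ ε f k₂ x +
      evolutionThree m μ ε f k₃ x * (x 3 / x 1 * x 4)) x := by
  have hr := (hx.radius_pos hμ).ne'
  have ha0 := (hx.lapse_pos hμ).ne'
  have hr2 := pow_ne_zero 2 hr
  have hr3 := pow_ne_zero 3 hr
  have ha2 := pow_ne_zero 2 ha0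
  have hra := mul_ne_zero hr2 ha0
  have hra2 := mul_ne_zero hr2 ha2
  have hr3a := mul_ne_zero hr3 ha0
  have hr4 := pow_ne_zero 4 hr
  have hZ := hx.2.1.ne'
  have ha : ContinuousAt (fun z : Fin 5 → ℝ => lapse μ (z 3)) x :=
    HasFDerivAt.continuousAt (hasGrad_lapse hr)
  have hq : ContinuousAt (redQ μ ε) x := HasFDerivAt.continuousAt (hasGrad_redQ hr)
  have h3 : ContinuousAt (tulThree μ ε) x := HasFDerivAt.continuousAt (hasGrad_tulThree hr)
  have hc1 : ContinuousAt (coefOne μ) x := HasFDerivAt.continuousAt (hasGrad_coefOne hr)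
  have hc2 : ContinuousAt (coefTwo μ ε) x := HasFDerivAt.continuousAt (hasGrad_coefTwo hr ha0)
  have hN : ContinuousAt (massSq μ ε) x := HasFDerivAt.continuousAt (hasGrad_massSq hμ hx.1)
  have hV : ContinuousAt (funV μ ε) x := HasFDerivAt.continuousAt (hasGrad_funV hμ hx.1)
  have hmV := mul_ne_zero hm.ne' hx.2.2
  have hmV2 := mul_ne_zero hm.ne' (pow_ne_zero 2 hx.2.2)
  have e1 : ContinuousAt (fun z => bracket z (f z) (dCoefOne μ z)) x := by
    refine continuousAt_bracket hf fun i => ?_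
    fin_cases i <;> simp [dCoefOne] <;> fun_prop (disch := assumption)
  have e2 : ContinuousAt (fun z => bracket z (f z) (dCoefTwo μ ε z)) x := by
    refine continuousAt_bracket hf fun i => ?_
    fin_cases i <;> simp [dCoefTwo] <;> fun_prop (disch := assumption)
  have e3 : ContinuousAt (fun z => bracket z (f z) (dThree μ ε z)) x := by
    refine continuousAt_bracket hf fun i => ?_
    fin_cases i <;> simp [dThree] <;> fun_prop (disch := assumption)
  have e4 : ContinuousAt (fun z => bracket z (f z) (dLapse μ z)) x := by
    refine continuousAt_bracket hf fun i => ?_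
    fin_cases i <;> simp [dLapse] <;> fun_prop (disch := assumption)
  have e5 : ContinuousAt (fun z => bracket z (f z) (dFunV μ ε z)) x := by
    refine continuousAt_bracket hf fun i => ?_
    have hd : ∀ i, ContinuousAt (fun z => dMass μ ε z i) x := by
      intro i
      fin_cases i <;> simp [dMass] <;> fun_prop (disch := assumption)
    have hdi := hd i
    have hμ0 := hμ.ne'
    simp only [dFunV, Pi.add_apply, Pi.smul_apply, smul_eq_mul]
    refine ContinuousAt.add (by fun_prop (disch := assumption)) ?_
    fin_cases i <;> simp <;> fun_prop (disch := assumption)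
  have hμ0 := hμ.ne'
  have hE3 : ContinuousAt (evolutionThree m μ ε f k₃) x := by
    unfold evolutionThree
    fun_prop (disch := assumption)
  unfold evolutionOne evolutionTwo
  constructor <;> fun_prop (disch := assumption)

theorem RedRegular.continuousAt_rows (hμ : 0 < μ) (hx : RedRegular μ ε x) (i : Fin 5) :
    ContinuousAt (fun z => dOne z i) x ∧ ContinuousAt (fun z => dTwo μ ε z i) x := by
  have hr := (hx.radius_pos hμ).ne'
  have hr2 := pow_ne_zero 2 hr
  have hr3 := pow_ne_zero 3 hr
  have ha : ContinuousAt (fun z : Fin 5 → ℝ => lapse μ (z 3)) x :=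
    HasFDerivAt.continuousAt (hasGrad_lapse hr)
  constructor
  · fin_cases i <;> simp [dOne] <;> fun_prop (disch := assumption)
  · fin_cases i <;> simp [dTwo] <;> fun_prop (disch := assumption)

theorem RedRegular.continuousAt_cofactors (hμ : 0 < μ) (hx : RedRegular μ ε x) :
    (ContinuousAt (cofactorOneOne μ ε) x ∧ ContinuousAt (cofactorOneTwo μ ε) x ∧
      ContinuousAt (cofactorOneThree μ ε) x) ∧
    ContinuousAt (cofactorTwoOne μ ε) x ∧ ContinuousAt (cofactorTwoTwo μ ε) x ∧
      ContinuousAt (cofactorTwoThree μ ε) x := by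
  have hr := (hx.radius_pos hμ).ne'
  have ha0 := (hx.lapse_pos hμ).ne'
  have ha : ContinuousAt (fun z : Fin 5 → ℝ => lapse μ (z 3)) x :=
    HasFDerivAt.continuousAt (hasGrad_lapse hr)
  have hq : ContinuousAt (redQ μ ε) x := HasFDerivAt.continuousAt (hasGrad_redQ hr)
  unfold cofactorOneOne cofactorOneTwo cofactorOneThree cofactorTwoOne cofactorTwoTwo
    cofactorTwoThree
  refine ⟨⟨?_, ?_, ?_⟩, ?_, ?_, ?_⟩ <;> dsimp only <;> fun_prop (disch := positivity)

/-! ### Evolution of the Tulczyjew relations and of the integrals -/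

theorem IsRedMotion.hasDerivAt_comp {I : Set ℝ} {γ : ℝ → Fin 5 → ℝ} (hm : 0 < m) (hμ : 0 < μ)
    (h : IsRedMotion m μ ε I γ) {τ : ℝ} (hτ : τ ∈ I) {F : (Fin 5 → ℝ) → ℝ} {f : Fin 5 → ℝ}
    (hF : HasGrad F f (γ τ)) :
    HasDerivAt (fun t => F (γ t)) (bracket (γ τ) f (dHam m μ ε (γ τ))) τ := by
  have h1 := (h τ hτ).2
  rw [((h τ hτ).1.hasGrad_dHam hm hμ).grad_eq] at h1
  exact hF.hasDerivAt_comp h1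

/-- Along a motion (T₁, T₂) solves a homogeneous linear system, so it vanishes identically once it
vanishes at τ₀. -/
theorem tulczyjew_invariant {I : Set ℝ} {γ : ℝ → Fin 5 → ℝ} (hm : 0 < m) (hμ : 0 < μ)
    (hI : IsOpen I) (hc : IsPreconnected I) (h : IsRedMotion m μ ε I γ) {τ₀ τ : ℝ}
    (h₀ : τ₀ ∈ I) (hτ : τ ∈ I) (h1 : tulOne (γ τ₀) = 0) (h2 : tulTwo μ ε (γ τ₀) = 0) :
    tulOne (γ τ) = 0 ∧ tulTwo μ ε (γ τ) = 0 := by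
  have hcont : ∀ {k : (Fin 5 → ℝ) → ℝ}, (∀ t ∈ I, ContinuousAt k (γ t)) →
      ContinuousOn (fun t => k (γ t)) I := fun hk t ht =>
    ((hk t ht).comp (h t ht).2.continuousAt).continuousWithinAt
  have hcf := fun t (ht : t ∈ I) => (h t ht).1.continuousAt_cofactors hμ
  have hA := fun t (ht : t ∈ I) => (h t ht).1.continuousAt_evolution hm hμ
    (fun i => ((h t ht).1.continuousAt_rows hμ i).1) (hcf t ht).1.1 (hcf t ht).1.2.1
    (hcf t ht).1.2.2
  have hB := fun t (ht : t ∈ I) => (h t ht).1.continuousAt_evolution hm hμ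
    (fun i => ((h t ht).1.continuousAt_rows hμ i).2) (hcf t ht).2.1 (hcf t ht).2.2.1
    (hcf t ht).2.2.2
  refine linear_system_zero hI hc (u := fun t => tulOne (γ t)) (v := fun t => tulTwo μ ε (γ t))
    (hcont fun t ht => (hA t ht).1) (hcont fun t ht => (hA t ht).2)
    (hcont fun t ht => (hB t ht).1) (hcont fun t ht => (hB t ht).2)
    (fun t ht => ?_) (fun t ht => ?_) h₀ hτ h1 h2
  · have hx := (h t ht).1
    refine (h.hasDerivAt_comp hm hμ ht
      (hasGrad_tulOne (hx.radius_pos hμ).ne')).congr_deriv (hx.bracket_dHam hm hμ (f := dOne) ?_)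
    rw [bracket_self, mul_zero, add_zero]
    exact cofactorOne_identity hμ hx.1
  · have hx := (h t ht).1
    refine (h.hasDerivAt_comp hm hμ ht (hasGrad_tulTwo (hx.radius_pos hμ).ne')).congr_deriv
      (hx.bracket_dHam hm hμ (f := dTwo μ ε) ?_)
    rw [bracket_self, mul_zero, add_zero]
    exact cofactorTwo_identity hμ hx.1

theorem redCasimir_const {I : Set ℝ} {γ : ℝ → Fin 5 → ℝ} (hm : 0 < m) (hμ : 0 < μ)
    (hI : IsOpen I) (hc : IsPreconnected I) (h : IsRedMotion m μ ε I γ) {τ₀ τ : ℝ}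
    (h₀ : τ₀ ∈ I) (hτ : τ ∈ I) : redCasimir (γ τ) = redCasimir (γ τ₀) := by
  refine eq_of_hasDerivAt_zero hI hc (f := fun t => redCasimir (γ t)) (fun t ht => ?_) h₀ hτ
  refine (h.hasDerivAt_comp hm hμ ht (hasGrad_redCasimir _)).congr_deriv ?_
  rw [bracket_eq]
  simp
  ring

theorem hamiltonianZero_const {I : Set ℝ} {γ : ℝ → Fin 5 → ℝ} (hm : 0 < m) (hμ : 0 < μ)
    (hI : IsOpen I) (hc : IsPreconnected I) (h : IsRedMotion m μ ε I γ) {τ₀ τ : ℝ}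
    (h₀ : τ₀ ∈ I) (hτ : τ ∈ I) :
    hamiltonianZero m μ ε (γ τ) = hamiltonianZero m μ ε (γ τ₀) := by
  refine eq_of_hasDerivAt_zero hI hc (f := fun t => hamiltonianZero m μ ε (γ t))
    (fun t ht => ?_) h₀ hτ
  refine (h.hasDerivAt_comp hm hμ ht ((h t ht).1.hasGrad_dHam hm hμ)).congr_deriv ?_
  exact bracket_self _ _

end

/-! ### The Tulczyjew manifold -/

section

variable {m μ c ε ν : ℝ} {x : Fin 5 → ℝ}

/-- The e_θ component is zero, being odd under the reflection that fixes the section; the other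
three are multiples of T₁, T₂, T₃. -/
theorem frameTul_secFrame (hμ : 0 < μ) (hr : 2 * μ < x 3) :
    frameTul μ (secFrame ε x) =
      ![-(√(lapse μ (x 3)) * tulOne x), -(tulTwo μ ε x / √(lapse μ (x 3))), 0,
        tulThree μ ε x / √(lapse μ (x 3))] := by
  have hr0 : 0 < x 3 := by linarith
  have ha := lapse_pos hμ hr
  have hb := Real.sqrt_pos.2 ha
  have hsq := Real.sq_sqrt ha.le
  have hμ' : μ = x 3 * (1 - lapse μ (x 3)) / 2 := mu_eq_lapse hr0.ne'
  have h3 : tulTwo μ ε x = -(redQ μ ε x * x 0) + lapse μ (x 3) / x 3 * x 1 ^ 2 := tulTwo_eq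
  funext i
  fin_cases i <;> simp [frameTul, frameQ, secFrame, tulOne, h3, tulThree, redQ] <;>
    field_simp <;> (try simp only [hsq]) <;> ring

theorem tulczyjew_eq_zero_iff {s : State} (hμ : 0 < μ) (hc : 0 < c) (hs : Regular μ s)
    (h : OnZeroQLeaf c ε s) :
    tulczyjew μ s = 0 ↔ tulOne (redState s) = 0 ∧ tulTwo μ ε (redState s) = 0 := by
  have hx := h.redRegular hμ hc hs
  have ha : 0 < lapse μ (redState s 3) := hx.lapse_pos hμ
  have hr : 0 < redState s 3 := hx.radius_pos hμ
  have hsin := (hs.sin_pos).ne'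
  have hb := (Real.sqrt_pos.2 ha).ne'
  have hrot := h.rot_sq hc
  have h1 : tulczyjew μ s = 0 ↔ frameTul μ (enc s) = 0 := by
    simp only [funext_iff, Pi.zero_apply]
    refine forall_congr' fun α => ?_
    rw [tulczyjew_eq ha hr.ne' hsin α, mul_eq_zero, or_iff_right]
    exact tetrad_ne_zero ha hr.ne' hsin α
  rw [h1, h.enc_eq hc, frameTul_rot μ hrot, frameTul_secFrame hμ hx.1]
  have h3 := tulThree_eq (μ := μ) (ε := ε) hr.ne' hx.2.1.ne'
  constructor
  · intro h0
    have e0 := congrFun h0 0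
    have e1 := congrFun h0 1
    simp [hb] at e0 e1
    exact ⟨e0, e1⟩
  · rintro ⟨e0, e1⟩
    rw [h3, e0, e1]
    funext i
    fin_cases i <;> simp

theorem tulThree_eq_zero (hr : x 3 ≠ 0) (hx : x 1 ≠ 0) (h1 : tulOne x = 0)
    (h2 : tulTwo μ ε x = 0) : tulThree μ ε x = 0 := by
  rw [tulThree_eq hr hx, h1, h2]
  ring

theorem redQ_mul_of_tulTwo (hr : x 3 ≠ 0) (h2 : tulTwo μ ε x = 0) :
    redQ μ ε x * x 0 * x 3 = lapse μ (x 3) * x 1 ^ 2 := by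
  rw [tulTwo_eq] at h2
  field_simp at h2
  linear_combination -h2

theorem mul_of_tulOne (hr : x 3 ≠ 0) (h1 : tulOne x = 0) : x 0 * x 4 * x 3 = -(x 1 * x 2) := by
  rw [tulOne] at h1
  field_simp at h1
  linear_combination h1

/-- After multiplication by Z₁²r², the relations replace Z₁P_r r by -Z₂Z₃ and (μZ₁/r² - ε)Z₁r by
aZ₂². What is left contains the Casimir as a factor. -/
theorem massSq_mul (hμ : 0 < μ) (hr : 2 * μ < x 3) (hC : redCasimir x = c ^ 2)
    (h1 : tulOne x = 0) (h2 : tulTwo μ ε x = 0) :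
    x 0 ^ 2 * x 3 ^ 2 * massSq μ ε x = lapse μ (x 3) * x 1 ^ 2 * c ^ 2 := by
  have hr0 : x 3 ≠ 0 := by linarith
  have ha := (lapse_pos hμ hr).ne'
  have e1 := mul_of_tulOne hr0 h1
  have e2 := redQ_mul_of_tulTwo hr0 h2
  have h3 : x 0 ^ 2 * x 3 ^ 2 * massSq μ ε x =
      -(lapse μ (x 3) * (x 0 * x 4 * x 3) ^ 2) +
        (redQ μ ε x * x 0 * x 3) ^ 2 / lapse μ (x 3) - lapse μ (x 3) * x 0 ^ 2 * x 1 ^ 2 := by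
    rw [massSq_eq hμ hr]
    field_simp
  rw [h3, e1, e2, ← hC, redCasimir]
  field_simp
  ring

/-- At Z₁ = 0 the second relation would reduce to aZ₂²/r = 0. -/
theorem RedRegular.spin_ne_zero (hμ : 0 < μ) (hx : RedRegular μ ε x) (h2 : tulTwo μ ε x = 0) :
    x 0 ≠ 0 := by
  intro h0
  have e2 := redQ_mul_of_tulTwo (hx.radius_pos hμ).ne' h2
  have := mul_pos (hx.lapse_pos hμ) (pow_pos hx.2.1 2)
  rw [h0] at e2
  linarith

theorem OnTul.massSq_pos (hμ : 0 < μ) (hc : 0 < c) (h : OnTul μ c ε x) : 0 < massSq μ ε x := by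
  have h0 := h.1.spin_ne_zero hμ h.2.2.2
  have hr := h.1.radius_pos hμ
  have ha := h.1.lapse_pos hμ
  have hZ := h.1.2.1
  have h1 := massSq_mul hμ h.1.1 h.2.1 h.2.2.1 h.2.2.2
  have h2 : 0 < x 0 ^ 2 * x 3 ^ 2 * massSq μ ε x := by
    rw [h1]
    positivity
  exact (pos_iff_pos_of_mul_pos h2).1 (by positivity)

theorem OnTul.hamiltonianZero_eq (m : ℝ) (hμ : 0 < μ) (h : OnTul μ c ε x) :
    hamiltonianZero m μ ε x = -massSq μ ε x / (2 * m) := by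
  rw [hamiltonianZero_eq_funU m hμ h.1.1 h.1.2.1, funU, h.2.2.1, h.2.2.2,
    tulThree_eq_zero (h.1.radius_pos hμ).ne' h.1.2.1.ne' h.2.2.1 h.2.2.2]
  simp

theorem OnTul.level_iff (hm : 0 < m) (hμ : 0 < μ) (h : OnTul μ c ε x) :
    hamiltonianZero m μ ε x = -ν ^ 2 / (2 * m) ↔ massSq μ ε x = ν ^ 2 := by
  rw [h.hamiltonianZero_eq m hμ, div_left_inj' (by positivity), neg_inj]

theorem grad_redCasimir (x : Fin 5 → ℝ) :
    grad redCasimir x = ![-2 * x 0, 2 * x 1, -2 * x 2, 0, 0] := by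
  rw [(hasGrad_redCasimir x).grad_eq]

theorem OnTul.linearIndependent (hμ : 0 < μ) (h : OnTul μ c ε x)
    (hne : x 2 ≠ 0 ∨ 2 * x 3 ^ 2 - 15 * μ * x 3 + 24 * μ ^ 2 ≠ 0) :
    LinearIndependent ℝ ![grad redCasimir x, grad tulOne x, grad (tulTwo μ ε) x] := by
  have hr := (h.1.radius_pos hμ).ne'
  have ha := (h.1.lapse_pos hμ).ne'
  have hZ := h.1.2.1.ne'
  have h0 := h.1.spin_ne_zero hμ h.2.2.2
  rw [Fintype.linearIndependent_iff]
  intro g hg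
  rw [grad_redCasimir, (hasGrad_tulOne hr).grad_eq, (hasGrad_tulTwo hr).grad_eq] at hg
  have e0 := congrFun hg 0
  have e1 := congrFun hg 1
  have e2 := congrFun hg 2
  have e3 := congrFun hg 3
  have e4 := congrFun hg 4
  -- Among the three differentials only dT₁ has a P_r component, and it is Z₁ ≠ 0; so its
  -- coefficient is zero.
  simp [Fin.sum_univ_succ, dOne, dTwo, h0] at e0 e1 e2 e3 e4
  simp only [e4, zero_mul, zero_add, add_zero] at e0 e1 e2 e3
  have hg0 : g 0 * x 3 = -(g 2 * lapse μ (x 3)) := by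
    field_simp at e1
    refine mul_left_cancel₀ (mul_ne_zero two_ne_zero hZ) ?_
    linear_combination e1
  have hg2 : g 2 = 0 := by
    by_contra hne2
    have hg0' : g 0 ≠ 0 := by
      intro h00
      rw [h00, zero_mul, zero_eq_neg] at hg0
      exact mul_ne_zero hne2 ha hg0
    have hZ3 : x 2 = 0 := by
      refine (mul_eq_zero.1 (?_ : g 0 * x 2 = 0)).resolve_left hg0'
      linear_combination -e2 / 2
    have hquad := hne.resolve_left (not_not.2 hZ3)
    have f3 := (mul_eq_zero.1 ((by linear_combination e3) : g 2 * (2 * μ * x 0 ^ 2 / x 3 ^ 3 +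
      x 1 ^ 2 * (4 * μ / x 3 ^ 3 - (x 3 ^ 2)⁻¹)) = 0)).resolve_left hne2
    have f0 : 2 * lapse μ (x 3) * x 0 * x 3 + ε * x 3 ^ 2 - 2 * μ * x 0 = 0 := by
      refine mul_left_cancel₀ hne2 ?_
      field_simp at e0
      linear_combination e0 + 2 * x 0 * x 3 * hg0
    have f2 := h.2.2.2
    have hl : lapse μ (x 3) = (x 3 - 2 * μ) / x 3 := by rw [lapse]; field_simp
    rw [tulTwo, hl] at f2
    rw [hl] at f0
    field_simp at f0 f2 f3
    -- If the two remaining coefficients are nonzero, the components and T₂ = 0 give two homogeneous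
    -- linear equations for (Z₁², Z₂²). Their determinant is 2r² - 15μr + 24μ², the exceptional
    -- polynomial.
    have k1 : x 0 ^ 2 * (5 * μ - 2 * x 3) + (x 3 - 2 * μ) * x 1 ^ 2 = 0 := by
      linear_combination f2 - x 0 * f0
    have k2 : 2 * μ * x 0 ^ 2 + x 1 ^ 2 * (4 * μ - x 3) = 0 := by
      linear_combination f3
    refine mul_ne_zero (pow_ne_zero 2 h0) hquad ?_
    linear_combination (4 * μ - x 3) * k1 - (x 3 - 2 * μ) * k2
  have hg0' : g 0 = 0 := by
    rw [hg2, zero_mul, neg_zero] at hg0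
    exact (mul_eq_zero.1 hg0).resolve_right hr
  intro i
  fin_cases i
  · exact hg0'
  · exact e4
  · exact hg2

/-! ### The radius as parameter on the Tulczyjew manifold -/

/-- On a level of N the relation `massSq_mul` acquires the factor Z₁r on both sides. Cancelling it
leaves an equation linear in Z₁, which makes Z₁ a rational function of r. -/
theorem OnTul.redQ_mul (hμ : 0 < μ) (h : OnTul μ c ε x) (hN : massSq μ ε x = ν ^ 2) :
    redQ μ ε x * c ^ 2 = x 0 * x 3 * ν ^ 2 := by
  have h0 := h.1.spin_ne_zero hμ h.2.2.2
  have hr := (h.1.radius_pos hμ).ne'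
  have e1 := massSq_mul hμ h.1.1 h.2.1 h.2.2.1 h.2.2.2
  rw [hN, ← redQ_mul_of_tulTwo hr h.2.2.2] at e1
  refine mul_left_cancel₀ (mul_ne_zero h0 hr) ?_
  linear_combination -e1

theorem OnTul.mul_radDelta (hμ : 0 < μ) (h : OnTul μ c ε x) (hN : massSq μ ε x = ν ^ 2) :
    x 0 * radDelta μ c ν (x 3) = -(ε * c ^ 2 * x 3 ^ 2) := by
  have hr := (h.1.radius_pos hμ).ne'
  have e1 := h.redQ_mul hμ hN
  rw [redQ] at e1
  field_simp at e1
  rw [radDelta]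
  linear_combination -e1

theorem OnTul.mul_sq_radDelta (hμ : 0 < μ) (hc : 0 < c) (h : OnTul μ c ε x)
    (hN : massSq μ ε x = ν ^ 2) :
    (lapse μ (x 3) * x 4 * radDelta μ c ν (x 3)) ^ 2 = ν ^ 2 * radR μ c ε ν (x 3) := by
  have hr := (h.1.radius_pos hμ).ne'
  have ha := (h.1.lapse_pos hμ).ne'
  have e1 := h.redQ_mul hμ hN
  have e2 := massSq_mul hμ h.1.1 h.2.1 h.2.2.1 h.2.2.2
  have e3 := h.mul_radDelta hμ hN
  have e4 := massSq_eq (ε := ε) hμ h.1.1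
  rw [hN] at e2 e4
  have hc2 : c ^ 2 ≠ 0 := by positivity
  -- This is N = ν² solved for P_r², with `redQ` and Z₂ eliminated in favour of Z₁.
  have e5 : lapse μ (x 3) ^ 2 * x 4 ^ 2 * c ^ 4 = x 0 ^ 2 * x 3 ^ 2 * ν ^ 4 -
      lapse μ (x 3) * x 0 ^ 2 * ν ^ 2 * c ^ 2 - lapse μ (x 3) * ν ^ 2 * c ^ 4 := by
    field_simp at e4
    refine mul_left_cancel₀ (pow_ne_zero 2 hr) ?_
    linear_combination c ^ 4 * e4 + x 3 ^ 2 * (redQ μ ε x * c ^ 2 + x 0 * x 3 * ν ^ 2) * e1 +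
      lapse μ (x 3) * c ^ 2 * e2
  refine mul_right_cancel₀ (pow_ne_zero 2 hc2) ?_
  rw [radR]
  linear_combination radDelta μ c ν (x 3) ^ 2 * e5 +
    (x 0 * radDelta μ c ν (x 3) - ε * c ^ 2 * x 3 ^ 2) *
      (x 3 ^ 2 * ν ^ 4 - lapse μ (x 3) * ν ^ 2 * c ^ 2) * e3

theorem OnTul.mul_funV (hμ : 0 < μ) (h : OnTul μ c ε x) (hN : massSq μ ε x = ν ^ 2) :
    μ * funV μ ε x = radDelta μ c ν (x 3) - 3 * μ * x 0 ^ 2 := by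
  have hC := h.2.1
  rw [redCasimir] at hC
  rw [SpinningBody.mul_funV hμ, hN, radDelta]
  linear_combination -μ * hC

end

/-! ### The reduced flow on 𝒯 parametrized by the radius -/

section

variable {m μ c ε ν s : ℝ} {x : Fin 5 → ℝ}

/-- On the manifold only those terms of dU survive in which T₁ or T₂ is the differentiated factor.
-/
theorem OnTul.dHam_eq (hμ : 0 < μ) (h : OnTul μ c ε x) :
    dHam m μ ε x = (-1 / (2 * m)) • dMass μ ε x +
      (1 / (m * funV μ ε x)) • (coefOne μ x • dOne x + coefTwo μ ε x • dTwo μ ε x) := by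
  rw [dHam, dFunU, funU, h.2.2.1, h.2.2.2,
    tulThree_eq_zero (h.1.radius_pos hμ).ne' h.1.2.1.ne' h.2.2.1 h.2.2.2]
  simp

theorem OnTul.radDelta_ne_zero (hμ : 0 < μ) (hc : 0 < c) (hε : ε ≠ 0) (h : OnTul μ c ε x)
    (hN : massSq μ ε x = ν ^ 2) : radDelta μ c ν (x 3) ≠ 0 := by
  intro h0
  have e := h.mul_radDelta hμ hN
  rw [h0, mul_zero, zero_eq_neg] at e
  have hr := h.1.radius_pos hμ
  exact (mul_ne_zero (mul_ne_zero hε (by positivity)) (by positivity)) e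

theorem OnTul.eq_radZOne (hμ : 0 < μ) (hc : 0 < c) (hε : ε ≠ 0) (h : OnTul μ c ε x)
    (hN : massSq μ ε x = ν ^ 2) : x 0 = radZOne μ c ε ν (x 3) := by
  have hΔ := h.radDelta_ne_zero hμ hc hε hN
  rw [radZOne, ← h.mul_radDelta hμ hN, mul_div_cancel_right₀ _ hΔ]

theorem OnTul.radChi_eq (hμ : 0 < μ) (hc : 0 < c) (hε : ε ≠ 0) (h : OnTul μ c ε x)
    (hN : massSq μ ε x = ν ^ 2) : radChi μ c ε ν (x 3) = μ * funV μ ε x := by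
  rw [h.mul_funV hμ hN, radChi, ← h.eq_radZOne hμ hc hε hN]

theorem OnTul.eq_radZTwo (hμ : 0 < μ) (hc : 0 < c) (hν : 0 < ν) (hε : ε ≠ 0)
    (h : OnTul μ c ε x) (hN : massSq μ ε x = ν ^ 2) : x 1 = radZTwo μ c ε ν (x 3) := by
  have hΔ := h.radDelta_ne_zero hμ hc hε hN
  have hr := h.1.radius_pos hμ
  have ha := h.1.lapse_pos hμ
  have hb := Real.sqrt_pos.2 ha
  have e1 := h.mul_radDelta hμ hN
  have e2 := massSq_mul hμ h.1.1 h.2.1 h.2.2.1 h.2.2.2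
  rw [hN] at e2
  rw [radZTwo, eq_div_iff (mul_pos hb (abs_pos.2 hΔ)).ne']
  refine (sq_eq_sq₀ (mul_pos h.1.2.1 (mul_pos hb (abs_pos.2 hΔ))).le (by positivity)).1 ?_
  simp only [mul_pow, sq_abs, Real.sq_sqrt ha.le]
  have hc2 : c ^ 2 ≠ 0 := by positivity
  refine mul_right_cancel₀ hc2 ?_
  linear_combination -radDelta μ c ν (x 3) ^ 2 * e2 +
    x 3 ^ 2 * ν ^ 2 * (x 0 * radDelta μ c ν (x 3) - ε * c ^ 2 * x 3 ^ 2) * e1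

theorem OnTul.eq_radPoint (hμ : 0 < μ) (hc : 0 < c) (hν : 0 < ν) (hε : ε ≠ 0)
    (h : OnTul μ c ε x) (hN : massSq μ ε x = ν ^ 2)
    (hp : lapse μ (x 3) * x 4 * radDelta μ c ν (x 3) = s * ν * √(radR μ c ε ν (x 3))) :
    x = radPoint μ c ε ν s (x 3) := by
  have hΔ := h.radDelta_ne_zero hμ hc hε hN
  have hr := (h.1.radius_pos hμ).ne'
  have ha := (h.1.lapse_pos hμ).ne'
  have h4 : x 4 = radP μ c ε ν s (x 3) := by
    rw [radP, ← hp]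
    field_simp
  have h2 : x 2 = -(x 3 * x 0 * x 4) / x 1 := by
    rw [eq_div_iff h.1.2.1.ne']
    linear_combination mul_of_tulOne hr h.2.2.1
  rw [h.eq_radZOne hμ hc hε hN, h4, h.eq_radZTwo hμ hc hν hε hN] at h2
  funext i
  fin_cases i
  · exact h.eq_radZOne hμ hc hε hN
  · exact h.eq_radZTwo hμ hc hν hε hN
  · exact h2
  · rfl
  · exact h4

/-- The terms of ∂H₀/∂P_r combine to aP_r(μV₀ + 3μZ₁²)/(mμV₀), and the bracket equals Δ by
`OnTul.mul_funV`. -/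
theorem OnTul.dHam_four (hm : 0 < m) (hμ : 0 < μ) (h : OnTul μ c ε x)
    (hN : massSq μ ε x = ν ^ 2) :
    dHam m μ ε x 4 =
      lapse μ (x 3) * x 4 * radDelta μ c ν (x 3) / (m * (μ * funV μ ε x)) := by
  have hr := (h.1.radius_pos hμ).ne'
  have hV := h.1.2.2
  have e1 := mul_of_tulOne hr h.2.2.1
  have e2 : radDelta μ c ν (x 3) = μ * funV μ ε x + 3 * μ * x 0 ^ 2 := by
    rw [h.mul_funV hμ hN]
    ring
  rw [h.dHam_eq hμ, e2]
  simp [dMass, dOne, dTwo, coefOne]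
  field_simp
  linear_combination -x 0 * lapse μ (x 3) * e1

theorem IsRedMotion.hasDerivAt_radius {I : Set ℝ} {γ : ℝ → Fin 5 → ℝ} (hm : 0 < m) (hμ : 0 < μ)
    (h : IsRedMotion m μ ε I γ) {τ : ℝ} (hτ : τ ∈ I) (hx : OnTul μ c ε (γ τ))
    (hN : massSq μ ε (γ τ) = ν ^ 2) :
    HasDerivAt (fun t => γ t 3)
      (lapse μ (γ τ 3) * γ τ 4 * radDelta μ c ν (γ τ 3) / (m * (μ * funV μ ε (γ τ)))) τ := by
  refine (h.hasDerivAt_comp hm hμ hτ (HasGrad.coord 3)).congr_deriv ?_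
  rw [← hx.dHam_four hm hμ hN, bracket_eq]
  simp

theorem continuousOn_radR_comp {I : Set ℝ} {r : ℝ → ℝ} (hr : ContinuousOn r I)
    (h0 : ∀ τ ∈ I, r τ ≠ 0) :
    ContinuousOn (fun τ => radR μ c ε ν (r τ)) I ∧
      ContinuousOn (fun τ => radDelta μ c ν (r τ)) I ∧
      ContinuousOn (fun τ => lapse μ (r τ)) I := by
  have h1 : ContinuousOn (fun τ => lapse μ (r τ)) I := by
    unfold lapse
    fun_prop (disch := assumption)
  have h2 : ContinuousOn (fun τ => radDelta μ c ν (r τ)) I := by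
    unfold radDelta
    fun_prop
  refine ⟨?_, h2, h1⟩
  unfold radR
  fun_prop

theorem continuousOn_radChi_comp {I : Set ℝ} {r : ℝ → ℝ} (hr : ContinuousOn r I)
    (h0 : ∀ τ ∈ I, radDelta μ c ν (r τ) ≠ 0) :
    ContinuousOn (fun τ => radChi μ c ε ν (r τ)) I := by
  have h2 : ContinuousOn (fun τ => radDelta μ c ν (r τ)) I := by
    unfold radDelta
    fun_prop
  unfold radChi radZOne
  fun_prop (disch := assumption)

theorem quadrature_pointwise {I : Set ℝ} {γ : ℝ → Fin 5 → ℝ} (hm : 0 < m) (hμ : 0 < μ)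
    (hc : 0 < c) (hν : 0 < ν) (hε : ε ≠ 0) (h : IsRedMotion m μ ε I γ) {τ : ℝ} (hτ : τ ∈ I)
    (hx : OnTul μ c ε (γ τ)) (hN : massSq μ ε (γ τ) = ν ^ 2)
    (hp : lapse μ (γ τ 3) * γ τ 4 * radDelta μ c ν (γ τ 3) =
      s * ν * √(radR μ c ε ν (γ τ 3))) :
    γ τ = radPoint μ c ε ν s (γ τ 3) ∧
      HasDerivAt (fun t => γ t 3)
        (s * (ν / m) * √(radR μ c ε ν (γ τ 3)) / radChi μ c ε ν (γ τ 3)) τ := by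
  refine ⟨hx.eq_radPoint hμ hc hν hε hN hp,
    (h.hasDerivAt_radius hm hμ hτ hx hN).congr_deriv ?_⟩
  rw [hp, hx.radChi_eq hμ hc hε hN]
  field_simp

theorem quadrature_forward {I : Set ℝ} {γ : ℝ → Fin 5 → ℝ} (hm : 0 < m) (hμ : 0 < μ)
    (hc : 0 < c) (hν : 0 < ν) (hε : ε ≠ 0) (h : IsRedMotion m μ ε I γ) {τ : ℝ} (hτ : τ ∈ I)
    (hx : OnTul μ c ε (γ τ)) (hN : massSq μ ε (γ τ) = ν ^ 2) :
    radDelta μ c ν (γ τ 3) ≠ 0 ∧ radChi μ c ε ν (γ τ 3) ≠ 0 ∧ 0 ≤ radR μ c ε ν (γ τ 3) ∧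
      ∃ s : ℝ, (s = 1 ∨ s = -1) ∧ γ τ = radPoint μ c ε ν s (γ τ 3) ∧
        HasDerivAt (fun t => γ t 3)
          (s * (ν / m) * √(radR μ c ε ν (γ τ 3)) / radChi μ c ε ν (γ τ 3)) τ := by
  have hsq := hx.mul_sq_radDelta hμ hc hN
  have hR : 0 ≤ radR μ c ε ν (γ τ 3) := by
    refine le_of_mul_le_mul_left ?_ (pow_pos hν 2)
    rw [mul_zero, ← hsq]
    positivity
  refine ⟨hx.radDelta_ne_zero hμ hc hε hN, ?_, hR, ?_⟩
  · rw [hx.radChi_eq hμ hc hε hN]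
    exact mul_ne_zero hμ.ne' hx.1.2.2
  · have h1 : (lapse μ (γ τ 3) * γ τ 4 * radDelta μ c ν (γ τ 3)) ^ 2 =
        (ν * √(radR μ c ε ν (γ τ 3))) ^ 2 := by
      rw [hsq, mul_pow, Real.sq_sqrt hR]
    -- The relations fix only the square of P_r, so here the sign may depend on τ.
    rcases sq_eq_sq_iff_eq_or_eq_neg.1 h1 with h2 | h2
    · exact ⟨1, Or.inl rfl, quadrature_pointwise hm hμ hc hν hε h hτ hx hN (by rw [h2]; ring)⟩
    · exact ⟨-1, Or.inr rfl, quadrature_pointwise hm hμ hc hν hε h hτ hx hN (by rw [h2]; ring)⟩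

theorem quadrature_integral {I : Set ℝ} {γ : ℝ → Fin 5 → ℝ} (hm : 0 < m) (hμ : 0 < μ)
    (hc : 0 < c) (hν : 0 < ν) (hε : ε ≠ 0) (hI : IsPreconnected I)
    (h : IsRedMotion m μ ε I γ) (hx : ∀ τ ∈ I, OnTul μ c ε (γ τ) ∧ massSq μ ε (γ τ) = ν ^ 2)
    {τ₁ τ₂ : ℝ} (h₁ : τ₁ ∈ I) (h₂ : τ₂ ∈ I) (hlt : τ₁ < τ₂)
    (hR : ∀ τ ∈ Set.Icc τ₁ τ₂, 0 < radR μ c ε ν (γ τ 3)) :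
    ∃ s : ℝ, (s = 1 ∨ s = -1) ∧
      (∀ τ ∈ Set.Icc τ₁ τ₂, γ τ = radPoint μ c ε ν s (γ τ 3)) ∧
      τ₂ - τ₁ = ∫ ρ in (γ τ₁ 3)..(γ τ₂ 3),
        s * (m / ν) * radChi μ c ε ν ρ / √(radR μ c ε ν ρ) := by
  have hsub : Set.Icc τ₁ τ₂ ⊆ I := hI.Icc_subset h₁ h₂
  have hγ : ∀ i, ContinuousOn (fun t => γ t i) (Set.Icc τ₁ τ₂) := fun i t ht =>
    ((hasDerivAt_pi.1 (h t (hsub ht)).2 i).continuousAt).continuousWithinAt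
  have hr0 : ∀ t ∈ Set.Icc τ₁ τ₂, γ t 3 ≠ 0 := fun t ht =>
    ((h t (hsub ht)).1.radius_pos hμ).ne'
  obtain ⟨cR, cΔ, ca⟩ := continuousOn_radR_comp (μ := μ) (c := c) (ε := ε) (ν := ν) (hγ 3) hr0
  have hΔ : ∀ t ∈ Set.Icc τ₁ τ₂, radDelta μ c ν (γ t 3) ≠ 0 := fun t ht =>
    (hx t (hsub ht)).1.radDelta_ne_zero hμ hc hε (hx t (hsub ht)).2
  have hχ : ∀ t ∈ Set.Icc τ₁ τ₂, radChi μ c ε ν (γ t 3) ≠ 0 := fun t ht => by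
    rw [(hx t (hsub ht)).1.radChi_eq hμ hc hε (hx t (hsub ht)).2]
    exact mul_ne_zero hμ.ne' (h t (hsub ht)).1.2.2
  have cχ := continuousOn_radChi_comp (μ := μ) (c := c) (ε := ε) (ν := ν) (hγ 3) hΔ
  have csR := cR.sqrt
  have hsR : ∀ t ∈ Set.Icc τ₁ τ₂, √(radR μ c ε ν (γ t 3)) ≠ 0 := fun t ht =>
    (Real.sqrt_pos.2 (hR t ht)).ne'
  have hνR : ∀ t ∈ Set.Icc τ₁ τ₂, ν * √(radR μ c ε ν (γ t 3)) ≠ 0 := fun t ht =>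
    mul_ne_zero hν.ne' (hsR t ht)
  have h4 := hγ 4
  -- The sign is realized as a continuous quotient with values ±1, which needs R > 0. It is
  -- therefore constant on the whole interval.
  have cσ : ContinuousOn (fun t => lapse μ (γ t 3) * γ t 4 * radDelta μ c ν (γ t 3) /
      (ν * √(radR μ c ε ν (γ t 3)))) (Set.Icc τ₁ τ₂) := by
    fun_prop (disch := assumption)
  have hσ : ∀ t ∈ Set.Icc τ₁ τ₂, lapse μ (γ t 3) * γ t 4 * radDelta μ c ν (γ t 3) /
      (ν * √(radR μ c ε ν (γ t 3))) = 1 ∨ lapse μ (γ t 3) * γ t 4 * radDelta μ c ν (γ t 3) /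
      (ν * √(radR μ c ε ν (γ t 3))) = -1 := fun t ht => by
    rw [← sq_eq_one_iff, div_pow, (hx t (hsub ht)).1.mul_sq_radDelta hμ hc (hx t (hsub ht)).2,
      mul_pow, Real.sq_sqrt (hR t ht).le]
    exact div_self (mul_ne_zero (pow_ne_zero 2 hν.ne') (hR t ht).ne')
  have hm1 : τ₁ ∈ Set.Icc τ₁ τ₂ := Set.left_mem_Icc.2 hlt.le
  have hs := hσ τ₁ hm1
  have hconst := fun t ht => sign_const isPreconnected_Icc cσ hσ (τ := t) hm1 ht
  generalize lapse μ (γ τ₁ 3) * γ τ₁ 4 * radDelta μ c ν (γ τ₁ 3) /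
      (ν * √(radR μ c ε ν (γ τ₁ 3))) = s at hs hconst
  have hpt := fun t (ht : t ∈ Set.Icc τ₁ τ₂) =>
    quadrature_pointwise (s := s) hm hμ hc hν hε h (hsub ht) (hx t (hsub ht)).1
      (hx t (hsub ht)).2 (by rw [mul_assoc s]; exact (div_eq_iff (hνR t ht)).1 (hconst t ht))
  refine ⟨s, hs, fun t ht => (hpt t ht).1, ?_⟩
  have hss : s * s = 1 := by rcases hs with rfl | rfl <;> norm_num
  have cG : ContinuousOn (fun ρ => s * (m / ν) * radChi μ c ε ν ρ / √(radR μ c ε ν ρ))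
      ((fun t => γ t 3) '' Set.Icc τ₁ τ₂) := by
    have m3 : ∀ ρ ∈ (fun t => γ t 3) '' Set.Icc τ₁ τ₂, ρ ≠ 0 ∧ radDelta μ c ν ρ ≠ 0 ∧
        √(radR μ c ε ν ρ) ≠ 0 := by
      rintro ρ ⟨t, ht, rfl⟩
      exact ⟨hr0 t ht, hΔ t ht, hsR t ht⟩
    have k1 := (continuousOn_radR_comp (μ := μ) (c := c) (ε := ε) (ν := ν) continuousOn_id
      fun ρ hρ => (m3 ρ hρ).1).1.sqrt
    have k2 := continuousOn_radChi_comp (μ := μ) (c := c) (ε := ε) (ν := ν) continuousOn_id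
      fun ρ hρ => (m3 ρ hρ).2.1
    exact (continuousOn_const.mul k2).div k1 fun ρ hρ => (m3 ρ hρ).2.2
  rw [← Set.uIcc_of_le hlt.le] at hpt cG cχ csR hχ hsR
  -- Substituting ρ = r(τ) turns the integrand into 1, since the factors s, m/ν, χ, √R cancel
  -- against dr/dτ. Continuity of the integrand on the image of r suffices; monotonicity of r is not
  -- invoked.
  have hsubst := intervalIntegral.integral_comp_mul_deriv'' (a := τ₁) (b := τ₂)
    (f := fun t => γ t 3)
    (f' := fun t => s * (ν / m) * √(radR μ c ε ν (γ t 3)) / radChi μ c ε ν (γ t 3))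
    (g := fun ρ => s * (m / ν) * radChi μ c ε ν ρ / √(radR μ c ε ν ρ))
    (fun t ht => (hpt t ht).2.continuousAt.continuousWithinAt)
    (fun t ht => (hpt t (Set.Ioo_subset_Icc_self ht)).2.hasDerivWithinAt)
    ((continuousOn_const.mul csR).div cχ hχ) cG
  rw [← hsubst]
  have hone : ∀ t ∈ Set.uIcc τ₁ τ₂,
      ((fun ρ => s * (m / ν) * radChi μ c ε ν ρ / √(radR μ c ε ν ρ)) ∘ fun t => γ t 3) t *
        (s * (ν / m) * √(radR μ c ε ν (γ t 3)) / radChi μ c ε ν (γ t 3)) = 1 := by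
    intro t ht
    have k1 := hχ t ht
    have k2 := hsR t ht
    simp only [Function.comp_apply]
    field_simp
    linear_combination hss
  rw [intervalIntegral.integral_congr hone]
  simp

end

/-! ### From the radius back to solutions -/

section

variable {m μ c ε ν s : ℝ} {x : Fin 5 → ℝ}

theorem onTul_radPoint {r : ℝ} (hμ : 0 < μ) (hc : 0 < c) (hν : 0 < ν) (hε : ε ≠ 0)
    (hs : s = 1 ∨ s = -1) (hr : 2 * μ < r) (hΔ : radDelta μ c ν r ≠ 0)
    (hχ : radChi μ c ε ν r ≠ 0) (hR : 0 < radR μ c ε ν r) :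
    OnTul μ c ε (radPoint μ c ε ν s r) ∧ massSq μ ε (radPoint μ c ε ν s r) = ν ^ 2 ∧
      radPoint μ c ε ν s r 4 ≠ 0 := by
  have hr0 : 0 < r := by linarith
  have ha := lapse_pos hμ hr
  have hb := Real.sqrt_pos.2 ha
  have hs2 : s ^ 2 = 1 := by rcases hs with rfl | rfl <;> norm_num
  -- The point is made opaque: the algebra needs only the polynomial relations `e0`, `e1`, `e2`,
  -- `e4`, which are free of roots and absolute values.
  obtain ⟨x, hx⟩ : ∃ x, x = radPoint μ c ε ν s r := ⟨_, rfl⟩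
  have x3 : x 3 = r := by rw [hx]; rfl
  have e0 : x 0 * radDelta μ c ν r = -(ε * c ^ 2 * r ^ 2) := by
    have : x 0 = radZOne μ c ε ν r := by rw [hx]; rfl
    rw [this, radZOne, div_mul_cancel₀ _ hΔ]
  have p1 : 0 < x 1 := by
    have : x 1 = radZTwo μ c ε ν r := by rw [hx]; rfl
    rw [this, radZTwo]
    have := abs_pos.2 hε
    have := abs_pos.2 hΔ
    positivity
  have e1 : lapse μ r * x 1 ^ 2 * radDelta μ c ν r ^ 2 = ε ^ 2 * c ^ 2 * ν ^ 2 * r ^ 6 := by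
    have : x 1 = radZTwo μ c ε ν r := by rw [hx]; rfl
    rw [this, radZTwo, div_pow, mul_pow (√(lapse μ r)), Real.sq_sqrt ha.le, sq_abs]
    field_simp
    rw [sq_abs]
  have e4 : (lapse μ r * x 4 * radDelta μ c ν r) ^ 2 = ν ^ 2 * radR μ c ε ν r := by
    have : x 4 = radP μ c ε ν s r := by rw [hx]; rfl
    rw [this, radP, mul_assoc, mul_comm (_ / _), ← mul_assoc, mul_div_cancel₀ _
      (mul_ne_zero ha.ne' hΔ), mul_pow, mul_pow, hs2, Real.sq_sqrt hR.le, one_mul]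
  have p4 : x 4 ≠ 0 := by
    intro h0
    rw [h0, mul_zero, zero_mul] at e4
    have := mul_pos (pow_pos hν 2) hR
    norm_num at e4
    rcases e4 with e4 | e4
    · exact hν.ne' e4
    · exact hR.ne' e4
  have e2 : x 2 * x 1 = -(r * x 0 * x 4) := by
    have : x 2 = -(r * x 0 * x 4) / x 1 := by rw [hx]; rfl
    rw [this, div_mul_cancel₀ _ p1.ne']
  rw [← hx]
  have q0 : x 0 ^ 2 * r ^ 2 * ν ^ 2 = lapse μ r * x 1 ^ 2 * c ^ 2 := by
    refine mul_right_cancel₀ (pow_ne_zero 2 hΔ) ?_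
    linear_combination r ^ 2 * ν ^ 2 * (x 0 * radDelta μ c ν r - ε * c ^ 2 * r ^ 2) * e0 -
      c ^ 2 * e1
  have p0 : x 0 ≠ 0 := by
    intro h0
    rw [h0, zero_mul, zero_eq_neg] at e0
    exact mul_ne_zero (mul_ne_zero hε (by positivity)) (by positivity) e0
  have t1 : tulOne x = 0 := by
    rw [tulOne, x3]
    field_simp
    linear_combination e2
  have t2 : tulTwo μ ε x = 0 := by
    rw [tulTwo, x3]
    have k : radDelta μ c ν r = ν ^ 2 * r ^ 3 - μ * c ^ 2 := rfl
    field_simp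
    refine mul_right_cancel₀ (pow_ne_zero 2 hΔ) ?_
    linear_combination (ε * r ^ 2 * radDelta μ c ν r -
      μ * (x 0 * radDelta μ c ν r - ε * c ^ 2 * r ^ 2)) * e0 + r * e1 -
      ε ^ 2 * c ^ 2 * r ^ 4 * k
  have q2 : x 2 ^ 2 * ν ^ 2 = lapse μ r * c ^ 2 * x 4 ^ 2 := by
    refine mul_left_cancel₀ (pow_ne_zero 2 p1.ne') ?_
    linear_combination ν ^ 2 * (x 2 * x 1 - r * x 0 * x 4) * e2 + x 4 ^ 2 * q0
  have hC : redCasimir x = c ^ 2 := by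
    rw [redCasimir]
    refine mul_left_cancel₀ (mul_ne_zero ha.ne' (pow_ne_zero 2 (mul_ne_zero hΔ hν.ne'))) ?_
    rw [radR] at e4
    linear_combination -radDelta μ c ν r ^ 2 * lapse μ r * q2 - c ^ 2 * e4 + ν ^ 2 * e1 -
      lapse μ r * ν ^ 2 * (x 0 * radDelta μ c ν r - ε * c ^ 2 * r ^ 2) * e0
  have hN : massSq μ ε x = ν ^ 2 := by
    have k := massSq_mul hμ (by rw [x3]; exact hr) hC t1 t2
    rw [x3, ← q0] at k
    exact mul_left_cancel₀ (mul_ne_zero (pow_ne_zero 2 p0) (pow_ne_zero 2 hr0.ne')) k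
  have hV : μ * funV μ ε x = radChi μ c ε ν r := by
    have k : x 0 = radZOne μ c ε ν r := by rw [hx]; rfl
    rw [mul_funV hμ, hN, x3, radChi, ← k, radDelta]
    rw [redCasimir] at hC
    linear_combination -μ * hC
  refine ⟨⟨⟨by rw [x3]; exact hr, p1, fun h0 => hχ ?_⟩, hC, t1, t2⟩, hN, p4⟩
  rw [← hV, h0, mul_zero]

theorem differentiableAt_radPoint {r : ℝ} (hμ : 0 < μ) (hc : 0 < c) (hν : 0 < ν) (hε : ε ≠ 0)
    (hr : 2 * μ < r) (hΔ : radDelta μ c ν r ≠ 0) (hR : 0 < radR μ c ε ν r) :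
    DifferentiableAt ℝ (radPoint μ c ε ν s) r := by
  have hr0 : r ≠ 0 := by linarith
  have ha := lapse_pos hμ hr
  have ha0 := ha.ne'
  have hR0 := hR.ne'
  have dΔ : DifferentiableAt ℝ (radDelta μ c ν) r := by
    unfold radDelta
    fun_prop
  have dl : DifferentiableAt ℝ (lapse μ) r := by
    unfold lapse
    fun_prop (disch := assumption)
  have d1 : DifferentiableAt ℝ (radZOne μ c ε ν) r := by
    unfold radZOne
    fun_prop (disch := assumption)
  have hb := (mul_pos (Real.sqrt_pos.2 ha) (abs_pos.2 hΔ)).ne'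
  have d2 : DifferentiableAt ℝ (radZTwo μ c ε ν) r := by
    unfold radZTwo
    exact (by fun_prop : DifferentiableAt ℝ (fun r => |ε| * c * ν * r ^ 3) r).fun_div
      ((dl.sqrt ha0).mul (dΔ.abs hΔ)) hb
  have dR : DifferentiableAt ℝ (radR μ c ε ν) r := by
    unfold radR
    fun_prop
  have haΔ := mul_ne_zero ha0 hΔ
  have dP : DifferentiableAt ℝ (radP μ c ε ν s) r := by
    unfold radP
    exact ((dR.sqrt hR0).const_mul (s * ν)).fun_div (dl.mul dΔ) haΔ
  have h2 : radZTwo μ c ε ν r ≠ 0 :=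
    div_ne_zero (mul_ne_zero (mul_ne_zero (mul_ne_zero (abs_pos.2 hε).ne' hc.ne') hν.ne')
      (pow_ne_zero 3 hr0)) hb
  refine differentiableAt_pi.2 fun i => ?_
  fin_cases i
  · exact d1
  · exact d2
  · exact (((differentiableAt_id.mul d1).mul dP).neg).div d2 h2
  · exact differentiableAt_id
  · exact dP

/-- On a level of the mass on the Tulczyjew manifold a tangent vector is determined by its
radial component. -/
theorem OnTul.tangent_eq_zero {w : Fin 5 → ℝ} (hμ : 0 < μ) (hc : 0 < c) (hε : ε ≠ 0)
    (h : OnTul μ c ε x) (hN : massSq μ ε x = ν ^ 2) (h4 : x 4 ≠ 0)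
    (hC : ![-2 * x 0, 2 * x 1, -2 * x 2, 0, 0] ⬝ᵥ w = 0) (h1 : dOne x ⬝ᵥ w = 0)
    (h2 : dTwo μ ε x ⬝ᵥ w = 0) (hM : dMass μ ε x ⬝ᵥ w = 0) (h3 : w 3 = 0) : w = 0 := by
  have hr := (h.1.radius_pos hμ).ne'
  have ha := (h.1.lapse_pos hμ).ne'
  have hZ := h.1.2.1.ne'
  have h0 := h.1.spin_ne_zero hμ h.2.2.2
  have hΔ := h.radDelta_ne_zero hμ hc hε hN
  have t1 := mul_of_tulOne hr h.2.2.1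
  have t2 := redQ_mul_of_tulTwo hr h.2.2.2
  have hC' := h.2.1
  rw [redCasimir] at hC'
  have hq := h.redQ_mul hμ hN
  have hε' : ε - 2 * μ * x 0 / x 3 ^ 2 = -(redQ μ ε x + μ * x 0 / x 3 ^ 2) := by
    rw [redQ]; ring
  simp [dotProduct, Fin.sum_univ_succ, h3, dOne, dTwo, dMass, hε'] at hC h1 h2 hM
  field_simp at h1 h2 hM
  generalize lapse μ (x 3) = a at *
  generalize redQ μ ε x = q at *
  -- Eliminates w₂ and w₄ from dN(w) = 0 by means of dT₁(w) = 0 and dC_∘(w) = 0; next, dT₂(w) = 0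
  -- removes w₁.
  have hA : μ * q * x 0 ^ 3 * w 0 - a ^ 2 * x 0 ^ 3 * x 1 * w 1 +
      a ^ 2 * x 1 ^ 2 * x 2 ^ 2 * w 0 - a ^ 2 * x 0 * x 1 * x 2 ^ 2 * w 1 -
      a ^ 2 * x 0 * x 1 ^ 2 * (-(x 0 * w 0) + x 1 * w 1) = 0 := by
    linear_combination x 0 ^ 3 / 2 * hM + a ^ 2 * x 0 ^ 2 * x 4 * x 3 * h1 -
      a ^ 2 * ((x 0 * x 4 * x 3 - x 1 * x 2) * w 0 + x 0 * x 2 * w 1 + x 0 * x 1 * w 2) * t1 -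
      a ^ 2 * x 0 * x 1 ^ 2 / 2 * hC
  have hB : (2 * x 3 * (μ * q * x 0 ^ 3 + a ^ 2 * x 1 ^ 2 * x 2 ^ 2 + a ^ 2 * x 0 ^ 2 * x 1 ^ 2) -
      a * x 0 * (x 0 ^ 2 + x 1 ^ 2 + x 2 ^ 2) * (μ * x 0 + x 3 ^ 2 * q)) * w 0 = 0 := by
    linear_combination 2 * x 3 * hA + a * x 0 * (x 0 ^ 2 + x 1 ^ 2 + x 2 ^ 2) * h2
  -- On 𝒯 the coefficient of w₀ collapses to -aZ₁²Δ, which is nonzero. The remaining components then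
  -- vanish one after another; w₄ needs P_r ≠ 0.
  have hK : 2 * x 3 * (μ * q * x 0 ^ 3 + a ^ 2 * x 1 ^ 2 * x 2 ^ 2 + a ^ 2 * x 0 ^ 2 * x 1 ^ 2) -
      a * x 0 * (x 0 ^ 2 + x 1 ^ 2 + x 2 ^ 2) * (μ * x 0 + x 3 ^ 2 * q) =
      -(a * x 0 ^ 2 * radDelta μ c ν (x 3)) := by
    rw [radDelta]
    linear_combination -(2 * x 3 * a ^ 2 * x 1 ^ 2 - a * x 0 * (μ * x 0 + x 3 ^ 2 * q)) * hC' -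
      (2 * x 3 * (a * x 1 ^ 2 + q * x 0 * x 3) - 2 * x 3 * a * c ^ 2 -
        2 * x 0 * (μ * x 0 + x 3 ^ 2 * q)) * t2 - a * x 3 ^ 2 * x 0 * hq
  have w0 : w 0 = 0 := by
    rw [hK] at hB
    exact (mul_eq_zero.1 hB).resolve_left
      (neg_ne_zero.2 (mul_ne_zero (mul_ne_zero ha (pow_ne_zero 2 h0)) hΔ))
  have w1 : w 1 = 0 := by
    simpa [w0, hr, hZ, ha] using h2
  have w4 : w 4 = 0 := by
    simpa [w0, w1, hr, h4, ha] using hM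
  have w2 : w 2 = 0 := by
    simpa [w0, w1, w4, hr, hZ] using h1
  funext i
  fin_cases i
  · exact w0
  · exact w1
  · exact w2
  · exact h3
  · exact w4

end

section

variable {m μ c ε ν s : ℝ} {x : Fin 5 → ℝ}

theorem OnTul.bracket_dOne (hm : 0 < m) (hμ : 0 < μ) (h : OnTul μ c ε x) :
    bracket x (dOne x) (dHam m μ ε x) = 0 := by
  have k := h.1.bracket_dHam hm hμ (f := dOne) (k₁ := cofactorOneOne μ ε)
    (k₂ := cofactorOneTwo μ ε) (k₃ := cofactorOneThree μ ε)
    (by rw [bracket_self, mul_zero, add_zero]; exact cofactorOne_identity hμ h.1.1)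
  rw [k, h.2.2.1, h.2.2.2]
  ring

theorem OnTul.bracket_dTwo (hm : 0 < m) (hμ : 0 < μ) (h : OnTul μ c ε x) :
    bracket x (dTwo μ ε x) (dHam m μ ε x) = 0 := by
  have k := h.1.bracket_dHam hm hμ (f := dTwo μ ε) (k₁ := cofactorTwoOne μ ε)
    (k₂ := cofactorTwoTwo μ ε) (k₃ := cofactorTwoThree μ ε)
    (by rw [bracket_self, mul_zero, add_zero]; exact cofactorTwo_identity hμ h.1.1)
  rw [k, h.2.2.1, h.2.2.2]
  ring

/-- On 𝒯, dH₀ is -dN/(2m) plus a combination of dT₁ and dT₂. Since {H₀, H₀} = 0 and {T_i, H₀} = 0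
there, {N, H₀} = 0 follows. -/
theorem OnTul.bracket_dMass (hm : 0 < m) (hμ : 0 < μ) (h : OnTul μ c ε x) :
    bracket x (dMass μ ε x) (dHam m μ ε x) = 0 := by
  have h1 := h.bracket_dOne hm hμ
  have h2 := h.bracket_dTwo hm hμ
  have h3 := bracket_self x (dHam m μ ε x)
  have h4 : ∀ D, bracket x (dHam m μ ε x) D = -1 / (2 * m) * bracket x (dMass μ ε x) D +
      1 / (m * funV μ ε x) * (coefOne μ x * bracket x (dOne x) D +
        coefTwo μ ε x * bracket x (dTwo μ ε x) D) := fun D => by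
    rw [h.dHam_eq hμ]
    simp only [bracket, add_dotProduct, smul_dotProduct, smul_eq_mul]
  rw [h4, h1, h2, mul_zero, mul_zero, add_zero, mul_zero, add_zero] at h3
  exact (mul_eq_zero.1 h3).resolve_left (div_ne_zero (by norm_num) (by positivity))

theorem bracket_redCasimir (x g : Fin 5 → ℝ) :
    bracket x ![-2 * x 0, 2 * x 1, -2 * x 2, 0, 0] g = 0 := by
  rw [bracket_eq]
  simp
  ring

theorem HasGrad.dotProduct_eq_zero {n : ℕ} {F : (Fin n → ℝ) → ℝ} {f v : Fin n → ℝ}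
    {γ : ℝ → Fin n → ℝ} {τ k : ℝ} (hF : HasGrad F f (γ τ)) (hγ : HasDerivAt γ v τ)
    (h : ∀ᶠ t in nhds τ, F (γ t) = k) : f ⬝ᵥ v = 0 :=
  (hF.hasDerivAt_comp hγ).unique ((hasDerivAt_const τ k).congr_of_eventuallyEq h)

/-- The curve stays on the common level set of C_∘, T₁, T₂, N, and the Hamiltonian field is tangent
to it. As a tangent vector is determined by its radial component, comparing dr/dτ suffices. -/
theorem quadrature_converse {I : Set ℝ} {r : ℝ → ℝ} (hm : 0 < m) (hμ : 0 < μ) (hc : 0 < c)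
    (hν : 0 < ν) (hε : ε ≠ 0) (hs : s = 1 ∨ s = -1) (hI : IsOpen I)
    (h : ∀ τ ∈ I, 2 * μ < r τ ∧ radDelta μ c ν (r τ) ≠ 0 ∧ radChi μ c ε ν (r τ) ≠ 0 ∧
      0 < radR μ c ε ν (r τ) ∧
      HasDerivAt r (s * (ν / m) * √(radR μ c ε ν (r τ)) / radChi μ c ε ν (r τ)) τ) :
    IsRedMotion m μ ε I (fun τ => radPoint μ c ε ν s (r τ)) := by
  have hT := fun τ (hτ : τ ∈ I) => onTul_radPoint hμ hc hν hε hs (h τ hτ).1 (h τ hτ).2.1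
    (h τ hτ).2.2.1 (h τ hτ).2.2.2.1
  intro τ hτ
  obtain ⟨hr, hΔ, hχ, hR, hd⟩ := h τ hτ
  obtain ⟨hx, hN, h4⟩ := hT τ hτ
  refine ⟨hx.1, ?_⟩
  rw [(hx.1.hasGrad_dHam hm hμ).grad_eq]
  have hv := ((differentiableAt_radPoint (s := s) hμ hc hν hε hr hΔ hR).hasDerivAt).scomp τ hd
  have hr0 := (hx.1.radius_pos hμ).ne'
  have hev : ∀ᶠ t in nhds τ, t ∈ I := hI.mem_nhds hτ
  have e3 := (hasDerivAt_pi.1 hv 3).unique hd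
  obtain ⟨v, hv'⟩ : ∃ v, v = (s * (ν / m) * √(radR μ c ε ν (r τ)) / radChi μ c ε ν (r τ)) •
    deriv (radPoint μ c ε ν s) (r τ) := ⟨_, rfl⟩
  rw [← hv'] at hv e3
  have dC := (hasGrad_redCasimir (radPoint μ c ε ν s (r τ))).dotProduct_eq_zero
    (γ := radPoint μ c ε ν s ∘ r) hv (k := c ^ 2)
    (hev.mono fun t ht => (hT t ht).1.2.1)
  have d1 := (hasGrad_tulOne hr0).dotProduct_eq_zero (γ := radPoint μ c ε ν s ∘ r) hv (k := 0)
    (hev.mono fun t ht => (hT t ht).1.2.2.1)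
  have d2 := (hasGrad_tulTwo (μ := μ) (ε := ε) hr0).dotProduct_eq_zero
    (γ := radPoint μ c ε ν s ∘ r) hv (k := 0) (hev.mono fun t ht => (hT t ht).1.2.2.2)
  have dM := (hasGrad_massSq (ε := ε) hμ hx.1.1).dotProduct_eq_zero
    (γ := radPoint μ c ε ν s ∘ r) hv (k := ν ^ 2) (hev.mono fun t ht => (hT t ht).2.1)
  have hp : lapse μ (r τ) * radP μ c ε ν s (r τ) * radDelta μ c ν (r τ) =
      s * ν * √(radR μ c ε ν (r τ)) := by
    have ha := (lapse_pos hμ hr).ne'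
    rw [radP]
    field_simp
  have hu3 : (poissonMatrix (radPoint μ c ε ν s (r τ)) *ᵥ
      dHam m μ ε (radPoint μ c ε ν s (r τ))) 3 = v 3 := by
    rw [poissonMatrix_mulVec, e3]
    refine (hx.dHam_four hm hμ hN).trans ?_
    rw [← hx.radChi_eq hμ hc hε hN]
    refine (congrArg (· / (m * radChi μ c ε ν (r τ))) hp).trans ?_
    field_simp
  have hw := hx.tangent_eq_zero (w := poissonMatrix (radPoint μ c ε ν s (r τ)) *ᵥ
      dHam m μ ε (radPoint μ c ε ν s (r τ)) - v) hμ hc hε hN h4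
    (by rw [dotProduct_sub, dC, sub_zero]; exact bracket_redCasimir _ _)
    (by rw [dotProduct_sub, d1, sub_zero]; exact hx.bracket_dOne hm hμ)
    (by rw [dotProduct_sub, d2, sub_zero]; exact hx.bracket_dTwo hm hμ)
    (by rw [dotProduct_sub, dM, sub_zero]; exact hx.bracket_dMass hm hμ)
    (by rw [Pi.sub_apply, hu3, sub_self])
  rw [sub_eq_zero.1 hw]
  exact hv

/-! ### Motions of energy zero -/

/-- For ε = 0 the radial relation reads Z₁Δ = 0 with Z₁ ≠ 0, hence Δ = 0. The other two equalities
are T₂ = 0 and its combination with the Casimir. -/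
theorem OnTul.zero_energy (hμ : 0 < μ) (h : OnTul μ c 0 x) (hN : massSq μ 0 x = ν ^ 2) :
    ν ^ 2 * x 3 ^ 3 = μ * c ^ 2 ∧ μ * x 0 ^ 2 = (x 3 - 2 * μ) * x 1 ^ 2 ∧
      (3 * μ - x 3) * x 1 ^ 2 = μ * (x 2 ^ 2 + c ^ 2) := by
  have hr := (h.1.radius_pos hμ).ne'
  have h0 := h.1.spin_ne_zero hμ h.2.2.2
  have e1 := h.mul_radDelta hμ hN
  have e2 : μ * x 0 ^ 2 = (x 3 - 2 * μ) * x 1 ^ 2 := by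
    have h2 := h.2.2.2
    rw [tulTwo, lapse] at h2
    field_simp at h2
    linear_combination -h2
  refine ⟨?_, e2, ?_⟩
  · rw [zero_mul, zero_mul, neg_zero] at e1
    exact sub_eq_zero.1 ((mul_eq_zero.1 e1).resolve_left h0)
  · have h3 := h.2.1
    rw [redCasimir] at h3
    linear_combination μ * h3 + e2

theorem OnTul.bracket_three_zero_energy (hm : 0 < m) (hμ : 0 < μ) (h : OnTul μ c 0 x)
    (hN : massSq μ 0 x = ν ^ 2) :
    bracket x (Pi.single 2 1) (dHam m μ 0 x) =
      -(c ^ 2 * (3 * μ - x 3) * x 1 / (m * x 3 ^ 3 * x 0)) := by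
  have hr := (h.1.radius_pos hμ).ne'
  have ha := (h.1.lapse_pos hμ).ne'
  have hZ := h.1.2.1.ne'
  have h0 := h.1.spin_ne_zero hμ h.2.2.2
  obtain ⟨e1, e2, e3⟩ := h.zero_energy hμ hN
  have hV : funV μ 0 x = -(3 * x 0 ^ 2) := by
    refine mul_left_cancel₀ hμ.ne' ?_
    rw [h.mul_funV hμ hN, radDelta, e1]
    ring
  have hp : x 4 = -(x 1 * x 2) / (x 3 * x 0) := by
    rw [eq_div_iff (mul_ne_zero hr h0), ← mul_of_tulOne hr h.2.2.1]
    ring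
  -- With k = Z₁/Z₂ the relations become r = μ(2 + k²), c² = Z₂²(1 - k²) - Z₃² and a = k²/(2 + k²),
  -- so everything is rational in k, μ, Z₂, Z₃.
  obtain ⟨k, hk⟩ : ∃ k, x 0 = k * x 1 := ⟨x 0 / x 1, by field_simp⟩
  have hr' : x 3 = μ * (2 + k ^ 2) := by
    refine mul_right_cancel₀ (pow_ne_zero 2 hZ) ?_
    rw [hk] at e2
    linear_combination -e2
  have hc' : c ^ 2 = x 1 ^ 2 * (1 - k ^ 2) - x 2 ^ 2 := by
    refine mul_left_cancel₀ hμ.ne' ?_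
    rw [hr'] at e3
    linear_combination -e3
  have hk0 : k ≠ 0 := by rintro rfl; simp [hk] at h0
  have h2k : 2 + k ^ 2 ≠ 0 := by positivity
  have hl : lapse μ (μ * (2 + k ^ 2)) = k ^ 2 / (2 + k ^ 2) := by
    rw [lapse]
    field_simp
    ring
  rw [bracket_eq, h.dHam_eq hμ, hV]
  simp [dMass, dOne, dTwo, coefOne, coefTwo, redQ]
  rw [hp, hk, hc', hr', hl]
  field_simp
  ring

end

theorem zero_energy_motion {m μ c ν : ℝ} {I : Set ℝ} {γ : ℝ → Fin 5 → ℝ} (hm : 0 < m)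
    (hμ : 0 < μ) (hc : 0 < c) (hν : 0 < ν) (hconn : IsPreconnected I)
    (h : IsRedMotion m μ 0 I γ)
    (hx : ∀ τ ∈ I, OnTul μ c 0 (γ τ) ∧ massSq μ 0 (γ τ) = ν ^ 2) {τ₀ : ℝ} (h₀ : τ₀ ∈ I) :
    ∃ s r : ℝ, (s = 1 ∨ s = -1) ∧ 2 * μ < r ∧ r < 3 * μ ∧ ν ^ 2 * r ^ 3 = μ * c ^ 2 ∧
      ∀ τ ∈ I, γ τ 3 = r ∧
        γ τ 2 = γ τ₀ 2 - s * c ^ 2 * √μ * (3 * μ - r) / (m * r ^ 3 * √(r - 2 * μ)) *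
          (τ - τ₀) ∧
        γ τ 1 = √(μ * (γ τ 2 ^ 2 + c ^ 2) / (3 * μ - r)) ∧
        γ τ 0 = s * √((r - 2 * μ) / μ) * γ τ 1 ∧
        γ τ 4 = -(γ τ 1 * γ τ 2) / (r * γ τ 0) := by
  have hz := fun τ (hτ : τ ∈ I) => (hx τ hτ).1.zero_energy hμ (hx τ hτ).2
  have hpos := fun τ (hτ : τ ∈ I) => (h τ hτ).1.radius_pos hμ
  have hr : ∀ τ ∈ I, γ τ 3 = γ τ₀ 3 := fun τ hτ => by
    refine (pow_left_inj₀ (hpos τ hτ).le (hpos τ₀ h₀).le three_ne_zero).1 ?_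
    refine mul_left_cancel₀ (pow_ne_zero 2 hν.ne') ?_
    rw [(hz τ hτ).1, (hz τ₀ h₀).1]
  have hr2 := (h τ₀ h₀).1.1
  have hν3 := (hz τ₀ h₀).1
  have hr3 : γ τ₀ 3 < 3 * μ := by
    have h1 : 0 < (3 * μ - γ τ₀ 3) * γ τ₀ 1 ^ 2 := by
      rw [(hz τ₀ h₀).2.2]
      positivity
    linarith [(pos_iff_pos_of_mul_pos h1).2 (pow_pos (h τ₀ h₀).1.2.1 2)]
  have hr0 := hpos τ₀ h₀
  generalize γ τ₀ 3 = r at hr hr2 hν3 hr3 hr0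
  have hk2 : 0 < (r - 2 * μ) / μ := div_pos (by linarith) hμ
  have hk := Real.sqrt_pos.2 hk2
  have hsq := Real.sq_sqrt hk2.le
  have hkZ : ∀ τ ∈ I, √((r - 2 * μ) / μ) * γ τ 1 ≠ 0 := fun τ hτ =>
    mul_ne_zero hk.ne' (h τ hτ).1.2.1.ne'
  have hγ : ∀ i, ContinuousOn (fun t => γ t i) I := fun i t ht =>
    ((hasDerivAt_pi.1 (h t ht).2 i).continuousAt).continuousWithinAt
  have hσ : ∀ τ ∈ I, γ τ 0 / (√((r - 2 * μ) / μ) * γ τ 1) = 1 ∨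
      γ τ 0 / (√((r - 2 * μ) / μ) * γ τ 1) = -1 := fun τ hτ => by
    have h1 := (hz τ hτ).2.1
    have h2 := (h τ hτ).1.2.1.ne'
    rw [hr τ hτ] at h1
    rw [← sq_eq_one_iff, div_pow, mul_pow, hsq, div_eq_one_iff_eq (by positivity)]
    field_simp
    linear_combination h1
  have hs := hσ τ₀ h₀
  -- Z₁ never vanishes, so the sign of Z₁/Z₂ cannot change along the motion.
  have hconst : ∀ τ ∈ I, γ τ 0 / (√((r - 2 * μ) / μ) * γ τ 1) =
      γ τ₀ 0 / (√((r - 2 * μ) / μ) * γ τ₀ 1) := fun τ hτ => sign_const hconn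
    ((hγ 0).div (continuousOn_const.mul (hγ 1)) hkZ) hσ h₀ hτ
  generalize γ τ₀ 0 / (√((r - 2 * μ) / μ) * γ τ₀ 1) = s at hs hconst
  have hZ : ∀ τ ∈ I, γ τ 0 = s * √((r - 2 * μ) / μ) * γ τ 1 := fun τ hτ => by
    rw [mul_assoc]
    exact (div_eq_iff (hkZ τ hτ)).1 (hconst τ hτ)
  have hd : ∀ τ ∈ I, HasDerivAt (fun t => γ t 2)
      (-(s * c ^ 2 * √μ * (3 * μ - r) / (m * r ^ 3 * √(r - 2 * μ)))) τ := fun τ hτ => by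
    refine (h.hasDerivAt_comp hm hμ hτ (HasGrad.coord 2)).congr_deriv ?_
    rw [(hx τ hτ).1.bracket_three_zero_energy hm hμ (hx τ hτ).2, hr τ hτ, hZ τ hτ,
      Real.sqrt_div (by linarith)]
    have h1 := (h τ hτ).1.2.1.ne'
    have h2 := (Real.sqrt_pos.2 hμ).ne'
    have h3 := (Real.sqrt_pos.2 (by linarith : 0 < r - 2 * μ)).ne'
    rcases hs with rfl | rfl <;> field_simp
  refine ⟨s, r, hs, hr2, hr3, hν3, fun τ hτ => ⟨hr τ hτ, ?_, ?_, hZ τ hτ, ?_⟩⟩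
  · rw [eq_add_integral hconn hd continuousOn_const h₀ hτ]
    simp
    ring
  · have h1 := (hz τ hτ).2.2
    rw [hr τ hτ] at h1
    rw [← h1, mul_div_cancel_left₀ _ (by linarith), Real.sqrt_sq (h τ hτ).1.2.1.le]
  · have h1 := mul_of_tulOne (hpos τ hτ).ne' (hx τ hτ).1.2.2.1
    have h2 := (hx τ hτ).1.1.spin_ne_zero hμ (hx τ hτ).1.2.2.2
    rw [hr τ hτ] at h1
    rw [eq_div_iff (mul_ne_zero hr0.ne' h2)]
    linear_combination h1

end SpinningBody

end

theorem mainTheorem2 (m μ c ε : ℝ) (hm : 0 < m) (hμ : 0 < μ) (hc : 0 < c) :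
    -- `Q = 0` is the manifold `P_θ = L₁ = P_φ = 0`, and it is invariant
    (∀ s : SpinningBody.State, SpinningBody.Regular μ s →
      (SpinningBody.vecQ s = 0 ↔ SpinningBody.OnZeroQ s)) ∧
    (∀ (I : Set ℝ) (x : ℝ → SpinningBody.State), IsOpen I → IsPreconnected I →
      SpinningBody.IsMotion m μ I x → ∀ τ₀ ∈ I,
        (SpinningBody.OnZeroQ (x τ₀) → ∀ τ ∈ I, SpinningBody.OnZeroQ (x τ)) ∧
        (SpinningBody.OnZeroQLeaf c ε (x τ₀) → ∀ τ ∈ I,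
          SpinningBody.OnZeroQLeaf c ε (x τ))) ∧
    -- on the leaf `C_⋆ = 0` the Hamiltonian is a function of `E, Z, r, P_r`; `E = 0` if `Q = 0`
    (∀ s : SpinningBody.State, SpinningBody.Regular μ s → SpinningBody.casimirStar s = 0 →
      0 < s.L 1 ^ 2 + s.L 2 ^ 2 →
        SpinningBody.hamiltonian m μ s =
          SpinningBody.hamiltonianRed m μ (-s.P 0) (SpinningBody.vecE s)
            (SpinningBody.redState s) ∧
        (SpinningBody.OnZeroQ s → SpinningBody.vecE s = 0)) ∧
    (∀ x : Fin 5 → ℝ, SpinningBody.RedRegular μ ε x →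
      SpinningBody.hamiltonianZero m μ ε x =
        SpinningBody.hamiltonianZeroExplicit m μ ε x) ∧
    -- the reduced system is Hamiltonian with two degrees of freedom on the leaves `C_∘ = c²`
    SpinningBody.IsPoisson SpinningBody.poissonMatrix ∧
    (∀ x : Fin 5 → ℝ,
      SpinningBody.poissonMatrix x *ᵥ SpinningBody.grad SpinningBody.redCasimir x = 0 ∧
      (SpinningBody.redCasimir x = c ^ 2 → (SpinningBody.poissonMatrix x).rank = 4)) ∧
    -- reduction of the motions
    (∀ (I : Set ℝ) (x : ℝ → SpinningBody.State), IsOpen I →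
      SpinningBody.IsMotion m μ I x →
      (∀ τ ∈ I, SpinningBody.OnZeroQLeaf c ε (x τ)) →
        SpinningBody.IsRedMotion m μ ε I (fun τ => SpinningBody.redState (x τ)) ∧
        ∀ τ ∈ I, SpinningBody.redCasimir (SpinningBody.redState (x τ)) = c ^ 2) ∧
    -- the Tulczyjew condition in the reduced variables
    (∀ s : SpinningBody.State, SpinningBody.Regular μ s → SpinningBody.OnZeroQLeaf c ε s →
      (SpinningBody.tulczyjew μ s = 0 ↔
        SpinningBody.tulOne (SpinningBody.redState s) = 0 ∧
        SpinningBody.tulTwo μ ε (SpinningBody.redState s) = 0)) ∧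
    -- it defines an invariant manifold of the reduced system; `C_∘` and `H₀` are integrals
    (∀ (I : Set ℝ) (γ : ℝ → Fin 5 → ℝ), IsOpen I → IsPreconnected I →
      SpinningBody.IsRedMotion m μ ε I γ → ∀ τ₀ ∈ I, ∀ τ ∈ I,
        SpinningBody.redCasimir (γ τ) = SpinningBody.redCasimir (γ τ₀) ∧
        SpinningBody.hamiltonianZero m μ ε (γ τ) =
          SpinningBody.hamiltonianZero m μ ε (γ τ₀) ∧
        (SpinningBody.tulOne (γ τ₀) = 0 ∧ SpinningBody.tulTwo μ ε (γ τ₀) = 0 →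
          SpinningBody.tulOne (γ τ) = 0 ∧ SpinningBody.tulTwo μ ε (γ τ) = 0)) ∧
    -- its intersection with a leaf is two-dimensional, and `H₀ = p^α p_α / (2m) < 0` there
    (∀ x : Fin 5 → ℝ, SpinningBody.OnTul μ c ε x →
      (SpinningBody.hamiltonianZero m μ ε x = -SpinningBody.massSq μ ε x / (2 * m) ∧
        0 < SpinningBody.massSq μ ε x) ∧
      (x 2 ≠ 0 ∨ 2 * x 3 ^ 2 - 15 * μ * x 3 + 24 * μ ^ 2 ≠ 0 →
        LinearIndependent ℝ ![SpinningBody.grad SpinningBody.redCasimir x,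
          SpinningBody.grad SpinningBody.tulOne x,
          SpinningBody.grad (SpinningBody.tulTwo μ ε) x])) ∧
    -- quadratures for the reduced system, energy different from zero: every solution
    (∀ (ν : ℝ) (I : Set ℝ) (γ : ℝ → Fin 5 → ℝ), 0 < ν → ε ≠ 0 → IsOpen I →
      IsPreconnected I → SpinningBody.IsRedMotion m μ ε I γ →
      (∀ τ ∈ I, SpinningBody.OnTul μ c ε (γ τ) ∧
        SpinningBody.hamiltonianZero m μ ε (γ τ) = -ν ^ 2 / (2 * m)) →
        (∀ τ ∈ I, SpinningBody.radDelta μ c ν (γ τ 3) ≠ 0 ∧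
          SpinningBody.radChi μ c ε ν (γ τ 3) ≠ 0 ∧
          0 ≤ SpinningBody.radR μ c ε ν (γ τ 3) ∧
          (∃ s : ℝ, (s = 1 ∨ s = -1) ∧
            γ τ = SpinningBody.radPoint μ c ε ν s (γ τ 3) ∧
            HasDerivAt (fun t => γ t 3)
              (s * (ν / m) * √(SpinningBody.radR μ c ε ν (γ τ 3)) /
                SpinningBody.radChi μ c ε ν (γ τ 3)) τ)) ∧
        (∀ τ₁ ∈ I, ∀ τ₂ ∈ I, τ₁ < τ₂ →
          (∀ τ ∈ Set.Icc τ₁ τ₂, 0 < SpinningBody.radR μ c ε ν (γ τ 3)) →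
          ∃ s : ℝ, (s = 1 ∨ s = -1) ∧
            (∀ τ ∈ Set.Icc τ₁ τ₂, γ τ = SpinningBody.radPoint μ c ε ν s (γ τ 3)) ∧
            τ₂ - τ₁ = ∫ ρ in (γ τ₁ 3)..(γ τ₂ 3),
              s * (m / ν) * SpinningBody.radChi μ c ε ν ρ /
                √(SpinningBody.radR μ c ε ν ρ))) ∧
    -- conversely, the quadrature yields solutions
    (∀ (ν s : ℝ) (I : Set ℝ) (r : ℝ → ℝ), 0 < ν → ε ≠ 0 → (s = 1 ∨ s = -1) → IsOpen I →
      (∀ τ ∈ I, 2 * μ < r τ ∧ SpinningBody.radDelta μ c ν (r τ) ≠ 0 ∧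
        SpinningBody.radChi μ c ε ν (r τ) ≠ 0 ∧ 0 < SpinningBody.radR μ c ε ν (r τ) ∧
        HasDerivAt r (s * (ν / m) * √(SpinningBody.radR μ c ε ν (r τ)) /
          SpinningBody.radChi μ c ε ν (r τ)) τ) →
        SpinningBody.IsRedMotion m μ ε I
          (fun τ => SpinningBody.radPoint μ c ε ν s (r τ)) ∧
        ∀ τ ∈ I, SpinningBody.OnTul μ c ε (SpinningBody.radPoint μ c ε ν s (r τ)) ∧
          SpinningBody.hamiltonianZero m μ ε (SpinningBody.radPoint μ c ε ν s (r τ)) =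
            -ν ^ 2 / (2 * m)) ∧
    -- energy zero: the radius is constant and `Z₃` is linear in `τ`
    (∀ (ν : ℝ) (I : Set ℝ) (γ : ℝ → Fin 5 → ℝ), 0 < ν → ε = 0 → IsOpen I →
      IsPreconnected I → SpinningBody.IsRedMotion m μ ε I γ →
      (∀ τ ∈ I, SpinningBody.OnTul μ c ε (γ τ) ∧
        SpinningBody.hamiltonianZero m μ ε (γ τ) = -ν ^ 2 / (2 * m)) →
      ∀ τ₀ ∈ I, ∃ s r : ℝ, (s = 1 ∨ s = -1) ∧ 2 * μ < r ∧ r < 3 * μ ∧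
        ν ^ 2 * r ^ 3 = μ * c ^ 2 ∧
        ∀ τ ∈ I, γ τ 3 = r ∧
          γ τ 2 = γ τ₀ 2 - s * c ^ 2 * √μ * (3 * μ - r) /
            (m * r ^ 3 * √(r - 2 * μ)) * (τ - τ₀) ∧
          γ τ 1 = √(μ * (γ τ 2 ^ 2 + c ^ 2) / (3 * μ - r)) ∧
          γ τ 0 = s * √((r - 2 * μ) / μ) * γ τ 1 ∧
          γ τ 4 = -(γ τ 1 * γ τ 2) / (r * γ τ 0)) ∧
    -- the derivative `∂H/∂E₃` vanishes at `E = 0`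
    (∀ x : Fin 5 → ℝ, SpinningBody.RedRegular μ ε x →
      SpinningBody.derivE m μ ε 2 x = 0) ∧
    -- the integral `K` and the recovery of `θ`, `φ`, `t` and of the spin
    (∀ (I : Set ℝ) (x : ℝ → SpinningBody.State), IsOpen I → IsPreconnected I →
      SpinningBody.IsMotion m μ I x →
      (∀ τ ∈ I, SpinningBody.OnZeroQLeaf c ε (x τ)) → ∀ τ₀ ∈ I,
      ∃ κ : ℝ, |κ| ≤ 1 ∧
        (∀ τ ∈ I, SpinningBody.integralK (x τ) = κ ∧
          (x τ).L 1 = κ * SpinningBody.vecZ (x τ) 1 / Real.sin ((x τ).y 2) ∧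
          (x τ).M 0 = -SpinningBody.vecZ (x τ) 0 ∧
          (x τ).M 1 = SpinningBody.vecZ (x τ) 2 * (x τ).L 2 / SpinningBody.vecZ (x τ) 1 ∧
          (x τ).M 2 = -(SpinningBody.vecZ (x τ) 2 * (x τ).L 1) / SpinningBody.vecZ (x τ) 1 ∧
          (∀ s : ℝ, (s = 1 ∨ s = -1) → 0 ≤ s * (x τ).L 2 →
            (x τ).L 2 = s * (SpinningBody.vecZ (x τ) 1 *
              √(1 - κ ^ 2 / Real.sin ((x τ).y 2) ^ 2)) ∧
            HasDerivAt (fun t => (x t).y 2)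
              (s * √(1 - κ ^ 2 / Real.sin ((x τ).y 2) ^ 2) *
                  SpinningBody.derivE m μ ε 1 (SpinningBody.redState (x τ)) -
                κ / Real.sin ((x τ).y 2) *
                  SpinningBody.derivE m μ ε 2 (SpinningBody.redState (x τ))) τ ∧
            HasDerivAt (fun t => (x t).y 3)
              (-(κ / Real.sin ((x τ).y 2) ^ 2) *
                  SpinningBody.derivE m μ ε 1 (SpinningBody.redState (x τ)) -
                s * (1 / Real.sin ((x τ).y 2)) *
                  √(1 - κ ^ 2 / Real.sin ((x τ).y 2) ^ 2) *
                  SpinningBody.derivE m μ ε 2 (SpinningBody.redState (x τ))) τ) ∧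
          HasDerivAt (fun t => (x t).y 0)
            (-SpinningBody.derivEnergy m μ ε (SpinningBody.redState (x τ))) τ) ∧
        (∀ τ ∈ I, ∀ Φ : ℝ,
          Φ = (∫ t in τ₀..τ, SpinningBody.derivE m μ ε 1 (SpinningBody.redState (x t))) →
          Real.cos ((x τ).y 2) =
            Real.cos ((x τ₀).y 2) * Real.cos Φ -
              Real.sin ((x τ₀).y 2) * (x τ₀).L 2 / SpinningBody.vecZ (x τ₀) 1 *
                Real.sin Φ ∧
          Real.sin ((x τ).y 2) * (x τ).L 2 / SpinningBody.vecZ (x τ) 1 =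
            Real.sin ((x τ₀).y 2) * (x τ₀).L 2 / SpinningBody.vecZ (x τ₀) 1 * Real.cos Φ +
              Real.cos ((x τ₀).y 2) * Real.sin Φ ∧
          (x τ).y 3 = (x τ₀).y 3 - ∫ t in τ₀..τ, κ / Real.sin ((x t).y 2) ^ 2 *
            SpinningBody.derivE m μ ε 1 (SpinningBody.redState (x t)) ∧
          (x τ).y 0 = (x τ₀).y 0 - ∫ t in τ₀..τ,
            SpinningBody.derivEnergy m μ ε (SpinningBody.redState (x t)))) ∧
    -- conversely, the reduced system and these equations determine motions of the full system
    (∀ (I : Set ℝ) (x : ℝ → SpinningBody.State) (κ s : ℝ), IsOpen I → (s = 1 ∨ s = -1) →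
      (∀ τ ∈ I, SpinningBody.Regular μ (x τ) ∧ SpinningBody.OnZeroQLeaf c ε (x τ) ∧
        0 < s * (x τ).L 2 ∧ SpinningBody.integralK (x τ) = κ) →
      SpinningBody.IsRedMotion m μ ε I (fun τ => SpinningBody.redState (x τ)) →
      (∀ τ ∈ I,
        HasDerivAt (fun t => (x t).y 2)
          (s * √(1 - κ ^ 2 / Real.sin ((x τ).y 2) ^ 2) *
            SpinningBody.derivE m μ ε 1 (SpinningBody.redState (x τ))) τ ∧
        HasDerivAt (fun t => (x t).y 3)
          (-(κ / Real.sin ((x τ).y 2) ^ 2) *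
            SpinningBody.derivE m μ ε 1 (SpinningBody.redState (x τ))) τ ∧
        HasDerivAt (fun t => (x t).y 0)
          (-SpinningBody.derivEnergy m μ ε (SpinningBody.redState (x τ))) τ) →
      SpinningBody.IsMotion m μ I x) := by
  open SpinningBody in
  refine ⟨fun s hs => vecQ_eq_zero_iff hs, fun I x hI hpc hx τ₀ h₀ => ⟨fun h τ hτ =>
      onZeroQ_invariant hm hμ hI hpc hx h₀ hτ h, fun h τ hτ =>
      onZeroQLeaf_invariant hm hμ hI hpc hx h₀ hτ h⟩,
    fun s hs hC hρ => ⟨hamiltonian_eq_hamiltonianRed hμ hs hC hρ, vecE_eq_zero⟩,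
    fun x hx => hamiltonianZero_eq_explicit hm hμ hx, isPoisson_poissonMatrix,
    fun x => ⟨poissonMatrix_mulVec_redCasimir x, fun h => rank_poissonMatrix fun h1 => ?_⟩,
    fun I x hI hx hN => ⟨isRedMotion_redState hm hμ hc hI hx hN, fun τ hτ =>
      (hN τ hτ).redCasimir_eq hc⟩,
    fun s hs h => tulczyjew_eq_zero_iff hμ hc hs h,
    fun I γ hI hpc h τ₀ h₀ τ hτ => ⟨redCasimir_const hm hμ hI hpc h h₀ hτ,
      hamiltonianZero_const hm hμ hI hpc h h₀ hτ, fun h1 =>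
      tulczyjew_invariant hm hμ hI hpc h h₀ hτ h1.1 h1.2⟩,
    fun x hx => ⟨⟨hx.hamiltonianZero_eq m hμ, hx.massSq_pos hμ hc⟩, hx.linearIndependent hμ⟩,
    fun ν I γ hν hε hI hpc h hx => ⟨fun τ hτ => quadrature_forward hm hμ hc hν hε h hτ
      (hx τ hτ).1 (((hx τ hτ).1.level_iff hm hμ).1 (hx τ hτ).2), fun τ₁ h₁ τ₂ h₂ hlt hR =>
      quadrature_integral hm hμ hc hν hε hpc h (fun τ hτ => ⟨(hx τ hτ).1,
        ((hx τ hτ).1.level_iff hm hμ).1 (hx τ hτ).2⟩) h₁ h₂ hlt hR⟩,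
    fun ν s I r hν hε hs hI h => ⟨quadrature_converse hm hμ hc hν hε hs hI h, fun τ hτ => ?_⟩,
    ?_, fun x hx => derivE_two_eq hm hμ hx, ?_,
    fun I x κ s hI hs hx hred hang => isMotion_of_isRedMotion hm hμ hc hI hs hx hred hang⟩
  -- On the leaf Z₂ = 0 is impossible, as it would give -Z₁² - Z₃² = c² > 0.
  · rw [redCasimir, h1] at h
    have := pow_pos hc 2
    nlinarith [sq_nonneg (x 0), sq_nonneg (x 2)]
  · obtain ⟨h1, h2, -⟩ := onTul_radPoint hμ hc hν hε hs (h τ hτ).1 (h τ hτ).2.1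
      (h τ hτ).2.2.1 (h τ hτ).2.2.2.1
    exact ⟨h1, (h1.level_iff hm hμ).2 h2⟩
  · rintro ν I γ hν rfl hI hpc h hx τ₀ h₀
    exact zero_energy_motion hm hμ hc hν hpc h (fun τ hτ => ⟨(hx τ hτ).1,
      ((hx τ hτ).1.level_iff hm hμ).1 (hx τ hτ).2⟩) h₀
  · intro I x hI hpc hx hN τ₀ h₀
    refine ⟨integralK (x τ₀), (hN τ₀ h₀).abs_integralK_le hc, fun τ hτ => ?_, fun τ hτ Φ hΦ =>
      recovery hm hμ hc hI hpc hx hN h₀ hτ hΦ⟩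
    have hK := integralK_const hm hμ hc hI hpc hx hN h₀ hτ
    have hsin := (hx.regular τ hτ).sin_pos.ne'
    have h := hN τ hτ
    have hZ := (h.vecZ_one_pos hc).ne'
    have hcos := h.cos_eq (hx.regular τ hτ)
    obtain ⟨h2, h3, h0⟩ := hasDerivAt_angles hm hμ hc hx hN hτ
    have hE := derivE_two_eq hm hμ (h.redRegular hμ hc (hx.regular τ hτ))
    rw [← hK]
    refine ⟨rfl, ?_, h.M_zero hc, h.M_one hc, h.M_two hc, fun s hs hL => ⟨?_, ?_, ?_⟩, h0⟩
    · rw [mul_div_right_comm, hcos, div_mul_cancel₀ _ hZ]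
    · rw [mul_left_comm, h.sin_eq hc (hx.regular τ hτ) hs hL, mul_div_cancel₀ _ hZ]
    · rw [h.sin_eq hc (hx.regular τ hτ) hs hL, hE, mul_zero, sub_zero, mul_comm]
      exact h2
    · rw [hE, mul_zero, sub_zero]
      refine h3.congr_deriv ?_
      rw [← hcos]
      field_simp
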